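/- **Proposition 1.2.** Let $S=S_{1,1}$ be the once-punctured torus, $\mathcal T(S)$ its Teichmüller space (complete finite-area hyperbolic metrics up to isotopy, equivalently discrete faithful representations of $\pi_1(S)=\langle a,b\rangle$ into $\mathrm{PSL}(2,\mathbb R)$ with parabolic $[a,b]$, up to conjugation), $\mathcal M(S)=\mathcal T(S)/\mathrm{Mod}(S)$ its moduli space, and $\ell_{sys}(X)$ the length of the shortest closed geodesic of $X\in\mathcal T(S)$. Let $\mathcal{ML}(S)$ be the space of measured laminations, that is, the closure in $\mathbb R_{\ge 0}^{\mathcal S}$ of the functions $w\, i(\gamma,\cdot)$ with $w\ge 0$ and $\gamma\in\mathcal S$, where $\mathcal S$ is the set of isotopy classes of essential non-peripheral simple closed curves and $i$ is the geometric intersection number. A lamination of the form $w\, i(\gamma,\cdot)$ with $w\ge 0$ is called a weighted simple closed curve (so the zero lamination counts as one, of weight $0$). For $X\in\mathcal T(S)$ and $\lambda\in\mathcal{ML}(S)$ let $t\mapsto E_t(X,\lambda)\in\mathcal T(S)$ be the earthquake path (to the left, or to the right), that is, the limit, for weighted simple closed curves $w_n\gamma_n\to\lambda$, of the Fenchel–Nielsen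 twists of $X$ along $\gamma_n$ for the distance $w_n t$. Then for every $X\in\mathcal T(S)$ and every $\lambda\in\mathcal{ML}(S)$ such an earthquake path exists, and for any such path $\lambda$ is a weighted simple closed curve if and only if $$\liminf_{t\to\infty}\ell_{sys}(E_t(X,\lambda))\neq 0 .$$ Equivalently, $\lambda$ is a weighted simple closed curve if and only if there is a compact set $K\subset\mathcal M(S)$ that contains the image of $E_t(X,\lambda)$ for all sufficiently large $t$; so for every other (irrational) $\lambda$ the trajectory leaves every compact subset of $\mathcal M(S)$ at arbitrarily large times. -/

import Mathlib

open Filter Topology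

open scoped MatrixGroups

/-! The fundamental group of the once-punctured torus is free on `a`, `b`, two simple loops that meet
once; the loop around the puncture is the commutator `a b a⁻¹ b⁻¹`. -/

namespace PuncturedTorus

/-- The fundamental group of the once-punctured torus. -/
abbrev Pi1 : Type := FreeGroup (Fin 2)

def genA : Pi1 := FreeGroup.of 0

def genB : Pi1 := FreeGroup.of 1

/-- The peripheral element, a loop around the puncture. -/
def cusp : Pi1 := genA * genB * genA⁻¹ * genB⁻¹

/-! ### Teichmüller space -/

/-- The holonomy representations of the complete finite-area hyperbolic metrics on the
once-punctured torus: faithful as maps to `PSL(2,ℝ)`, with discrete image, and with parabolic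
image of the loop around the puncture. As the fundamental group is free, every homomorphism to
`PSL(2,ℝ)` lifts to `SL(2,ℝ)`; we work with lifts and later identify them. -/
structure FuchsianRep where
  toHom : Pi1 →* SL(2, ℝ)
  faithful : ∀ g, toHom g = 1 ∨ toHom g = -1 → g = 1
  discrete : DiscreteTopology toHom.range
  parabolic : (toHom cusp).val.IsParabolic

/-- The topology of pointwise (algebraic) convergence. -/
instance : TopologicalSpace FuchsianRep :=
  TopologicalSpace.induced (fun ρ (g : Pi1) => ρ.toHom g) inferInstance

/-- Two homomorphisms to `SL(2,ℝ)` that are conjugate as homomorphisms to `PSL(2,ℝ)`. -/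
def ProjConj (ρ σ : Pi1 →* SL(2, ℝ)) : Prop :=
  ∃ C : SL(2, ℝ), ∀ g, σ g = C * ρ g * C⁻¹ ∨ σ g = -(C * ρ g * C⁻¹)

theorem ProjConj.refl (ρ : Pi1 →* SL(2, ℝ)) : ProjConj ρ ρ := ⟨1, fun g => by simp⟩

theorem ProjConj.symm {ρ σ : Pi1 →* SL(2, ℝ)} (h : ProjConj ρ σ) : ProjConj σ ρ := by
  obtain ⟨C, hC⟩ := h
  refine ⟨C⁻¹, fun g => ?_⟩
  rcases hC g with h | h
  · left; rw [h]; group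
  · right; rw [h]; simp [mul_assoc]

theorem ProjConj.trans {ρ σ τ : Pi1 →* SL(2, ℝ)} (h : ProjConj ρ σ) (h' : ProjConj σ τ) :
    ProjConj ρ τ := by
  obtain ⟨C, hC⟩ := h
  obtain ⟨D, hD⟩ := h'
  refine ⟨D * C, fun g => ?_⟩
  rcases hC g with h | h <;> rcases hD g with h' | h' <;> rw [h', h]
  · left; group
  · right; simp [mul_assoc]
  · right; simp [mul_assoc]
  · left; simp [mul_assoc]

instance teichSetoid : Setoid FuchsianRep where
  r ρ σ := ProjConj ρ.toHom σ.toHom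
  iseqv := ⟨fun _ => ProjConj.refl _, fun h => h.symm, fun h h' => h.trans h'⟩

/-- Teichmüller space: holonomy representations up to conjugation in `PSL(2,ℝ)`, with the quotient
topology. Both orientations of the surface are admitted, so this consists of two copies of the usual
space, interchanged by reflection in the upper half-plane; the twist of `IsTwist` is a twist to the
left on one copy and a twist to the right on the other. -/
def Teich : Type := Quotient teichSetoid

instance : TopologicalSpace Teich := inferInstanceAs (TopologicalSpace (Quotient teichSetoid))

def Teich.mk (ρ : FuchsianRep) : Teich := Quotient.mk teichSetoid ρ

/-! ### Mapping classes and moduli space -/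

/-- The automorphisms of the fundamental group that are induced by orientation-preserving
homeomorphisms of the surface: those that preserve the conjugacy class of the oriented loop around
the puncture. -/
def MCG : Subgroup (MulAut Pi1) where
  carrier := {φ | IsConj (φ cusp) cusp}
  one_mem' := IsConj.refl _
  mul_mem' {φ ψ} hφ hψ := (MonoidHom.map_isConj φ.toMonoidHom hψ).trans hφ
  inv_mem' {φ} hφ := by
    have h := (MonoidHom.map_isConj (φ⁻¹ : MulAut Pi1).toMonoidHom hφ).symm
    simpa using h

/-- Two representations are equivalent if they differ by a mapping class and a conjugation. -/
def moduliSetoid : Setoid FuchsianRep where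
  r ρ σ := ∃ φ ∈ MCG, ProjConj (ρ.toHom.comp φ.toMonoidHom) σ.toHom
  iseqv := by
    refine ⟨fun ρ => ⟨1, MCG.one_mem, 1, fun g => by simp⟩, ?_, ?_⟩
    · rintro ρ σ ⟨φ, hφ, h⟩
      refine ⟨φ⁻¹, MCG.inv_mem hφ, ?_⟩
      obtain ⟨C, hC⟩ := h.symm
      exact ⟨C, fun g => by simpa using hC (φ⁻¹ g)⟩
    · rintro ρ σ τ ⟨φ, hφ, h⟩ ⟨ψ, hψ, h'⟩
      refine ⟨φ * ψ, MCG.mul_mem hφ hψ, ProjConj.trans ?_ h'⟩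
      obtain ⟨C, hC⟩ := h
      exact ⟨C, fun g => by simpa using hC (ψ g)⟩

/-- Moduli space, the quotient of Teichmüller space by the mapping class group. -/
def Moduli : Type := Quotient moduliSetoid

instance : TopologicalSpace Moduli := inferInstanceAs (TopologicalSpace (Quotient moduliSetoid))

/-- The projection of Teichmüller space onto moduli space. -/
def Teich.toModuli : Teich → Moduli :=
  Quotient.map' id fun _ _ h => ⟨1, MCG.one_mem, h⟩

/-! ### Lengths -/

/-- The translation length of an isometry of the hyperbolic plane. -/
noncomputable def translationLength (A : SL(2, ℝ)) : ℝ :=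
  ⨅ z : UpperHalfPlane, dist z (A • z)

/-- The length of the shortest closed geodesic: closed geodesics correspond to the conjugacy classes
of hyperbolic elements, their lengths being the translation lengths. -/
noncomputable def systole (X : Teich) : ℝ :=
  sInf {l | ∃ ρ : FuchsianRep, Teich.mk ρ = X ∧
    ∃ g : Pi1, (ρ.toHom g).val.IsHyperbolic ∧ l = translationLength (ρ.toHom g)}

/-! ### Simple closed curves and measured laminations -/

/-- The oriented essential (non-peripheral) simple closed curves: all of them are non-separating, so
they are the images of `a` under the mapping class group. -/
def SimpleCurve : Type := {g : Pi1 // ∃ φ ∈ MCG, φ genA = g}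

/-- The sum of the exponents of the `i`-th generator. -/
def expSum (i : Fin 2) (g : Pi1) : ℤ :=
  (FreeGroup.lift (fun j => Multiplicative.ofAdd (if j = i then (1 : ℤ) else 0)) g).toAdd

/-- The geometric intersection number of simple closed curves, which on the once-punctured torus is
the absolute value of the algebraic one. -/
def inter (γ δ : SimpleCurve) : ℝ :=
  |((expSum 0 γ.1 * expSum 1 δ.1 - expSum 1 γ.1 * expSum 0 δ.1 : ℤ) : ℝ)|

/-- The curve `γ` with weight `w`, as a function on the set of simple closed curves. -/
def weightedCurve (w : ℝ) (γ : SimpleCurve) : SimpleCurve → ℝ := fun δ => w * inter γ δ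

/-- The space of measured laminations in Thurston's description: a lamination is given by its
intersection numbers with all simple closed curves, and the laminations are the limits of weighted
simple closed curves. The zero lamination is included. -/
def ML : Set (SimpleCurve → ℝ) :=
  closure {l | ∃ w : ℝ, 0 ≤ w ∧ ∃ γ : SimpleCurve, l = weightedCurve w γ}

/-- `l` is a weighted simple closed curve; the zero lamination has weight `0`. -/
def IsWeightedCurve (l : SimpleCurve → ℝ) : Prop :=
  ∃ w : ℝ, 0 ≤ w ∧ ∃ γ : SimpleCurve, l = weightedCurve w γ

/-! ### Twists and earthquakes -/

/-- The translation by the signed distance `s` along the axis of the hyperbolic matrix `A`, in the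
direction in which `A` translates; so `A` itself is, up to sign, the translation by
`translationLength A`. -/
noncomputable def axisTranslation (A : SL(2, ℝ)) (s : ℝ) : Matrix (Fin 2) (Fin 2) ℝ :=
  Real.cosh (s / 2) • 1 +
    (Real.sinh (s / 2) * SignType.sign A.val.trace / Real.sqrt (A.val.trace ^ 2 - 4)) •
      ((2 : ℝ) • A.val - A.val.trace • 1)

/-- `Y` is obtained from `X` by the Fenchel-Nielsen twist along the closed geodesic `γ` for the
distance `s`: for a positively oriented pair of generators `φ a = γ` and `φ b`, where `φ b` crosses
`γ` once, the holonomy of `γ` is kept, and that of `φ b` is multiplied by the translation along the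
axis of `γ`. -/
def IsTwist (X : Teich) (γ : SimpleCurve) (s : ℝ) (Y : Teich) : Prop :=
  ∃ φ ∈ MCG, φ genA = γ.1 ∧ ∃ ρ σ : FuchsianRep, Teich.mk ρ = X ∧ Teich.mk σ = Y ∧
    σ.toHom (φ genA) = ρ.toHom (φ genA) ∧
    (σ.toHom (φ genB)).val = (ρ.toHom (φ genB)).val * axisTranslation (ρ.toHom (φ genA)) s

/-- `E t` is the earthquake of `X` along the lamination `l` at time `t`, for all `t`, as Kerckhoff
defines it: the limit of the twists of `X` along `γ` for the distance `w * t`, where the weighted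
curves `w γ` tend to `l`. (The limit exists for all such nets of weighted curves and does not depend
on the net; here one net is required, given by a filter on the set of pairs `(w, γ)`.) -/
def IsEarthquake (X : Teich) (l : SimpleCurve → ℝ) (E : ℝ → Teich) : Prop :=
  ∃ (F : Filter (ℝ × SimpleCurve)) (Y : ℝ × SimpleCurve → ℝ → Teich),
    F.NeBot ∧ (∀ᶠ p in F, 0 ≤ p.1) ∧
    Tendsto (fun p => weightedCurve p.1 p.2) F (𝓝 l) ∧
    (∀ p t, IsTwist X p.2 (p.1 * t) (Y p t)) ∧
    ∀ t, Tendsto (fun p => Y p t) F (𝓝 (E t))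

end PuncturedTorus

open PuncturedTorus

/-! Everything is read off from traces. Two matrices whose commutator has trace `-2` are determined,
up to signs and conjugation by an invertible real matrix, by the absolute traces of `a`, `b`, `ab`,
a positive solution of Markov's equation (`exists_conj_nfHom`); conversely ping-pong on an ideal
quadrilateral makes every solution discrete and faithful (`nfHom_projDiscrete`). Descent on Markov
triples at the modular torus shows that homologous simple closed curves are conjugate
(`isConj_of_expSum_eq`). So a point `X` yields a function `X.m` on primitive classes of `ℤ²`,
subject to `m (u + v) + m (u - v) = m u * m v` and Markov's equation. Laminations are vectors `lam`
of `ℝ²` up to sign, with intersection numbers `|pair lam u|`, and the weighted curves are those with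
`pair lam u = 0` for some primitive `u`.

Along a twist each trace is a sum of exponentials with non-negative coefficients and exponents at
most half the intersection number (`exists_twist_profile`). The resulting estimates survive limits:
along an earthquake every `m u` is convex, differentiable, and has logarithmic derivative at most
`|pair lam u| / 2`. Existence of earthquakes is compactness in trace coordinates.

If `pair lam u = 0`, then `m u` is constant, and at each time `u` extends to a basis whose traces
are bounded in terms of `m u`. This confines the path to a compact part of moduli space, and a gap
in the trace spectrum bounds the systole below.

If `lam` is irrational, suppose that all traces stay above some `κ > 2` at late times
(`Flow.exists_short`). Logarithmic derivatives are superadditive along the Farey path to `lam` but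
bounded by `|pair lam u| / 2`, which shrinks to `0`; hence at a Farey edge around `lam` beyond which
traces grow, the two derivatives have opposite signs. So some `δ` with tiny `|pair lam δ|` is
getting shorter. Wait until its trace is critical and take the Farey edge around `lam` with
difference `δ`. Either an end of that edge is shortening with a trace smaller by the factor `2 / κ`,
and the argument repeats with it, which can happen only finitely often; or the triangle is reduced,
so its traces are bounded in terms of `κ`. The latter contradicts the fact that the length of `lam`
is constant and positive along its earthquake, while it is bounded by a combination of the two
lengths with tiny coefficients (`IsEarthquake.lower`). -/

namespace PuncturedTorus

/-! ### Traces in `SL(2, ℝ)` -/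

/-- The trace of an element of `SL(2, ℝ)`. -/
def tr (A : SL(2, ℝ)) : ℝ := A.val.trace

theorem tr_def (A : SL(2, ℝ)) : tr A = A.val 0 0 + A.val 1 1 := Matrix.trace_fin_two _

theorem det_entries (A : SL(2, ℝ)) : A.val 0 0 * A.val 1 1 - A.val 0 1 * A.val 1 0 = 1 := by
  rw [← Matrix.det_fin_two]; exact A.2

theorem coe_inv_entries (A : SL(2, ℝ)) :
    (A⁻¹).val = !![A.val 1 1, -A.val 0 1; -A.val 1 0, A.val 0 0] := by
  rw [Matrix.SpecialLinearGroup.SL2_inv_expl]; rfl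

theorem tr_inv (A : SL(2, ℝ)) : tr A⁻¹ = tr A := by
  rw [tr_def, tr_def, coe_inv_entries]; simp [add_comm]

theorem tr_mul_comm (A B : SL(2, ℝ)) : tr (A * B) = tr (B * A) := by
  simp only [tr, Matrix.SpecialLinearGroup.coe_mul]
  exact Matrix.trace_mul_comm _ _

theorem tr_conj (A B : SL(2, ℝ)) : tr (B * A * B⁻¹) = tr A := by
  rw [tr_mul_comm]; simp [← mul_assoc]

theorem tr_neg (A : SL(2, ℝ)) : tr (-A) = -tr A := by
  simp [tr]

theorem tr_mul_add (A B : SL(2, ℝ)) : tr (A * B) + tr (A * B⁻¹) = tr A * tr B := by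
  simp only [tr_def, Matrix.SpecialLinearGroup.coe_mul, coe_inv_entries]
  simp [Matrix.mul_apply, Fin.sum_univ_two]
  ring

theorem tr_commutator (A B : SL(2, ℝ)) :
    tr (A * B * A⁻¹ * B⁻¹) =
      tr A ^ 2 + tr B ^ 2 + tr (A * B) ^ 2 - tr A * tr B * tr (A * B) - 2 := by
  have hA := det_entries A
  have hB := det_entries B
  simp only [tr_def, Matrix.SpecialLinearGroup.coe_mul, coe_inv_entries]
  simp [Matrix.mul_apply, Fin.sum_univ_two]
  generalize A.val 0 0 = a at *
  generalize A.val 0 1 = b at *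
  generalize A.val 1 0 = c at *
  generalize A.val 1 1 = d at *
  generalize B.val 0 0 = e at *
  generalize B.val 0 1 = f at *
  generalize B.val 1 0 = g at *
  generalize B.val 1 1 = h at *
  linear_combination (e ^ 2 + h ^ 2 + 2 * f * g) * hA +
    (a ^ 2 + d ^ 2 + 2 * b * c + 2 * (a * d - b * c) - 2) * hB

theorem continuous_tr : Continuous tr := by
  unfold tr
  exact (continuous_subtype_val).matrix_trace

/-! ### The normal form -/

/-- The positive solutions of Markov's equation `x² + y² + z² = x y z`. -/
def Triples : Set (ℝ × ℝ × ℝ) :=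
  {p | 0 < p.1 ∧ 0 < p.2.1 ∧ 0 < p.2.2 ∧ p.1 ^ 2 + p.2.1 ^ 2 + p.2.2 ^ 2 = p.1 * p.2.1 * p.2.2}

/-- The first matrix of the normal form. -/
noncomputable def nfA (x y z : ℝ) : Matrix (Fin 2) (Fin 2) ℝ :=
  !![z / y, x / y; x / y, x - z / y]

/-- The second matrix of the normal form. -/
def nfB (y : ℝ) : Matrix (Fin 2) (Fin 2) ℝ := !![y, 1; -1, 0]

theorem eigenvalue_eq {B : Matrix (Fin 2) (Fin 2) ℝ} (hB : B.det = 1) {v : Fin 2 → ℝ} (hv : v ≠ 0)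
    {k : ℝ} (h : B.mulVec v = k • v) : k ^ 2 - B.trace * k + 1 = 0 := by
  have h0 := congrFun h 0
  have h1 := congrFun h 1
  simp [Matrix.mulVec, dotProduct, Fin.sum_univ_two] at h0 h1
  rw [Matrix.det_fin_two] at hB
  rw [Matrix.trace_fin_two]
  have hv' : v 0 ≠ 0 ∨ v 1 ≠ 0 := by
    by_contra! hh
    exact hv (by ext i; fin_cases i <;> simp [hh.1, hh.2])
  rcases hv' with hv | hv
  · apply mul_left_cancel₀ hv
    linear_combination (B 1 1 - k) * h0 - B 0 1 * h1 - v 0 * hB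
  · apply mul_left_cancel₀ hv
    linear_combination (B 0 0 - k) * h1 - B 1 0 * h0 - v 1 * hB

/-- Trace `-2` and determinant `1` make `-1` an eigenvalue of the commutator. An eigenvector `v` and
`w = B⁻¹ v` form the basis: there `B` is `nfB` by Cayley-Hamilton, and the relation `A⁻¹ C = B A⁻¹
B⁻¹` applied to `v`, together with the traces, fixes the entries of `A`. -/
theorem exists_conj_normalForm (A B : SL(2, ℝ)) (hC : tr (A * B * A⁻¹ * B⁻¹) = -2)
    (hB : tr B ≠ 0) :
    ∃ M : Matrix (Fin 2) (Fin 2) ℝ, M.det ≠ 0 ∧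
      A.val * M = M * nfA (tr A) (tr B) (tr (A * B)) ∧ B.val * M = M * nfB (tr B) := by
  set C := A * B * A⁻¹ * B⁻¹ with hCdef
  have hdet : (C.val + 1).det = 0 := by
    have h1 := det_entries C
    have h2 := tr_def C
    rw [Matrix.det_fin_two]
    simp
    linarith
  obtain ⟨v, hv, hCv⟩ := Matrix.exists_mulVec_eq_zero_iff.2 hdet
  have hCv' : C.val.mulVec v = -v := by
    rw [Matrix.add_mulVec, Matrix.one_mulVec] at hCv
    exact eq_neg_of_add_eq_zero_left hCv
  set w := (B⁻¹).val.mulVec v with hw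
  have hBw : B.val.mulVec w = v := by
    rw [hw, Matrix.mulVec_mulVec, ← Matrix.SpecialLinearGroup.coe_mul]; simp
  have hrel : B.val.mulVec ((A⁻¹).val.mulVec w) = -(A⁻¹).val.mulVec v := by
    have hg : A⁻¹ * C = B * (A⁻¹ * B⁻¹) := by rw [hCdef]; group
    have : (A⁻¹).val.mulVec (C.val.mulVec v) = B.val.mulVec ((A⁻¹).val.mulVec w) := by
      rw [hw, Matrix.mulVec_mulVec, Matrix.mulVec_mulVec, Matrix.mulVec_mulVec,
        ← Matrix.SpecialLinearGroup.coe_mul, hg, Matrix.SpecialLinearGroup.coe_mul,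
        Matrix.SpecialLinearGroup.coe_mul, Matrix.mul_assoc]
    rw [← this, hCv', Matrix.mulVec_neg]
  let M : Matrix (Fin 2) (Fin 2) ℝ := !![v 0, w 0; v 1, w 1]
  have hM : M.det ≠ 0 := by
    -- If `w = k v`, then `v` and `A⁻¹ v` are eigenvectors of `B` for the eigenvalues `k⁻¹` and
    -- `-k⁻¹`; subtracting the two characteristic equations gives `tr B = 0`.
    intro h0
    obtain ⟨k, hk⟩ : ∃ k : ℝ, w = k • v := by
      simp [M, Matrix.det_fin_two] at h0
      have hv' : v 0 ≠ 0 ∨ v 1 ≠ 0 := by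
        by_contra! hh
        exact hv (by ext i; fin_cases i <;> simp [hh.1, hh.2])
      rcases hv' with h | h
      · refine ⟨w 0 / v 0, ?_⟩
        ext i; fin_cases i <;> simp <;> field_simp
        linarith
      · refine ⟨w 1 / v 1, ?_⟩
        ext i; fin_cases i <;> simp <;> field_simp
        linarith
    have hk0 : k ≠ 0 := by
      rintro rfl
      rw [hk] at hBw
      simp at hBw
      exact hv hBw.symm
    have e1 : B.val.mulVec v = k⁻¹ • v := by
      rw [hk, Matrix.mulVec_smul] at hBw
      rw [eq_inv_smul_iff₀ hk0, hBw]
    have e2 : B.val.mulVec ((A⁻¹).val.mulVec v) = (-k⁻¹) • (A⁻¹).val.mulVec v := by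
      rw [hk, Matrix.mulVec_smul, Matrix.mulVec_smul] at hrel
      rw [neg_smul, ← smul_neg, eq_inv_smul_iff₀ hk0, hrel]
    have hu : (A⁻¹).val.mulVec v ≠ 0 := by
      intro hu
      have : A.val.mulVec ((A⁻¹).val.mulVec v) = v := by
        rw [Matrix.mulVec_mulVec, ← Matrix.SpecialLinearGroup.coe_mul]; simp
      rw [hu] at this
      simp at this
      exact hv this.symm
    have q1 := eigenvalue_eq B.2 hv e1
    have q2 := eigenvalue_eq B.2 hu e2
    have : B.val.trace * k⁻¹ = 0 := by linarith
    rcases mul_eq_zero.1 this with h | h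
    · exact hB h
    · exact hk0 (by simpa using h)
  have hMu : IsUnit M.det := isUnit_iff_ne_zero.2 hM
  have hMv : M.mulVec ![1, 0] = v := by
    ext i; fin_cases i <;> simp [M, Matrix.mulVec, dotProduct, Fin.sum_univ_two]
  have hMw : M.mulVec ![0, 1] = w := by
    ext i; fin_cases i <;> simp [M, Matrix.mulVec, dotProduct, Fin.sum_univ_two]
  have hBM : B.val * M = M * nfB (tr B) := by
    have h0 := congrFun hBw 0
    have h1 := congrFun hBw 1
    have w0 := congrFun hw 0
    have w1 := congrFun hw 1
    rw [coe_inv_entries] at w0 w1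
    simp [Matrix.mulVec, dotProduct, Fin.sum_univ_two] at h0 h1 w0 w1
    ext i j
    fin_cases i <;> fin_cases j <;>
      simp [M, nfB, Matrix.mul_apply, Fin.sum_univ_two, tr_def] <;> linarith
  refine ⟨M, hM, ?_, hBM⟩
  obtain ⟨N, hN⟩ : ∃ N : Matrix (Fin 2) (Fin 2) ℝ, A.val * M = M * N :=
    ⟨M⁻¹ * (A.val * M), by
      rw [← Matrix.mul_assoc, Matrix.mul_nonsing_inv _ hMu, Matrix.one_mul]⟩
  have hNeq : N = M⁻¹ * (A.val * M) := by
    rw [hN, ← Matrix.mul_assoc, Matrix.nonsing_inv_mul _ hMu, Matrix.one_mul]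
  have hNdet : N.det = 1 := by
    have := congrArg Matrix.det hN
    rw [Matrix.det_mul, Matrix.det_mul, A.2, one_mul] at this
    exact (mul_left_cancel₀ hM (by rw [mul_one]; exact this)).symm
  have hNtr : N.trace = tr A := by
    rw [hNeq, Matrix.trace_mul_comm, Matrix.mul_assoc, Matrix.mul_nonsing_inv _ hMu, Matrix.mul_one,
      tr]
  have hNB : (N * nfB (tr B)).trace = tr (A * B) := by
    have : N * nfB (tr B) = M⁻¹ * (A.val * B.val * M) := by
      have h3 : A.val * B.val * M = M * (N * nfB (tr B)) := by
        rw [Matrix.mul_assoc, hBM, ← Matrix.mul_assoc, hN, Matrix.mul_assoc]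
      rw [h3, ← Matrix.mul_assoc, Matrix.nonsing_inv_mul _ hMu, Matrix.one_mul]
    rw [this, Matrix.trace_mul_comm, Matrix.mul_assoc, Matrix.mul_nonsing_inv _ hMu, Matrix.mul_one,
      tr, Matrix.SpecialLinearGroup.coe_mul]
  have hAi : (A⁻¹).val * M = M * N.adjugate := by
    have h1 : (A⁻¹).val * (A.val * M) = M := by
      rw [← Matrix.mul_assoc, ← Matrix.SpecialLinearGroup.coe_mul]; simp
    rw [hN] at h1
    calc (A⁻¹).val * M = (A⁻¹).val * (M * N) * N.adjugate := by
          rw [Matrix.mul_assoc, Matrix.mul_assoc, Matrix.mul_adjugate, hNdet]; simp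
      _ = M * N.adjugate := by rw [h1]
  have hrel' : (nfB (tr B) * N.adjugate).mulVec ![0, 1] = -N.adjugate.mulVec ![1, 0] := by
    have h2 : M.mulVec ((nfB (tr B) * N.adjugate).mulVec ![0, 1]) =
        M.mulVec (-N.adjugate.mulVec ![1, 0]) := by
      rw [Matrix.mulVec_neg, Matrix.mulVec_mulVec, Matrix.mulVec_mulVec, ← Matrix.mul_assoc, ← hBM,
        Matrix.mul_assoc, ← hAi, ← Matrix.mulVec_mulVec, ← Matrix.mulVec_mulVec, hMw, hrel,
        ← Matrix.mulVec_mulVec, hMv]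
    have := congrArg (M⁻¹).mulVec h2
    simpa only [Matrix.mulVec_mulVec, ← Matrix.mul_assoc, Matrix.nonsing_inv_mul _ hMu,
      Matrix.one_mul, Matrix.one_mulVec] using this
  have r0 := congrFun hrel' 0
  have r1 := congrFun hrel' 1
  rw [Matrix.trace_fin_two] at hNtr hNB
  simp [nfB, Matrix.adjugate_fin_two, Matrix.mulVec, dotProduct, Fin.sum_univ_two,
    Matrix.mul_apply] at r0 r1 hNB
  rw [hN]
  congr 1
  have e01 : N 0 1 = tr A / tr B := by
    rw [eq_div_iff hB]; linarith
  have e00 : N 0 0 = tr (A * B) / tr B := by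
    rw [eq_div_iff hB]; linarith
  ext i j
  fin_cases i <;> fin_cases j <;> simp [nfA]
  · exact e00
  · exact e01
  · linarith
  · linarith

/-! ### Ping-pong for the normal form

The four sides of an ideal quadrilateral with vertices `v₀, v₁, v₂, v₃` are labelled by the letters
of the free group; the frame of a letter consists of the end points of its side. A letter maps the
frames of all letters but its inverse into the cone over its own frame. -/

abbrev Letter : Type := Fin 2 × Bool

section Frames

variable (al be ga : ℝ)

/-- The matrix of a letter in the basis `v₀, v₁`. -/
noncomputable def letterMat : Letter → Matrix (Fin 2) (Fin 2) ℝ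
  | (0, true) => !![be, al; al, ga]
  | (0, false) => !![ga, -al; -al, be]
  | (1, true) => !![(be + ga) / al, 1; -1, 0]
  | (1, false) => !![0, -1; 1, (be + ga) / al]

/-- The side of the ideal quadrilateral that belongs to a letter. -/
def frame : Letter → Matrix (Fin 2) (Fin 2) ℝ
  | (0, true) => !![1, 0; 0, 1]
  | (0, false) => !![-al, -ga; be, al]
  | (1, true) => !![-ga, -1; al, 0]
  | (1, false) => !![0, -al; 1, be]

/-- The matrix of the letter `s` with respect to the frames of `t` and of `s`, up to sign. -/
noncomputable def trans : Letter → Letter → Matrix (Fin 2) (Fin 2) ℝ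
  | (0, true), (1, true) => !![1, be; 0, al]
  | (0, false), (1, false) => !![1, be; 0, al]
  | (1, true), (0, false) => !![1, ga / al; 0, 1 / al]
  | (1, false), (0, true) => !![1, ga / al; 0, 1 / al]
  | (0, true), (1, false) => !![al, 0; ga, 1]
  | (0, false), (1, true) => !![al, 0; ga, 1]
  | (1, true), (0, true) => !![1 / al, 0; be / al, 1]
  | (1, false), (0, false) => !![1 / al, 0; be / al, 1]
  | (0, _), (0, _) => !![be, al; al, ga]
  | (1, _), (1, _) => !![ga / al, 1 / al; 1 / al, be / al]

variable {al be ga}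

/-- The ping-pong step in matrix form: in terms of frames every letter becomes a matrix with
non-negative entries. The sign is lost because cones are projective. A letter followed by its
inverse is excluded, so the values of `trans` at such pairs are mere fillers. -/
theorem letterMat_mul_frame (ha : 0 < al) (hb : 0 < be) (h : be * ga = 1 + al ^ 2) :
    ∀ s t : Letter, (s.1 = t.1 → s.2 = t.2) →
      letterMat al be ga s * frame al be ga t = frame al be ga s * trans al be ga s t ∨
      letterMat al be ga s * frame al be ga t = -(frame al be ga s * trans al be ga s t) := by
  have hb' := hb.ne'
  have ha' := ha.ne'
  obtain rfl : ga = (1 + al ^ 2) / be := by rw [eq_div_iff hb']; linarith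
  rintro ⟨i, s⟩ ⟨j, t⟩ hst
  fin_cases i <;> fin_cases j <;> cases s <;> cases t <;>
  simp at hst <;>
  first
  | (left; ext i j; fin_cases i <;> fin_cases j <;>
      simp [letterMat, frame, trans, Matrix.mul_apply, Fin.sum_univ_two] <;> field_simp <;> ring1)
  | (right; ext i j; fin_cases i <;> fin_cases j <;>
      simp [letterMat, frame, trans, Matrix.mul_apply, Fin.sum_univ_two] <;> field_simp <;> ring1)

/-- The product of the matrices `frame s * v` and so on: it is negative if and only if the line
through `v` lies outside the closed cone of the frame. -/
def coneForm (F : Matrix (Fin 2) (Fin 2) ℝ) (v : Fin 2 → ℝ) : ℝ :=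
  F.adjugate.mulVec v 0 * F.adjugate.mulVec v 1

theorem coneForm_neg (F : Matrix (Fin 2) (Fin 2) ℝ) (v : Fin 2 → ℝ) :
    coneForm F (-v) = coneForm F v := by
  simp only [coneForm, Matrix.mulVec_neg, Pi.neg_apply]; ring

theorem coneForm_nonneg (F : Matrix (Fin 2) (Fin 2) ℝ) {c : Fin 2 → ℝ} (hc : ∀ i, 0 ≤ c i) :
    0 ≤ coneForm F (F.mulVec c) := by
  rw [coneForm, Matrix.mulVec_mulVec, Matrix.adjugate_mul]
  have : (F.det • (1 : Matrix (Fin 2) (Fin 2) ℝ)).mulVec c = F.det • c := by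
    rw [Matrix.smul_mulVec, Matrix.one_mulVec]
  rw [this]
  have := mul_nonneg (hc 0) (hc 1)
  simp only [Pi.smul_apply, smul_eq_mul]
  nlinarith [mul_nonneg this (sq_nonneg F.det)]

/-- The sum of the end vectors of one side lies strictly outside the cone of any other side. Being
strict, this persists for matrices near the identity. -/
theorem coneForm_frame_neg (ha : 0 < al) (hb : 0 < be) (hg : 0 < ga) (h : be * ga = 1 + al ^ 2) :
    ∀ s t : Letter, s ≠ t →
      coneForm (frame al be ga s) ((frame al be ga t).mulVec ![1, 1]) < 0 := by
  rintro ⟨i, s⟩ ⟨j, t⟩ hst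
  fin_cases i <;> fin_cases j <;> cases s <;> cases t <;>
  simp at hst <;>
  simp [coneForm, frame, Matrix.adjugate_fin_two, Matrix.mulVec, dotProduct, Fin.sum_univ_two] <;>
  first
  | exact mul_neg_of_pos_of_neg (by nlinarith) (by nlinarith)
  | exact mul_neg_of_neg_of_pos (by nlinarith) (by nlinarith)
  | linarith
  | positivity

/-- The product of the matrices of a word. -/
noncomputable def wordMat (al be ga : ℝ) (L : List Letter) : Matrix (Fin 2) (Fin 2) ℝ :=
  (L.map (letterMat al be ga)).prod

/-- The product of the transition matrices along a word, starting in the frame of `t`. -/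
noncomputable def chainMat (al be ga : ℝ) : List Letter → Letter → Matrix (Fin 2) (Fin 2) ℝ
  | [], _ => 1
  | s :: L, t => trans al be ga s (L.head?.getD t) * chainMat al be ga L t

theorem isReduced_cons_append {s t : Letter} {L : List Letter}
    (h : FreeGroup.IsReduced (s :: L ++ [t])) :
    (s.1 = (L.head?.getD t).1 → s.2 = (L.head?.getD t).2) ∧ FreeGroup.IsReduced (L ++ [t]) := by
  cases L with
  | nil =>
    rw [List.cons_append, List.nil_append, FreeGroup.isReduced_cons_cons] at h
    exact h
  | cons u L =>
    rw [List.cons_append, List.cons_append, FreeGroup.isReduced_cons_cons] at h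
    exact h

/-- The frames telescope along a reduced word. The letter `t` is where the word starts to act; `getD
t` covers the empty word. -/
theorem wordMat_mul_frame (ha : 0 < al) (hb : 0 < be) (h : be * ga = 1 + al ^ 2) (t : Letter) :
    ∀ L : List Letter, FreeGroup.IsReduced (L ++ [t]) →
      wordMat al be ga L * frame al be ga t =
        frame al be ga (L.head?.getD t) * chainMat al be ga L t ∨
      wordMat al be ga L * frame al be ga t =
        -(frame al be ga (L.head?.getD t) * chainMat al be ga L t) := by
  intro L
  induction L with
  | nil => intro _; left; simp [wordMat, chainMat]
  | cons s L ih =>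
    intro hL
    obtain ⟨hs, hL'⟩ := isReduced_cons_append hL
    have e : wordMat al be ga (s :: L) * frame al be ga t =
        letterMat al be ga s * (wordMat al be ga L * frame al be ga t) := by
      simp [wordMat, Matrix.mul_assoc]
    rw [e]
    rcases ih hL' with h1 | h1 <;> rcases letterMat_mul_frame ha hb h s _ hs with h2 | h2 <;>
      rw [h1] <;> simp only [chainMat, List.head?_cons, Option.getD_some, Matrix.mul_neg,
        ← Matrix.mul_assoc, h2, Matrix.neg_mul, neg_neg] <;> simp

/-- Matrices with non-negative entries and positive determinant. -/
structure NonnegMat (M : Matrix (Fin 2) (Fin 2) ℝ) : Prop where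
  nonneg : ∀ i j, 0 ≤ M i j
  det_pos : 0 < M.det

theorem NonnegMat.one : NonnegMat 1 := by
  refine ⟨fun i j => ?_, by simp⟩
  fin_cases i <;> fin_cases j <;> simp

theorem NonnegMat.mul {M N : Matrix (Fin 2) (Fin 2) ℝ} (hM : NonnegMat M) (hN : NonnegMat N) :
    NonnegMat (M * N) := by
  refine ⟨fun i j => ?_, by rw [Matrix.det_mul]; exact mul_pos hM.2 hN.2⟩
  rw [Matrix.mul_apply]
  exact Finset.sum_nonneg fun k _ => mul_nonneg (hM.1 _ _) (hN.1 _ _)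

theorem NonnegMat.trans (ha : 0 < al) (hb : 0 < be) (hg : 0 < ga) (h : be * ga = 1 + al ^ 2) :
    ∀ s t : Letter, NonnegMat (trans al be ga s t) := by
  have key : 0 < ga / al * (be / al) - al⁻¹ * al⁻¹ := by
    have : ga / al * (be / al) - al⁻¹ * al⁻¹ = 1 := by
      field_simp; linarith
    rw [this]; exact one_pos
  rintro ⟨i, s⟩ ⟨j, t⟩
  fin_cases i <;> fin_cases j <;> cases s <;> cases t <;>
  (refine ⟨fun i j => ?_, ?_⟩
   · fin_cases i <;> fin_cases j <;> simp [PuncturedTorus.trans] <;> positivity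
   · simp [PuncturedTorus.trans, Matrix.det_fin_two]
     first | exact key | nlinarith)

theorem NonnegMat.chainMat (ha : 0 < al) (hb : 0 < be) (hg : 0 < ga) (h : be * ga = 1 + al ^ 2)
    (t : Letter) : ∀ L : List Letter, NonnegMat (chainMat al be ga L t)
  | [] => NonnegMat.one
  | _ :: L => (NonnegMat.trans ha hb hg h _ _).mul (NonnegMat.chainMat ha hb hg h t L)

end Frames

/-! ### The normal form as a representation -/

theorem nfA_det {x y z : ℝ} (hy : y ≠ 0) (h : x ^ 2 + y ^ 2 + z ^ 2 = x * y * z) :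
    (nfA x y z).det = 1 := by
  rw [nfA, Matrix.det_fin_two_of]
  field_simp
  linarith

/-- The first generator of the normal form. -/
noncomputable def nfGenA (p : Triples) : SL(2, ℝ) :=
  ⟨nfA p.1.1 p.1.2.1 p.1.2.2, nfA_det p.2.2.1.ne' p.2.2.2.2⟩

/-- The second generator of the normal form. -/
def nfGenB (p : Triples) : SL(2, ℝ) := ⟨nfB p.1.2.1, by simp [nfB, Matrix.det_fin_two]⟩

/-- The representation in normal form with traces `p`. -/
noncomputable def nfHom (p : Triples) : Pi1 →* SL(2, ℝ) :=
  FreeGroup.lift ![nfGenA p, nfGenB p]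

theorem nfHom_genA (p : Triples) : nfHom p genA = nfGenA p := by simp [nfHom, genA]

theorem nfHom_genB (p : Triples) : nfHom p genB = nfGenB p := by simp [nfHom, genB]

/-- No element but the identity is mapped near the identity of `PSL(2, ℝ)`. -/
def ProjDiscrete (ρ : Pi1 →* SL(2, ℝ)) : Prop :=
  ∃ U ∈ 𝓝 (1 : SL(2, ℝ)), ∀ g, ρ g ∈ U ∨ -ρ g ∈ U → g = 1

/-! ### The normal form satisfies the hypotheses of ping-pong -/

section Parameters

variable (p : Triples)

/-- The frame parameters that belong to a triple. -/
noncomputable def parA : ℝ := p.1.1 / p.1.2.1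

noncomputable def parB : ℝ := p.1.2.2 / p.1.2.1

noncomputable def parC : ℝ := p.1.1 - p.1.2.2 / p.1.2.1

theorem parA_pos : 0 < parA p := div_pos p.2.1 p.2.2.1

theorem parB_pos : 0 < parB p := div_pos p.2.2.2.1 p.2.2.1

theorem par_rel : parB p * parC p = 1 + parA p ^ 2 := by
  obtain ⟨⟨x, y, z⟩, hx, hy, hz, h⟩ := p
  simp only [parA, parB, parC] at *
  field_simp
  linarith

theorem parC_pos : 0 < parC p := by
  have h := par_rel p
  have : 0 < parB p * parC p := by rw [h]; positivity
  exact (pos_iff_pos_of_mul_pos this).1 (parB_pos p)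

theorem letterMat_par (i : Fin 2) (b : Bool) :
    letterMat (parA p) (parB p) (parC p) (i, b) =
      (cond b (![nfGenA p, nfGenB p] i) (![nfGenA p, nfGenB p] i)⁻¹ : SL(2, ℝ)).val := by
  have hy := p.2.2.1.ne'
  have hx := p.2.1.ne'
  have key : (parB p + parC p) / parA p = p.1.2.1 := by
    simp only [parA, parB, parC]
    field_simp
    ring
  fin_cases i <;> cases b
  · simp only [cond_false]
    rw [coe_inv_entries]
    simp [letterMat, nfGenA, nfA, parA, parB, parC]
  · simp only [cond_true]
    simp [letterMat, nfGenA, nfA, parA, parB, parC]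
  · simp only [cond_false]
    rw [coe_inv_entries]
    simp [letterMat, nfGenB, nfB, key]
  · simp only [cond_true]
    simp [letterMat, nfGenB, nfB, key]

theorem wordMat_par (L : List Letter) :
    wordMat (parA p) (parB p) (parC p) L = (nfHom p (FreeGroup.mk L)).val := by
  rw [nfHom, FreeGroup.lift_mk, wordMat]
  induction L with
  | nil => simp
  | cons s L ih =>
    rw [List.map_cons, List.prod_cons, ih, List.map_cons, List.prod_cons,
      Matrix.SpecialLinearGroup.coe_mul, letterMat_par p s.1 s.2]

theorem exists_letter (s t : Letter) : ∃ u : Letter, u ≠ s ∧ (t.1 = u.1 → t.2 = u.2) := by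
  revert s t; decide

/-- A non-trivial reduced word maps the middle of the side `u` into the cone of its first letter,
provided that `u` is not inverse to its last letter. If `u` also differs from the first letter, an
element near `±1` keeps that point outside the cone. -/
theorem nfHom_projDiscrete : ProjDiscrete (nfHom p) := by
  set al := parA p
  set be := parB p
  set ga := parC p
  have ha : 0 < al := parA_pos p
  have hb : 0 < be := parB_pos p
  have hc : 0 < ga := parC_pos p
  have hr : be * ga = 1 + al ^ 2 := par_rel p
  let φ : Letter → Letter → SL(2, ℝ) → ℝ := fun s t g =>
    coneForm (frame al be ga s) (g.val.mulVec ((frame al be ga t).mulVec ![1, 1]))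
  have hφ : ∀ s t, Continuous (φ s t) := by
    intro s t
    have hv : ∀ i j : Fin 2, Continuous fun g : SL(2, ℝ) => g.val i j := fun i j =>
      (continuous_apply_apply i j).comp continuous_subtype_val
    simp only [φ, coneForm, Matrix.mulVec, dotProduct, Fin.sum_univ_two]
    fun_prop (disch := exact hv _ _)
  refine ⟨{g | ∀ s t, s ≠ t → φ s t g < 0}, ?_, ?_⟩
  · have : {g : SL(2, ℝ) | ∀ s t, s ≠ t → φ s t g < 0} =
        ⋂ s, ⋂ t, ⋂ (_ : s ≠ t), {g | φ s t g < 0} := by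
      ext g; simp
    rw [this]
    refine IsOpen.mem_nhds ?_ ?_
    · exact isOpen_iInter_of_finite fun s => isOpen_iInter_of_finite fun t =>
        isOpen_iInter_of_finite fun _ => isOpen_lt (hφ s t) continuous_const
    · simp only [Set.mem_iInter, Set.mem_ofPred_eq, φ]
      intro s t hst
      rw [Matrix.SpecialLinearGroup.coe_one, Matrix.one_mulVec]
      exact coneForm_frame_neg ha hb hc hr s t hst
  · intro g hg
    by_contra hg1
    have hne : g.toWord ≠ [] := by rwa [Ne, FreeGroup.toWord_eq_nil_iff]
    obtain ⟨u, hu1, hu2⟩ := exists_letter (g.toWord.head hne) (g.toWord.getLast hne)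
    have hred : FreeGroup.IsReduced (g.toWord ++ [u]) := by
      refine List.isChain_append.2 ⟨FreeGroup.isReduced_toWord, List.isChain_singleton _, ?_⟩
      intro x hx y hy
      rw [List.getLast?_eq_getLast_of_ne_nil hne] at hx
      simp at hx hy
      subst hx hy
      exact hu2
    have hw := wordMat_mul_frame ha hb hr u g.toWord hred
    have hhead : g.toWord.head?.getD u = g.toWord.head hne := by
      rw [List.head?_eq_some_head hne]; rfl
    rw [hhead, wordMat_par, FreeGroup.mk_toWord] at hw
    have hnn : 0 ≤ φ (g.toWord.head hne) u (nfHom p g) := by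
      have hN := NonnegMat.chainMat ha hb hc hr u g.toWord
      have hcv : ∀ i, 0 ≤ (chainMat al be ga g.toWord u).mulVec ![1, 1] i := by
        intro i
        simp only [Matrix.mulVec, dotProduct, Fin.sum_univ_two]
        have := hN.1 i 0
        have := hN.1 i 1
        simp; linarith
      have := coneForm_nonneg (frame al be ga (g.toWord.head hne)) hcv
      simp only [φ, Matrix.mulVec_mulVec] at this ⊢
      rcases hw with hw | hw
      · rw [hw]; exact this
      · rw [hw, Matrix.neg_mulVec, coneForm_neg]; exact this
    have hlt : φ (g.toWord.head hne) u (nfHom p g) < 0 := by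
      rcases hg with hg | hg
      · exact hg _ _ hu1.symm
      · have := hg _ _ hu1.symm
        simp only [φ] at this ⊢
        rwa [Matrix.SpecialLinearGroup.coe_neg, Matrix.neg_mulVec, coneForm_neg] at this
    exact absurd hlt (not_lt.2 hnn)

end Parameters

/-! ### Fuchsian representations and the normal form -/

theorem cusp_ne_one : cusp ≠ 1 := by
  unfold cusp genA genB; decide

theorem eq_one_or_eq_neg_one_of_scalar {A : SL(2, ℝ)}
    (h : A.val ∈ Set.range (Matrix.scalar (Fin 2))) :
    A = 1 ∨ A = -1 := by
  obtain ⟨k, hk⟩ := h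
  have hd := A.2
  rw [← hk] at hd
  have hk2 : k ^ 2 = 1 := by
    have : (Matrix.scalar (Fin 2) k).det = k ^ 2 := by simp
    rw [← this]; exact hd
  rcases mul_self_eq_one_iff.1 ((pow_two k).symm.trans hk2) with h | h
  · left; ext i j; rw [← hk, h]; simp
  · right; ext i j; rw [← hk, h]; simp [Matrix.diagonal_apply, Matrix.one_apply]; split_ifs <;> simp

/-- The commutator fixes a vector, so in a suitable basis it is upper unipotent. The relation `A B =
C B A` then makes it trivial or `A` upper triangular; in the second case its conjugate by `A` is
upper unipotent too. -/
theorem commute_of_tr_commutator_eq_two {A B : SL(2, ℝ)} (h : tr (A * B * A⁻¹ * B⁻¹) = 2) :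
    Commute (A * B * A⁻¹ * B⁻¹) (A * (A * B * A⁻¹ * B⁻¹) * A⁻¹) := by
  set C := A * B * A⁻¹ * B⁻¹ with hC
  have hdet : (C.val - 1).det = 0 := by
    have h1 := det_entries C
    have h2 := tr_def C
    rw [Matrix.det_fin_two]
    simp
    linarith
  obtain ⟨v, hv, hCv⟩ := Matrix.exists_mulVec_eq_zero_iff.2 hdet
  have hn : v 0 ^ 2 + v 1 ^ 2 ≠ 0 := by
    intro h0
    apply hv
    have h0' : v 0 = 0 := by nlinarith [sq_nonneg (v 0), sq_nonneg (v 1)]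
    have h1' : v 1 = 0 := by nlinarith [sq_nonneg (v 0), sq_nonneg (v 1)]
    ext i; fin_cases i <;> simp [h0', h1']
  let M : SL(2, ℝ) := ⟨!![v 0, -v 1 / (v 0 ^ 2 + v 1 ^ 2); v 1, v 0 / (v 0 ^ 2 + v 1 ^ 2)], by
    rw [Matrix.det_fin_two_of]; field_simp; ring⟩
  obtain ⟨A', hA'⟩ : ∃ A', A = M * A' * M⁻¹ := ⟨M⁻¹ * A * M, by group⟩
  obtain ⟨B', hB'⟩ : ∃ B', B = M * B' * M⁻¹ := ⟨M⁻¹ * B * M, by group⟩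
  have hCC : C = M * (A' * B' * A'⁻¹ * B'⁻¹) * M⁻¹ := by rw [hC, hA', hB']; group
  set C' := A' * B' * A'⁻¹ * B'⁻¹ with hC'
  have hCM : C * M = M * C' := by rw [hCC]; group
  have hcol0 : C'.val 0 0 = 1 ∧ C'.val 1 0 = 0 := by
    have e : ∀ i, (C * M).val i 0 = v i := by
      intro i
      have := congrFun hCv i
      rw [Matrix.sub_mulVec, Matrix.one_mulVec, Pi.sub_apply, Pi.zero_apply, sub_eq_zero] at this
      rw [← this, Matrix.SpecialLinearGroup.coe_mul, Matrix.mul_apply]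
      simp [M, Matrix.mulVec, dotProduct, Fin.sum_univ_two]
    have e0 := e 0
    have e1 := e 1
    rw [hCM, Matrix.SpecialLinearGroup.coe_mul, Matrix.mul_apply, Fin.sum_univ_two] at e0 e1
    simp [M] at e0 e1
    field_simp at e0 e1
    constructor
    · apply mul_left_cancel₀ (mul_ne_zero hn hn)
      linear_combination v 0 * e0 + v 1 * e1
    · apply mul_left_cancel₀ hn
      linear_combination v 0 * e1 - v 1 * e0
  obtain ⟨c00, c10⟩ := hcol0
  have c11 : C'.val 1 1 = 1 := by
    have := det_entries C'
    rw [c00, c10] at this; linarith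
  have hAB : A' * B' = C' * (B' * A') := by rw [hC']; group
  have dA := det_entries A'
  have dB := det_entries B'
  have key : C'.val 0 1 = 0 ∨ A'.val 1 0 = 0 := by
    have q : ∀ i j, (A' * B').val i j = (C' * (B' * A')).val i j := fun i j => by rw [hAB]
    have q00 := q 0 0
    have q01 := q 0 1
    have q10 := q 1 0
    have q11 := q 1 1
    simp only [Matrix.SpecialLinearGroup.coe_mul, Matrix.mul_apply, Fin.sum_univ_two, c00, c10,
      c11] at q00 q01 q10 q11
    generalize C'.val 0 1 = u at *
    generalize A'.val 0 0 = a at *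
    generalize A'.val 0 1 = b at *
    generalize A'.val 1 0 = c at *
    generalize A'.val 1 1 = d at *
    generalize B'.val 0 0 = e at *
    generalize B'.val 0 1 = f at *
    generalize B'.val 1 0 = g at *
    generalize B'.val 1 1 = k at *
    -- If both entries are non-zero, the relation forces `B' = l A'⁻¹` with a scalar `l`. Then `A'`
    -- and `B'` commute, which contradicts `u ≠ 0`.
    by_contra! hcon
    obtain ⟨hu, hc⟩ := hcon
    have r1 : g * a + k * c = 0 := by
      apply mul_left_cancel₀ hu
      linear_combination -q00 - q11
    have r2 : c * e + d * g = 0 := by linear_combination q10 + r1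
    have r3 : c * f = g * b := by linear_combination q11
    have r4 : g = -c * (c * f + d * k) := by linear_combination -g * dA + c * r3 + d * r1
    set l := c * f + d * k with hl
    have r5 : e = d * l := by
      apply mul_left_cancel₀ hc
      linear_combination r2 - d * r4
    have r6 : k = a * l := by
      apply mul_left_cancel₀ hc
      linear_combination r1 - a * r4
    have r7 : f = -(b * l) := by
      apply mul_left_cancel₀ hc
      linear_combination r3 + b * r4
    have hl0 : l ≠ 0 := by
      intro h0
      rw [r5, r6, r7, r4, h0] at dB
      simp at dB
    apply hu
    apply mul_left_cancel₀ hl0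
    rw [r5, r6, r7, r4] at q01
    linear_combination (-1 : ℝ) * q01 - u * l * dA
  suffices h : Commute C' (A' * C' * A'⁻¹) by
    have e1 : A * C * A⁻¹ = M * (A' * C' * A'⁻¹) * M⁻¹ := by rw [hCC, hA']; group
    rw [e1, hCC]
    show _ * _ = _ * _
    have h' : C' * (A' * C' * A'⁻¹) = (A' * C' * A'⁻¹) * C' := h
    calc M * C' * M⁻¹ * (M * (A' * C' * A'⁻¹) * M⁻¹) = M * (C' * (A' * C' * A'⁻¹)) * M⁻¹ := by group
      _ = M * (A' * C' * A'⁻¹) * M⁻¹ * (M * C' * M⁻¹) := by rw [h']; group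
  rcases key with hu | hc
  · have : C' = 1 := by
      ext i j; fin_cases i <;> fin_cases j <;> simp [c00, c10, c11, hu]
    rw [this]; exact Commute.one_left _
  · show C' * _ = _ * C'
    ext i j
    simp only [Matrix.SpecialLinearGroup.coe_mul, coe_inv_entries]
    fin_cases i <;> fin_cases j <;>
      simp [Matrix.mul_apply, Fin.sum_univ_two, c00, c10, c11, hc]
    rw [hc] at dA
    linear_combination 0 * dA

theorem genA_mul_self_ne_one : genA * genA ≠ 1 := by
  unfold genA; decide

theorem commutator_conj_ne : cusp * (genA * cusp * genA⁻¹) ≠ (genA * cusp * genA⁻¹) * cusp := by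
  unfold cusp genA genB; decide

/-- A parabolic matrix in `SL(2, ℝ)` has trace `2` or `-2`. Trace `2` would make `cusp` commute with
its conjugate by `a`, which fails in the free group. The sign is the same for all lifts, as a
commutator ignores signs. -/
theorem FuchsianRep.tr_cusp (ρ : FuchsianRep) : tr (ρ.toHom cusp) = -2 := by
  have hpar := ρ.parabolic.2
  rw [Matrix.discr_fin_two] at hpar
  have hdet : (ρ.toHom cusp).val.det = 1 := (ρ.toHom cusp).2
  rw [hdet] at hpar
  have h4 : (tr (ρ.toHom cusp) - 2) * (tr (ρ.toHom cusp) + 2) = 0 := by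
    simp only [tr]; linarith
  rcases mul_eq_zero.1 h4 with h | h
  · exfalso
    have h2 : tr (ρ.toHom genA * ρ.toHom genB * (ρ.toHom genA)⁻¹ * (ρ.toHom genB)⁻¹) = 2 := by
      rw [← map_inv, ← map_inv, ← map_mul, ← map_mul, ← map_mul]
      have : tr (ρ.toHom cusp) = 2 := by linarith
      exact this
    have hc := commute_of_tr_commutator_eq_two h2
    have hc' : ρ.toHom (cusp * (genA * cusp * genA⁻¹)) =
        ρ.toHom ((genA * cusp * genA⁻¹) * cusp) := by
      simp only [cusp, map_mul, map_inv]
      exact hc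
    refine commutator_conj_ne (mul_inv_eq_one.1 (ρ.faithful _ (Or.inl ?_)))
    rw [map_mul, map_inv, hc', mul_inv_cancel]
  · linarith

theorem tr_markov {A B : SL(2, ℝ)} (h : tr (A * B * A⁻¹ * B⁻¹) = -2) :
    tr A ^ 2 + tr B ^ 2 + tr (A * B) ^ 2 = tr A * tr B * tr (A * B) := by
  rw [tr_commutator] at h; linarith

theorem mul_self_of_tr_eq_zero {A : SL(2, ℝ)} (h : tr A = 0) : A * A = -1 := by
  have d := det_entries A
  rw [tr_def] at h
  ext i j
  fin_cases i <;> fin_cases j <;>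
    simp [Matrix.SpecialLinearGroup.coe_mul, Matrix.mul_apply, Fin.sum_univ_two]
  · linear_combination A.val 0 0 * h - d
  · linear_combination A.val 0 1 * h
  · linear_combination A.val 1 0 * h
  · linear_combination A.val 1 1 * h - d

theorem map_cusp (ρ : Pi1 →* SL(2, ℝ)) :
    ρ cusp = ρ genA * ρ genB * (ρ genA)⁻¹ * (ρ genB)⁻¹ := by
  simp [cusp]

theorem FuchsianRep.tr_genA_ne_zero (ρ : FuchsianRep) : tr (ρ.toHom genA) ≠ 0 := by
  intro h
  refine genA_mul_self_ne_one (ρ.faithful _ (Or.inr ?_))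
  rw [map_mul, mul_self_of_tr_eq_zero h]

section Conj

variable {ρ : Pi1 →* SL(2, ℝ)}

theorem tr_sq_rel (hC : tr (ρ cusp) = -2) :
    tr (ρ genA) ^ 2 + tr (ρ genB) ^ 2 + tr (ρ (genA * genB)) ^ 2 =
      tr (ρ genA) * tr (ρ genB) * tr (ρ (genA * genB)) := by
  rw [map_cusp] at hC
  rw [map_mul]
  exact tr_markov hC

theorem abs_tr_mem_triples (hC : tr (ρ cusp) = -2) (hA : tr (ρ genA) ≠ 0) :
    (|tr (ρ genA)|, |tr (ρ genB)|, |tr (ρ (genA * genB))|) ∈ Triples := by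
  have h := tr_sq_rel hC
  have hpos : 0 < tr (ρ genA) * tr (ρ genB) * tr (ρ (genA * genB)) := by rw [← h]; positivity
  have hne := hpos.ne'
  have hB : tr (ρ genB) ≠ 0 := fun h0 => hne (by rw [h0]; ring)
  have hAB : tr (ρ (genA * genB)) ≠ 0 := fun h0 => hne (by rw [h0]; ring)
  refine ⟨abs_pos.2 hA, abs_pos.2 hB, abs_pos.2 hAB, ?_⟩
  simp only [sq_abs, ← abs_mul]
  rw [h, abs_of_pos hpos]

/-- The absolute values of the traces of `a`, `b` and `a b`. -/
def absTriple (hC : tr (ρ cusp) = -2) (hA : tr (ρ genA) ≠ 0) : Triples :=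
  ⟨(|tr (ρ genA)|, |tr (ρ genB)|, |tr (ρ (genA * genB))|), abs_tr_mem_triples hC hA⟩

theorem eq_pm_abs (A : SL(2, ℝ)) : ∃ A' : SL(2, ℝ), (A' = A ∨ A' = -A) ∧ tr A' = |tr A| := by
  rcases abs_choice (tr A) with h | h
  · exact ⟨A, Or.inl rfl, h.symm⟩
  · exact ⟨-A, Or.inr rfl, by rw [h, tr_neg]⟩

/-- Choose signs so that the images of `a` and `b` have positive trace; the commutator does not
change, and Markov's equation makes the trace of the product positive as well. The determinant of
`M` may be negative, which is the choice of orientation. -/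
theorem exists_conj_nfHom (hC : tr (ρ cusp) = -2) (hA : tr (ρ genA) ≠ 0) :
    ∃ M : Matrix (Fin 2) (Fin 2) ℝ, M.det ≠ 0 ∧ ∀ g,
      (ρ g).val * M = M * (nfHom (absTriple hC hA) g).val ∨
      (ρ g).val * M = -(M * (nfHom (absTriple hC hA) g).val) := by
  have hm := abs_tr_mem_triples hC hA
  obtain ⟨A, hA1, hA2⟩ := eq_pm_abs (ρ genA)
  obtain ⟨B, hB1, hB2⟩ := eq_pm_abs (ρ genB)
  have hcomm : A * B * A⁻¹ * B⁻¹ = ρ cusp := by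
    rw [map_cusp]
    rcases hA1 with rfl | rfl <;> rcases hB1 with rfl | rfl <;> simp
  have hC' : tr (A * B * A⁻¹ * B⁻¹) = -2 := by rw [hcomm, hC]
  have hpmAB : A * B = ρ (genA * genB) ∨ A * B = -ρ (genA * genB) := by
    rw [map_mul]
    rcases hA1 with rfl | rfl <;> rcases hB1 with rfl | rfl <;> simp
  have hAB : tr (A * B) = |tr (ρ (genA * genB))| := by
    have h := tr_markov hC'
    have hpos : 0 < tr A * tr B * tr (A * B) := by
      rw [← h, hA2, hB2]
      have := hm.1
      have := hm.2.1
      positivity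
    have : 0 < tr (A * B) := by
      rw [hA2, hB2] at hpos
      exact (pos_iff_pos_of_mul_pos hpos).1 (mul_pos hm.1 hm.2.1)
    rw [← abs_of_pos this]
    rcases hpmAB with h | h <;> rw [h]
    rw [tr_neg, abs_neg]
  have hB0 : tr B ≠ 0 := by rw [hB2]; exact hm.2.1.ne'
  obtain ⟨M, hM, h1, h2⟩ := exists_conj_normalForm A B hC' hB0
  rw [hA2, hB2, hAB] at h1
  rw [hB2] at h2
  refine ⟨M, hM, fun g => ?_⟩
  have hMu : IsUnit M.det := isUnit_iff_ne_zero.2 hM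
  induction g using FreeGroup.induction_on with
  | C1 => left; simp
  | of i =>
    fin_cases i
    · have e := nfHom_genA (absTriple hC hA)
      rw [genA] at e hA1
      show (ρ (FreeGroup.of 0)).val * M = M * (nfHom _ (FreeGroup.of 0)).val ∨
        (ρ (FreeGroup.of 0)).val * M = -(M * (nfHom _ (FreeGroup.of 0)).val)
      rw [e]
      rcases hA1 with h | h
      · left; rw [← h]; exact h1
      · right
        rw [h, Matrix.SpecialLinearGroup.coe_neg, Matrix.neg_mul] at h1
        rw [eq_neg_iff_add_eq_zero, add_comm, ← eq_neg_iff_add_eq_zero]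
        exact h1.symm
    · have e := nfHom_genB (absTriple hC hA)
      rw [genB] at e hB1
      show (ρ (FreeGroup.of 1)).val * M = M * (nfHom _ (FreeGroup.of 1)).val ∨
        (ρ (FreeGroup.of 1)).val * M = -(M * (nfHom _ (FreeGroup.of 1)).val)
      rw [e]
      rcases hB1 with h | h
      · left; rw [← h]; exact h2
      · right
        rw [h, Matrix.SpecialLinearGroup.coe_neg, Matrix.neg_mul] at h2
        rw [eq_neg_iff_add_eq_zero, add_comm, ← eq_neg_iff_add_eq_zero]
        exact h2.symm
  | inv_of i ih =>
    have aux : ∀ X Y : SL(2, ℝ), X.val * M = M * Y.val → (X⁻¹).val * M = M * (Y⁻¹).val := by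
      intro X Y h
      have hX : (X⁻¹).val * X.val = 1 := by rw [← Matrix.SpecialLinearGroup.coe_mul]; simp
      have hY : Y.val * (Y⁻¹).val = 1 := by rw [← Matrix.SpecialLinearGroup.coe_mul]; simp
      calc (X⁻¹).val * M = (X⁻¹).val * (M * Y.val) * (Y⁻¹).val := by
            rw [Matrix.mul_assoc, Matrix.mul_assoc, hY, Matrix.mul_one]
        _ = M * (Y⁻¹).val := by rw [← h, ← Matrix.mul_assoc, hX, Matrix.one_mul]
    rw [map_inv, map_inv]
    rcases ih with h | h
    · left; exact aux _ _ h
    · right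
      have h' : (ρ (FreeGroup.of i)).val * M =
          M * (-(nfHom (absTriple hC hA) (FreeGroup.of i))).val := by
        rw [Matrix.SpecialLinearGroup.coe_neg, Matrix.mul_neg]; exact h
      have := aux _ _ h'
      rw [this]
      simp
  | mul g k hg hk =>
    have aux : (ρ (g * k)).val * M = (ρ g).val * ((ρ k).val * M) := by
      rw [map_mul, Matrix.SpecialLinearGroup.coe_mul, Matrix.mul_assoc]
    have aux2 : M * (nfHom (absTriple hC hA) (g * k)).val =
        M * (nfHom (absTriple hC hA) g).val * (nfHom (absTriple hC hA) k).val := by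
      rw [map_mul, Matrix.SpecialLinearGroup.coe_mul, Matrix.mul_assoc]
    rw [aux, aux2]
    rcases hg with hg | hg <;> rcases hk with hk | hk <;> rw [hk]
    · left; rw [← Matrix.mul_assoc, hg]
    · right; rw [Matrix.mul_neg, ← Matrix.mul_assoc, hg]
    · right; rw [← Matrix.mul_assoc, hg, Matrix.neg_mul]
    · left; rw [Matrix.mul_neg, ← Matrix.mul_assoc, hg, Matrix.neg_mul, neg_neg]

theorem abs_tr_eq_nfHom (hC : tr (ρ cusp) = -2) (hA : tr (ρ genA) ≠ 0) (g : Pi1) :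
    |tr (ρ g)| = |tr (nfHom (absTriple hC hA) g)| := by
  obtain ⟨M, hM, h⟩ := exists_conj_nfHom hC hA
  have hMu : IsUnit M.det := isUnit_iff_ne_zero.2 hM
  have aux : ∀ X Y : Matrix (Fin 2) (Fin 2) ℝ, X * M = M * Y → X.trace = Y.trace := by
    intro X Y h
    have : X = M * Y * M⁻¹ := by
      rw [← h, Matrix.mul_assoc, Matrix.mul_nonsing_inv _ hMu, Matrix.mul_one]
    rw [this, Matrix.trace_mul_comm, ← Matrix.mul_assoc, Matrix.nonsing_inv_mul _ hMu,
      Matrix.one_mul]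
  rcases h g with h | h
  · rw [tr, tr, aux _ _ h]
  · rw [← Matrix.mul_neg] at h
    rw [tr, tr, aux _ _ h, Matrix.trace_neg, abs_neg]

theorem projDiscrete_of_tr (hC : tr (ρ cusp) = -2) (hA : tr (ρ genA) ≠ 0) : ProjDiscrete ρ := by
  obtain ⟨M, hM, h⟩ := exists_conj_nfHom hC hA
  have hMu : IsUnit M.det := isUnit_iff_ne_zero.2 hM
  obtain ⟨U, hU, hU'⟩ := nfHom_projDiscrete (absTriple hC hA)
  let c : SL(2, ℝ) → SL(2, ℝ) := fun g => ⟨M⁻¹ * g.val * M, by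
    rw [Matrix.det_mul, Matrix.det_mul, g.2, mul_one, ← Matrix.det_mul,
      Matrix.nonsing_inv_mul _ hMu, Matrix.det_one]⟩
  have hc : Continuous c := by
    refine Continuous.subtype_mk ?_ _
    exact (continuous_const.mul continuous_subtype_val).mul continuous_const
  have hc1 : c 1 = 1 := by
    apply Subtype.ext
    show M⁻¹ * (1 : SL(2, ℝ)).val * M = 1
    rw [Matrix.SpecialLinearGroup.coe_one, Matrix.mul_one, Matrix.nonsing_inv_mul _ hMu]
  have key : ∀ g, c (ρ g) = nfHom (absTriple hC hA) g ∨ c (ρ g) = -nfHom (absTriple hC hA) g := by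
    intro g
    rcases h g with h | h
    · left
      apply Subtype.ext
      show M⁻¹ * (ρ g).val * M = _
      rw [Matrix.mul_assoc, h, ← Matrix.mul_assoc, Matrix.nonsing_inv_mul _ hMu, Matrix.one_mul]
    · right
      apply Subtype.ext
      show M⁻¹ * (ρ g).val * M = (-nfHom (absTriple hC hA) g).val
      rw [Matrix.mul_assoc, h, Matrix.mul_neg, ← Matrix.mul_assoc, Matrix.nonsing_inv_mul _ hMu,
        Matrix.one_mul, Matrix.SpecialLinearGroup.coe_neg]
  have hcneg : ∀ g, c (-g) = -c g := by
    intro g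
    apply Subtype.ext
    show M⁻¹ * (-g).val * M = (-c g).val
    rw [Matrix.SpecialLinearGroup.coe_neg, Matrix.SpecialLinearGroup.coe_neg, Matrix.mul_neg,
      Matrix.neg_mul]
  refine ⟨c ⁻¹' U, hc.continuousAt.preimage_mem_nhds (by rw [hc1]; exact hU), fun g hg => ?_⟩
  apply hU'
  simp only [Set.mem_preimage] at hg
  rcases key g with hk | hk <;> simp only [hcneg, hk, neg_neg] at hg <;> tauto

theorem ProjDiscrete.eq_one (h : ProjDiscrete ρ) {g : Pi1} (hg : ρ g = 1 ∨ ρ g = -1) : g = 1 := by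
  obtain ⟨U, hU, hU'⟩ := h
  apply hU'
  rcases hg with hg | hg
  · left; rw [hg]; exact mem_of_mem_nhds hU
  · right; rw [hg, neg_neg]; exact mem_of_mem_nhds hU

/-- A homomorphism with parabolic-like commutator trace `-2` is Fuchsian. -/
def mkRep (ρ : Pi1 →* SL(2, ℝ)) (hC : tr (ρ cusp) = -2) (hA : tr (ρ genA) ≠ 0) : FuchsianRep where
  toHom := ρ
  faithful g hg := (projDiscrete_of_tr hC hA).eq_one hg
  discrete := by
    obtain ⟨U, hU, hU'⟩ := projDiscrete_of_tr hC hA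
    obtain ⟨V, hVU, hVo, hV1⟩ := mem_nhds_iff.1 hU
    refine discreteTopology_of_isOpen_singleton_one ?_
    refine isOpen_induced_iff.2 ⟨V, hVo, ?_⟩
    ext ⟨x, g, rfl⟩
    simp only [Set.mem_preimage, Set.mem_singleton_iff]
    constructor
    · intro hx
      have := hU' g (Or.inl (hVU hx))
      apply Subtype.ext
      show ρ g = 1
      rw [this, map_one]
    · intro hx
      have : ρ g = 1 := congrArg Subtype.val hx
      rw [this]; exact hV1
  parabolic := by
    refine ⟨fun hs => ?_, ?_⟩
    · exact cusp_ne_one ((projDiscrete_of_tr hC hA).eq_one (eq_one_or_eq_neg_one_of_scalar hs))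
    · rw [Matrix.discr_fin_two, (ρ cusp).2]
      have : (ρ cusp).val.trace = -2 := hC
      rw [this]; norm_num

end Conj

/-! ### Homology -/

theorem expSum_mul (i : Fin 2) (g h : Pi1) : expSum i (g * h) = expSum i g + expSum i h := by
  simp [expSum]

theorem expSum_inv (i : Fin 2) (g : Pi1) : expSum i g⁻¹ = -expSum i g := by
  simp [expSum]

theorem expSum_one (i : Fin 2) : expSum i 1 = 0 := by
  simp [expSum]

theorem expSum_of (i j : Fin 2) : expSum i (FreeGroup.of j) = if j = i then 1 else 0 := by
  simp [expSum]

theorem expSum_genA (i : Fin 2) : expSum i genA = if 0 = i then 1 else 0 := expSum_of i 0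

theorem expSum_genB (i : Fin 2) : expSum i genB = if 1 = i then 1 else 0 := expSum_of i 1

theorem expSum_hom (i : Fin 2) (θ : Pi1 →* Pi1) (g : Pi1) :
    expSum i (θ g) = expSum i (θ genA) * expSum 0 g + expSum i (θ genB) * expSum 1 g := by
  induction g using FreeGroup.induction_on with
  | C1 => simp [expSum_one]
  | of j => fin_cases j <;> simp [expSum_of, genA, genB]
  | inv_of j h => rw [map_inv, expSum_inv, h, expSum_inv, expSum_inv]; ring
  | mul g h hg hh => rw [map_mul, expSum_mul, hg, hh, expSum_mul, expSum_mul]; ring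

/-- The action on homology of an automorphism of the fundamental group. -/
def hmat : MulAut Pi1 →* Matrix (Fin 2) (Fin 2) ℤ where
  toFun θ := !![expSum 0 (θ genA), expSum 0 (θ genB); expSum 1 (θ genA), expSum 1 (θ genB)]
  map_one' := by
    ext i j; fin_cases i <;> fin_cases j <;> simp [expSum_genA, expSum_genB]
  map_mul' θ ψ := by
    ext i j
    fin_cases i <;> fin_cases j <;>
      simp [Matrix.mul_apply, Fin.sum_univ_two] <;> exact expSum_hom _ θ.toMonoidHom _

theorem hmat_apply (θ : MulAut Pi1) : hmat θ =
    !![expSum 0 (θ genA), expSum 0 (θ genB); expSum 1 (θ genA), expSum 1 (θ genB)] := rfl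

theorem hmat_conj (g : Pi1) : hmat (MulAut.conj g) = 1 := by
  ext i j
  fin_cases i <;> fin_cases j <;>
    simp [hmat_apply, expSum_mul, expSum_inv, expSum_genA, expSum_genB]

/-! ### Elementary automorphisms -/

theorem pi1_hom_ext {G : Type*} [Group G] {f g : Pi1 →* G} (hA : f genA = g genA)
    (hB : f genB = g genB) : f = g := by
  apply FreeGroup.ext_hom
  intro i
  fin_cases i
  · exact hA
  · exact hB

theorem mulAut_ext {f g : MulAut Pi1} (hA : f genA = g genA) (hB : f genB = g genB) : f = g := by
  have : f.toMonoidHom = g.toMonoidHom := pi1_hom_ext hA hB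
  ext x
  exact DFunLike.congr_fun this x

/-- The endomorphism with given values on the generators. -/
def endo (u v : Pi1) : Pi1 →* Pi1 := FreeGroup.lift ![u, v]

@[simp] theorem endo_genA (u v : Pi1) : endo u v genA = u := by simp [endo, genA]

@[simp] theorem endo_genB (u v : Pi1) : endo u v genB = v := by simp [endo, genB]

/-- The automorphism `a ↦ a`, `b ↦ b a`. -/
def autU : MulAut Pi1 :=
  MonoidHom.toMulEquiv (endo genA (genB * genA)) (endo genA (genB * genA⁻¹))
    (pi1_hom_ext (by simp) (by simp)) (pi1_hom_ext (by simp) (by simp))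

/-- The automorphism `a ↦ a b`, `b ↦ b`. -/
def autV : MulAut Pi1 :=
  MonoidHom.toMulEquiv (endo (genA * genB) genB) (endo (genA * genB⁻¹) genB)
    (pi1_hom_ext (by simp) (by simp)) (pi1_hom_ext (by simp) (by simp))

/-- The automorphism `a ↦ a b`, `b ↦ a⁻¹`. -/
def autT : MulAut Pi1 :=
  MonoidHom.toMulEquiv (endo (genA * genB) genA⁻¹) (endo genB⁻¹ (genB * genA))
    (pi1_hom_ext (by simp) (by simp)) (pi1_hom_ext (by simp) (by simp))

/-- The automorphism `a ↦ b`, `b ↦ a⁻¹`. -/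
def autS : MulAut Pi1 :=
  MonoidHom.toMulEquiv (endo genB genA⁻¹) (endo genB⁻¹ genA)
    (pi1_hom_ext (by simp) (by simp)) (pi1_hom_ext (by simp) (by simp))

@[simp] theorem autU_genA : autU genA = genA := endo_genA genA (genB * genA)
@[simp] theorem autU_genB : autU genB = genB * genA := endo_genB genA (genB * genA)
@[simp] theorem autU_inv_genA : autU⁻¹ genA = genA := endo_genA genA (genB * genA⁻¹)
@[simp] theorem autU_inv_genB : autU⁻¹ genB = genB * genA⁻¹ := endo_genB genA (genB * genA⁻¹)
@[simp] theorem autV_genA : autV genA = genA * genB := endo_genA (genA * genB) genB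
@[simp] theorem autV_genB : autV genB = genB := endo_genB (genA * genB) genB
@[simp] theorem autV_inv_genA : autV⁻¹ genA = genA * genB⁻¹ := endo_genA (genA * genB⁻¹) genB
@[simp] theorem autU_symm_genA : MulEquiv.symm autU genA = genA := endo_genA genA (genB * genA⁻¹)
@[simp] theorem autU_symm_genB : MulEquiv.symm autU genB = genB * genA⁻¹ :=
  endo_genB genA (genB * genA⁻¹)
@[simp] theorem autV_symm_genA : MulEquiv.symm autV genA = genA * genB⁻¹ :=
  endo_genA (genA * genB⁻¹) genB
@[simp] theorem autV_symm_genB : MulEquiv.symm autV genB = genB := endo_genB (genA * genB⁻¹) genB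
@[simp] theorem autT_genA : autT genA = genA * genB := endo_genA (genA * genB) genA⁻¹
@[simp] theorem autT_genB : autT genB = genA⁻¹ := endo_genB (genA * genB) genA⁻¹
@[simp] theorem autS_genA : autS genA = genB := endo_genA genB genA⁻¹
@[simp] theorem autS_genB : autS genB = genA⁻¹ := endo_genB genB genA⁻¹

theorem autU_cusp : autU cusp = cusp := by simp [cusp, mul_assoc]
theorem autV_cusp : autV cusp = cusp := by simp [cusp, mul_assoc]
theorem autT_cusp : autT cusp = cusp := by simp [cusp, mul_assoc]

theorem autU_mem : autU ∈ MCG := by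
  show IsConj _ _
  rw [autU_cusp]

theorem autV_mem : autV ∈ MCG := by
  show IsConj _ _
  rw [autV_cusp]

theorem autS_mem : autS ∈ MCG := by
  show IsConj _ _
  refine isConj_iff.2 ⟨genA, ?_⟩
  simp [cusp, mul_assoc]

/-- The automorphisms that fix the cusp element. -/
def cuspStab : Subgroup (MulAut Pi1) where
  carrier := {θ | θ cusp = cusp}
  one_mem' := rfl
  mul_mem' {θ ψ} hθ hψ := by
    show θ (ψ cusp) = cusp
    rw [show ψ cusp = cusp from hψ, show θ cusp = cusp from hθ]
  inv_mem' {θ} hθ := by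
    show θ⁻¹ cusp = cusp
    have : θ cusp = cusp := hθ
    nth_rewrite 1 [← this]
    simp

theorem hmat_autU : hmat autU = !![1, 1; 0, 1] := by
  simp [hmat_apply, expSum_mul, expSum_genA, expSum_genB]

theorem hmat_autV : hmat autV = !![1, 0; 1, 1] := by
  simp [hmat_apply, expSum_mul, expSum_genA, expSum_genB]

theorem hmat_autT : hmat autT = !![1, -1; 1, 0] := by
  simp [hmat_apply, expSum_mul, expSum_inv, expSum_genA, expSum_genB]

theorem hmat_autS : hmat autS = !![0, -1; 1, 0] := by
  simp [hmat_apply, expSum_inv, expSum_genA, expSum_genB]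

/-- `autT` is the rotation of order six of the modular torus, up to the loop around the puncture. -/
theorem autT_pow_six : autT ^ 6 = MulAut.conj cusp := by
  apply mulAut_ext
  · simp [pow_succ, cusp, mul_assoc]
  · simp [pow_succ, cusp, mul_assoc]

/-! ### The modular torus -/

/-- The holonomy of the modular torus. -/
def modRep : Pi1 →* SL(2, ℤ) :=
  FreeGroup.lift ![⟨!![1, 1; 1, 2], by simp [Matrix.det_fin_two]⟩,
    ⟨!![3, 1; -1, 0], by simp [Matrix.det_fin_two]⟩]

theorem modRep_genA : (modRep genA).val = !![1, 1; 1, 2] := by simp [modRep, genA]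

theorem modRep_genB : (modRep genB).val = !![3, 1; -1, 0] := by simp [modRep, genB]

/-- The triple of the modular torus. -/
def modTriple : Triples := ⟨(3, 3, 3), by norm_num [Triples]⟩

theorem nfHom_modTriple (g : Pi1) :
    nfHom modTriple g = Matrix.SpecialLinearGroup.map (Int.castRingHom ℝ) (modRep g) := by
  have : nfHom modTriple = (Matrix.SpecialLinearGroup.map (Int.castRingHom ℝ)).comp modRep := by
    apply pi1_hom_ext
    · rw [nfHom_genA, MonoidHom.comp_apply]
      ext i j
      rw [Matrix.SpecialLinearGroup.map_apply_coe, modRep_genA]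
      fin_cases i <;> fin_cases j <;> norm_num [nfGenA, nfA, modTriple]
    · rw [nfHom_genB, MonoidHom.comp_apply]
      ext i j
      rw [Matrix.SpecialLinearGroup.map_apply_coe, modRep_genB]
      fin_cases i <;> fin_cases j <;> norm_num [nfGenB, nfB, modTriple]
  rw [this]; rfl

theorem modRep_faithful {g : Pi1} (h : modRep g = 1 ∨ modRep g = -1) : g = 1 := by
  apply (nfHom_projDiscrete modTriple).eq_one
  rw [nfHom_modTriple]
  rcases h with h | h
  · left; rw [h, map_one]
  · right; rw [h]
    ext i j
    fin_cases i <;> fin_cases j <;> simp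

/-- The trace of an element in the modular torus. -/
def modTr (g : Pi1) : ℤ := (modRep g).val 0 0 + (modRep g).val 1 1

theorem tr_modRep (g : Pi1) : tr (nfHom modTriple g) = modTr g := by
  rw [nfHom_modTriple, tr_def]
  simp [modTr]

theorem modTr_conj (g h : Pi1) : modTr (h * g * h⁻¹) = modTr g := by
  have : (modTr (h * g * h⁻¹) : ℝ) = modTr g := by
    rw [← tr_modRep, ← tr_modRep, map_mul, map_mul, map_inv, tr_conj]
  exact_mod_cast this

theorem modTr_inv (g : Pi1) : modTr g⁻¹ = modTr g := by
  have : (modTr g⁻¹ : ℝ) = modTr g := by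
    rw [← tr_modRep, ← tr_modRep, map_inv, tr_inv]
  exact_mod_cast this

theorem modTr_mul (g h : Pi1) : modTr (g * h) + modTr (g * h⁻¹) = modTr g * modTr h := by
  have : (modTr (g * h) + modTr (g * h⁻¹) : ℝ) = modTr g * modTr h := by
    rw [← tr_modRep, ← tr_modRep, ← tr_modRep, ← tr_modRep, map_mul, map_mul, map_inv, tr_mul_add]
  exact_mod_cast this

theorem modRep_cusp : (modRep cusp).val = !![-1, -6; 0, -1] := by
  simp only [cusp, map_mul, map_inv, Matrix.SpecialLinearGroup.coe_mul,
    Matrix.SpecialLinearGroup.coe_inv, modRep_genA, modRep_genB, Matrix.adjugate_fin_two_of]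
  decide

theorem modTr_rel {θ : MulAut Pi1} (hθ : θ cusp = cusp) :
    modTr (θ genA) ^ 2 + modTr (θ genB) ^ 2 + modTr (θ (genA * genB)) ^ 2 =
      modTr (θ genA) * modTr (θ genB) * modTr (θ (genA * genB)) := by
  have hC : tr ((nfHom modTriple).comp θ.toMonoidHom cusp) = -2 := by
    show tr (nfHom modTriple (θ cusp)) = -2
    rw [hθ, tr_modRep, modTr, modRep_cusp]
    simp
  have := tr_sq_rel hC
  simp only [MonoidHom.comp_apply] at this
  have h2 : ∀ g, tr (nfHom modTriple (θ.toMonoidHom g)) = modTr (θ g) := fun g => tr_modRep _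
  rw [h2, h2, h2] at this
  exact_mod_cast this

theorem modTr_genA_ne_zero (θ : MulAut Pi1) : modTr (θ genA) ≠ 0 := by
  intro h
  have h1 : tr (nfHom modTriple (θ genA)) = 0 := by rw [tr_modRep, h]; simp
  have h2 := mul_self_of_tr_eq_zero h1
  rw [← map_mul, ← map_mul] at h2
  have h3 := (nfHom_projDiscrete modTriple).eq_one (Or.inr h2)
  exact genA_mul_self_ne_one ((MulEquiv.map_eq_one_iff θ).1 h3)

/-! ### Automorphisms that fix the cusp -/

/-- Absolute traces in the modular torus. -/
def absTr (g : Pi1) : ℤ := |modTr g|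

theorem absTr_conj (g h : Pi1) : absTr (h * g * h⁻¹) = absTr g := by
  rw [absTr, modTr_conj, absTr]

theorem absTr_inv (g : Pi1) : absTr g⁻¹ = absTr g := by
  rw [absTr, modTr_inv, absTr]

/-- For `x ≤ 2` the quadratic form `y² + z² - x y z` is non-negative, so it cannot equal `-x²`. -/
theorem three_le_of_markov {x y z : ℤ} (hx : 0 < x) (h : x ^ 2 + y ^ 2 + z ^ 2 = x * y * z) :
    3 ≤ x := by
  by_contra hcon
  have : x = 1 ∨ x = 2 := by omega
  rcases this with rfl | rfl
  · nlinarith [sq_nonneg (y - z), sq_nonneg y, sq_nonneg z]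
  · nlinarith [sq_nonneg (y - z)]

theorem modTr_prod_pos {θ : MulAut Pi1} (hθ : θ cusp = cusp) :
    0 < modTr (θ genA) * modTr (θ genB) * modTr (θ (genA * genB)) := by
  rw [← modTr_rel hθ]
  have := modTr_genA_ne_zero θ
  positivity

theorem absTr_pos {θ : MulAut Pi1} (hθ : θ cusp = cusp) :
    0 < absTr (θ genA) ∧ 0 < absTr (θ genB) ∧ 0 < absTr (θ (genA * genB)) := by
  have h := (modTr_prod_pos hθ).ne'
  refine ⟨abs_pos.2 fun h0 => h ?_, abs_pos.2 fun h0 => h ?_, abs_pos.2 fun h0 => h ?_⟩ <;>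
    rw [h0] <;> ring

theorem absTr_rel {θ : MulAut Pi1} (hθ : θ cusp = cusp) :
    absTr (θ genA) ^ 2 + absTr (θ genB) ^ 2 + absTr (θ (genA * genB)) ^ 2 =
      absTr (θ genA) * absTr (θ genB) * absTr (θ (genA * genB)) := by
  simp only [absTr, sq_abs, ← abs_mul]
  rw [modTr_rel hθ, abs_of_pos (modTr_prod_pos hθ)]

/-- By Markov's equation the traces of the product and of the quotient multiply to a sum of two
squares. They have the same sign, and the trace identity passes to absolute values. -/
theorem absTr_quot {θ : MulAut Pi1} (hθ : θ cusp = cusp) :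
    absTr (θ (genA * genB⁻¹)) =
      absTr (θ genA) * absTr (θ genB) - absTr (θ (genA * genB)) := by
  have h1 := modTr_mul (θ genA) (θ genB)
  rw [← map_inv, ← map_mul, ← map_mul] at h1
  have h2 := modTr_prod_pos hθ
  have h3 := absTr_rel hθ
  obtain ⟨p1, p2, p3⟩ := absTr_pos hθ
  have h4 : 0 < absTr (θ genA) * absTr (θ genB) - absTr (θ (genA * genB)) := by
    have : 0 < (absTr (θ genA) * absTr (θ genB) - absTr (θ (genA * genB))) *
        absTr (θ (genA * genB)) := by nlinarith
    exact (pos_iff_pos_of_mul_pos this).2 p3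
  have e : modTr (θ (genA * genB⁻¹)) =
      modTr (θ genA) * modTr (θ genB) - modTr (θ (genA * genB)) := by
    linarith
  simp only [absTr] at h4 ⊢
  rw [e]
  rw [← abs_mul] at h4 ⊢
  rcases lt_or_ge 0 (modTr (θ (genA * genB))) with hp | hp
  · have : 0 < modTr (θ genA) * modTr (θ genB) := (pos_iff_pos_of_mul_pos h2).2 hp
    rw [abs_of_pos this, abs_of_pos hp] at h4 ⊢
    rw [abs_of_pos h4]
  · have : modTr (θ genA) * modTr (θ genB) < 0 := by
      by_contra hc
      push Not at hc
      nlinarith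
    rw [abs_of_neg this, abs_of_nonpos hp] at h4 ⊢
    rw [abs_of_neg (by linarith)]
    ring

/-- Left multiplication by `cusp`, which is minus a translation by `6`, changes the trace by a
multiple of the lower left entry. Each of the three elements is `cusp` times a conjugate of itself,
or becomes a conjugate of itself when multiplied by `cusp`; comparing traces gives the formulas. -/
theorem lowerLeft_eq {θ : MulAut Pi1} (hθ : θ cusp = cusp) :
    modTr (θ genA) = 3 * (modRep (θ genA)).val 1 0 ∧
    modTr (θ genB) = -3 * (modRep (θ genB)).val 1 0 ∧
    modTr (θ (genA * genB)) = 3 * (modRep (θ (genA * genB))).val 1 0 := by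
  have hc : θ genA * θ genB * (θ genA)⁻¹ * (θ genB)⁻¹ = cusp := by
    rw [← hθ]; simp [cusp]
  have e1 : θ genA = cusp * (θ genB * θ genA * (θ genB)⁻¹) := by rw [← hc]; group
  have e2 : θ genA * θ genB * (θ genA)⁻¹ = cusp * θ genB := by rw [← hc]; group
  have e3 : θ (genA * genB) = cusp * (θ genB * θ genA) := by rw [← hc, map_mul]; group
  have key : ∀ g : Pi1, modTr (cusp * g) = -modTr g - 6 * (modRep g).val 1 0 ∧
      (modRep (cusp * g)).val 1 0 = -(modRep g).val 1 0 := by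
    intro g
    simp only [modTr, map_mul, Matrix.SpecialLinearGroup.coe_mul, modRep_cusp]
    simp [Matrix.mul_apply, Fin.sum_univ_two]
    ring
  refine ⟨?_, ?_, ?_⟩
  · obtain ⟨k1, k2⟩ := key (θ genB * θ genA * (θ genB)⁻¹)
    rw [← e1, modTr_conj] at k1
    rw [← e1] at k2
    linarith
  · obtain ⟨k1, k2⟩ := key (θ genB)
    rw [← e2, modTr_conj] at k1
    linarith
  · obtain ⟨k1, k2⟩ := key (θ genB * θ genA)
    rw [← e3] at k1 k2
    have : modTr (θ genB * θ genA) = modTr (θ (genA * genB)) := by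
      rw [map_mul, ← modTr_conj (θ genB * θ genA) (θ genA)]; congr 1; group
    rw [this] at k1
    linarith

/-- The symmetry `autT` of the modular torus is realized by `z ↦ z + 1`, which normalizes its group.
-/
theorem modRep_autT (g : Pi1) : modRep (autT g) = ModularGroup.T * modRep g * ModularGroup.T⁻¹ := by
  have : modRep.comp autT.toMonoidHom = (MulAut.conj ModularGroup.T).toMonoidHom.comp modRep := by
    apply pi1_hom_ext
    · show modRep (autT genA) = ModularGroup.T * modRep genA * ModularGroup.T⁻¹
      rw [eq_mul_inv_iff_mul_eq]
      apply Subtype.ext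
      simp only [autT_genA, map_mul, Matrix.SpecialLinearGroup.coe_mul, modRep_genA, modRep_genB,
        ModularGroup.coe_T]
      decide
    · show modRep (autT genB) = ModularGroup.T * modRep genB * ModularGroup.T⁻¹
      rw [eq_mul_inv_iff_mul_eq]
      apply Subtype.ext
      simp only [autT_genB, map_inv, Matrix.SpecialLinearGroup.coe_mul, modRep_genA, modRep_genB,
        ModularGroup.coe_T, Matrix.SpecialLinearGroup.coe_inv, Matrix.adjugate_fin_two_of]
      decide
  exact DFunLike.congr_fun this g

theorem modRep_autT_zpow (n : ℤ) (g : Pi1) :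
    modRep ((autT ^ n) g) = ModularGroup.T ^ n * modRep g * (ModularGroup.T ^ n)⁻¹ := by
  induction n generalizing g with
  | zero => simp
  | succ n ih =>
    rw [zpow_add_one, MulAut.mul_apply, ih, modRep_autT, zpow_add_one]
    group
  | pred n ih =>
    have h : modRep (autT⁻¹ g) = ModularGroup.T⁻¹ * modRep g * ModularGroup.T := by
      have := modRep_autT (autT⁻¹ g)
      rw [MulAut.apply_inv_self] at this
      rw [this]; group
    rw [zpow_sub_one, MulAut.mul_apply, ih, h, zpow_sub_one]
    group

theorem eq_of_modRep_eq_pm {g h : Pi1} (H : modRep g = modRep h ∨ modRep g = -modRep h) :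
    g = h := by
  rw [← mul_inv_eq_one]
  apply modRep_faithful
  rw [map_mul, map_inv]
  rcases H with H | H <;> rw [H] <;> simp

/-- Traces `±3` mean lower left entries `±1`, by `lowerLeft_eq`. Up to signs, the two matrices then
depend on a single integer, and translating the standard generators produces the same family;
faithfulness turns equality of matrices into equality of automorphisms. -/
theorem eq_autT_zpow_of_absTr {θ : MulAut Pi1} (hθ : θ cusp = cusp) (hA : absTr (θ genA) = 3)
    (hB : absTr (θ genB) = 3) (hAB : absTr (θ (genA * genB)) = 3) : ∃ n : ℤ, θ = autT ^ n := by
  obtain ⟨l1, l2, l3⟩ := lowerLeft_eq hθ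
  have hpos := modTr_prod_pos hθ
  have dA : (modRep (θ genA)).val 0 0 * (modRep (θ genA)).val 1 1 -
      (modRep (θ genA)).val 0 1 * (modRep (θ genA)).val 1 0 = 1 := by
    rw [← Matrix.det_fin_two]; exact (modRep (θ genA)).2
  have dB : (modRep (θ genB)).val 0 0 * (modRep (θ genB)).val 1 1 -
      (modRep (θ genB)).val 0 1 * (modRep (θ genB)).val 1 0 = 1 := by
    rw [← Matrix.det_fin_two]; exact (modRep (θ genB)).2
  have m3 : (modRep (θ (genA * genB))).val 1 0 =
      (modRep (θ genA)).val 1 0 * (modRep (θ genB)).val 0 0 +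
      (modRep (θ genA)).val 1 1 * (modRep (θ genB)).val 1 0 := by
    rw [map_mul, map_mul, Matrix.SpecialLinearGroup.coe_mul, Matrix.mul_apply, Fin.sum_univ_two]
  have tA : modTr (θ genA) = (modRep (θ genA)).val 0 0 + (modRep (θ genA)).val 1 1 := rfl
  have tB : modTr (θ genB) = (modRep (θ genB)).val 0 0 + (modRep (θ genB)).val 1 1 := rfl
  have conjA : ∀ n : ℤ, (modRep ((autT ^ n) genA)).val = !![1 + n, 1 + n - n ^ 2; 1, 2 - n] := by
    intro n
    rw [modRep_autT_zpow]
    simp only [Matrix.SpecialLinearGroup.coe_mul, Matrix.SpecialLinearGroup.coe_inv, modRep_genA,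
      ModularGroup.coe_T_zpow, Matrix.adjugate_fin_two_of]
    ext i j
    fin_cases i <;> fin_cases j <;> simp [Matrix.mul_apply, Fin.sum_univ_two] <;> ring
  have conjB : ∀ n : ℤ, (modRep ((autT ^ n) genB)).val = !![3 - n, 1 - 3 * n + n ^ 2; -1, n] := by
    intro n
    rw [modRep_autT_zpow]
    simp only [Matrix.SpecialLinearGroup.coe_mul, Matrix.SpecialLinearGroup.coe_inv, modRep_genB,
      ModularGroup.coe_T_zpow, Matrix.adjugate_fin_two_of]
    ext i j
    fin_cases i <;> fin_cases j <;> simp [Matrix.mul_apply, Fin.sum_univ_two] <;> ring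
  have fin : ∀ {A B : SL(2, ℤ)} {e : ℤ}, (e = 1 ∨ e = -1) → A.val 0 0 = e * B.val 0 0 →
      A.val 0 1 = e * B.val 0 1 → A.val 1 0 = e * B.val 1 0 → A.val 1 1 = e * B.val 1 1 →
      A = B ∨ A = -B := by
    rintro A B e (rfl | rfl) h1 h2 h3 h4
    · left; ext i j; fin_cases i <;> fin_cases j <;> simp [h1, h2, h3, h4]
    · right; ext i j; fin_cases i <;> fin_cases j <;> simp [h1, h2, h3, h4]
  obtain ⟨e, he⟩ : ∃ e, e = (modRep (θ genA)).val 1 0 := ⟨_, rfl⟩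
  obtain ⟨f, hf⟩ : ∃ f, f = -(modRep (θ genB)).val 1 0 := ⟨_, rfl⟩
  have hb10 : (modRep (θ genB)).val 1 0 = -f := by rw [hf, neg_neg]
  rw [← he] at l1 dA m3
  rw [hb10] at l2 dB m3
  rw [absTr, l1, abs_eq (by norm_num)] at hA
  rw [absTr, l2, abs_eq (by norm_num)] at hB
  rw [absTr, l3, abs_eq (by norm_num)] at hAB
  have e1 : e = 1 ∨ e = -1 := by omega
  have f1 : f = 1 ∨ f = -1 := by omega
  have ee : e * e = 1 := by rcases e1 with h | h <;> rw [h] <;> norm_num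
  have ff : f * f = 1 := by rcases f1 with h | h <;> rw [h] <;> norm_num
  have hz : (modRep (θ (genA * genB))).val 1 0 = e * f := by
    have hz1 : (modRep (θ (genA * genB))).val 1 0 = 1 ∨
      (modRep (θ (genA * genB))).val 1 0 = -1 := by omega
    rw [l1, l2, l3] at hpos
    rcases hz1 with h | h <;> rw [h] at hpos ⊢ <;> rcases e1 with h1 | h1 <;>
      rcases f1 with h2 | h2 <;> rw [h1, h2] at hpos ⊢ <;>
      first | (exfalso; norm_num at hpos; done) | norm_num
  rw [hz] at m3
  rw [l1] at tA
  rw [l2] at tB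
  have q11 : (modRep (θ genB)).val 1 1 = f * (f * (modRep (θ genB)).val 1 1) := by
    rw [← mul_assoc, ff, one_mul]
  -- By `conjB` the translation amount is the lower right entry of the image of `b`, corrected by
  -- the sign `f`.
  set n := f * (modRep (θ genB)).val 1 1 with hn
  have q00 : (modRep (θ genB)).val 0 0 = f * (3 - n) := by linear_combination -tB - q11
  have q01 : (modRep (θ genB)).val 0 1 = f * (1 - 3 * n + n ^ 2) := by
    rw [q00, q11] at dB
    linear_combination f * dB + ((modRep (θ genB)).val 0 1 * (-1) - f * n * (3 - n)) * ff
  have p11 : (modRep (θ genA)).val 1 1 = e * (2 - n) := by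
    rw [q00] at m3
    linear_combination f * m3 + (2 * e - e * n - (modRep (θ genA)).val 1 1) * ff
  have p00 : (modRep (θ genA)).val 0 0 = e * (1 + n) := by linear_combination -tA - p11
  have p01 : (modRep (θ genA)).val 0 1 = e * (1 + n - n ^ 2) := by
    rw [p00, p11] at dA
    linear_combination (-e) * dA + (e * (1 + n) * (2 - n) - (modRep (θ genA)).val 0 1) * ee
  refine ⟨n, mulAut_ext (eq_of_modRep_eq_pm (fin e1 ?_ ?_ ?_ ?_))
    (eq_of_modRep_eq_pm (fin f1 ?_ ?_ ?_ ?_))⟩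
  · rw [conjA, p00]; simp
  · rw [conjA, p01]; simp
  · rw [conjA, ← he]; simp
  · rw [conjA, p11]; simp
  · rw [conjB, q00]; simp
  · rw [conjB, q01]; simp
  · rw [conjB, hb10]; simp
  · rw [conjB, q11]; simp

theorem inv_autU_cusp : autU⁻¹ cusp = cusp := cuspStab.inv_mem autU_cusp

theorem inv_autV_cusp : autV⁻¹ cusp = cusp := cuspStab.inv_mem autV_cusp

/-! ### Descent on Markov triples -/

theorem absTr_autU_inv (θ : MulAut Pi1) (hθ : θ cusp = cusp) :
    absTr ((θ * autU⁻¹) genA) = absTr (θ genA) ∧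
    absTr ((θ * autU⁻¹) genB) =
      absTr (θ genA) * absTr (θ genB) - absTr (θ (genA * genB)) ∧
    absTr ((θ * autU⁻¹) (genA * genB)) = absTr (θ genB) := by
  refine ⟨by simp, ?_, ?_⟩
  · rw [← absTr_quot hθ, ← absTr_inv]
    simp
  · rw [← absTr_conj (θ genB) (θ genA)]
    simp [mul_assoc]

theorem absTr_autV_inv (θ : MulAut Pi1) (hθ : θ cusp = cusp) :
    absTr ((θ * autV⁻¹) genA) =
      absTr (θ genA) * absTr (θ genB) - absTr (θ (genA * genB)) ∧
    absTr ((θ * autV⁻¹) genB) = absTr (θ genB) ∧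
    absTr ((θ * autV⁻¹) (genA * genB)) = absTr (θ genA) := by
  refine ⟨?_, by simp, by simp⟩
  rw [← absTr_quot hθ]
  simp

theorem absTr_autT (θ : MulAut Pi1) :
    absTr ((θ * autT) genA) = absTr (θ (genA * genB)) ∧
    absTr ((θ * autT) genB) = absTr (θ genA) ∧
    absTr ((θ * autT) (genA * genB)) = absTr (θ genB) := by
  refine ⟨by simp, by simp [absTr_inv], ?_⟩
  rw [← absTr_conj (θ genB) (θ genA)]
  simp

/-- The positive monoid generated by the two elementary twists. -/
def posMonoid : Submonoid (MulAut Pi1) := Submonoid.closure {autU, autV}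

/-- Vieta jumping: `x y - z` is the other root of the equation in its third variable. The quadratic
polynomial is not positive at `y`, so `y` lies between the roots, of which `z` is the larger. -/
theorem quotient_le_of_markov {x y z : ℤ} (hx : 3 ≤ x) (hxy : x ≤ y)
    (hlt : x * y < 2 * z) (hprod : z * (x * y - z) = x ^ 2 + y ^ 2) : x * y - z ≤ y := by
  by_contra hc
  push Not at hc
  have h1 : 0 ≤ y ^ 2 * (x - 3) := mul_nonneg (sq_nonneg y) (by linarith)
  have h2 : 0 ≤ (y - x) * (y + x) := mul_nonneg (by linarith) (by linarith)
  have h3 : 0 < (z - y) * (x * y - z - y) := mul_pos (by linarith) (by linarith)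
  linarith

/-- Here `z` is the smaller root, so `m` is not between the roots, which means `s m² ≤ 2 m² + s²`.
With `3 ≤ s ≤ m` this leaves only `s = m = 3`, and of the roots `3` and `6` only the first is
reduced. -/
theorem eq_three_of_reduced {s m z : ℤ} (hs : 3 ≤ s) (hsm : s ≤ m) (hmz : m ≤ z)
    (h2 : 2 * z ≤ s * m) (hr : s ^ 2 + m ^ 2 + z ^ 2 = s * m * z) : s = 3 ∧ m = 3 ∧ z = 3 := by
  have h1 : 0 ≤ (z - m) * (s * m - m - z) := mul_nonneg (by linarith) (by linarith)
  have h4 : s * m ^ 2 ≤ 2 * m ^ 2 + s ^ 2 := by linarith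
  have h3 : 0 ≤ m ^ 2 * (s - 3) := mul_nonneg (sq_nonneg m) (by linarith)
  have h5 : m = s := by
    by_contra hne
    have : 0 < (m - s) * (m + s) := mul_pos (by omega) (by linarith)
    linarith
  subst h5
  have h6 : m = 3 := by
    by_contra hne
    have : 0 < m ^ 2 * (m - 3) := mul_pos (by positivity) (by omega)
    linarith
  subst h6
  have h7 : (z - 3) * (z - 6) = 0 := by linear_combination hr
  rcases mul_eq_zero.1 h7 with h | h <;> omega

/-- Induction on the sum of the traces. As long as `z` is the larger root, strip `autU` or `autV`:
this replaces `z` by the smaller root and makes the larger of the other two traces the new maximum.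
The descent ends at `(3, 3, 3)`. -/
theorem eq_autT_zpow_mul_of_max (n : ℕ) : ∀ θ : MulAut Pi1, θ cusp = cusp →
    absTr (θ genA) ≤ absTr (θ (genA * genB)) → absTr (θ genB) ≤ absTr (θ (genA * genB)) →
    absTr (θ genA) + absTr (θ genB) + absTr (θ (genA * genB)) ≤ n →
    ∃ k : ℤ, ∃ P ∈ posMonoid, θ = autT ^ k * P := by
  induction n with
  | zero =>
    intro θ hθ _ _ h
    obtain ⟨p1, p2, p3⟩ := absTr_pos hθ
    rw [Nat.cast_zero] at h
    omega
  | succ n ih =>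
    intro θ hθ hxz hyz hn
    obtain ⟨p1, p2, p3⟩ := absTr_pos hθ
    have hrel := absTr_rel hθ
    have hx3 := three_le_of_markov p1 hrel
    have hy3 : 3 ≤ absTr (θ genB) :=
      three_le_of_markov (y := absTr (θ genA)) (z := absTr (θ (genA * genB))) p2
        (by linear_combination hrel)
    obtain ⟨u1, u2, u3⟩ := absTr_autU_inv θ hθ
    obtain ⟨v1, v2, v3⟩ := absTr_autV_inv θ hθ
    set x := absTr (θ genA) with hx
    set y := absTr (θ genB) with hy
    set z := absTr (θ (genA * genB)) with hz
    have hcU : (θ * autU⁻¹) cusp = cusp := by rw [MulAut.mul_apply, inv_autU_cusp, hθ]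
    have hcV : (θ * autV⁻¹) cusp = cusp := by rw [MulAut.mul_apply, inv_autV_cusp, hθ]
    have hprod : z * (x * y - z) = x ^ 2 + y ^ 2 := by linear_combination -hrel
    push_cast at hn
    rcases lt_or_ge (x * y) (2 * z) with hlt | hge
    · rcases le_total x y with hxy | hxy
      · have hle : x * y - z ≤ y := quotient_le_of_markov hx3 hxy hlt hprod
        obtain ⟨k, P, hP, h⟩ := ih (θ * autU⁻¹) hcU (by rw [u1, u3]; exact hxy)
          (by rw [u2, u3]; exact hle) (by rw [u1, u2, u3]; omega)
        refine ⟨k, P * autU, posMonoid.mul_mem hP (Submonoid.subset_closure (by simp)), ?_⟩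
        rw [← mul_assoc, ← h]; simp
      · have hle : x * y - z ≤ x := by
          have := quotient_le_of_markov hy3 hxy (by linarith) (z := z)
            (by linear_combination hprod)
          linarith
        obtain ⟨k, P, hP, h⟩ := ih (θ * autV⁻¹) hcV (by rw [v1, v3]; exact hle)
          (by rw [v2, v3]; exact hxy) (by rw [v1, v2, v3]; omega)
        refine ⟨k, P * autV, posMonoid.mul_mem hP (Submonoid.subset_closure (by simp)), ?_⟩
        rw [← mul_assoc, ← h]; simp
    · have h3 : x = 3 ∧ y = 3 ∧ z = 3 := by
        rcases le_total x y with hxy | hxy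
        · exact eq_three_of_reduced hx3 hxy hyz hge hrel
        · obtain ⟨h1, h2, h3⟩ := eq_three_of_reduced hy3 hxy hxz (by linarith)
            (by linear_combination hrel)
          exact ⟨h2, h1, h3⟩
      obtain ⟨k, hk⟩ := eq_autT_zpow_of_absTr hθ h3.1 h3.2.1 h3.2.2
      exact ⟨k, 1, posMonoid.one_mem, by rw [hk, mul_one]⟩

/-- `autT` permutes the traces of `a`, `b`, `ab` cyclically, so at most two applications make that
of `ab` maximal. -/
theorem exists_normal_form {θ : MulAut Pi1} (hθ : θ cusp = cusp) :
    ∃ k j : ℤ, ∃ P ∈ posMonoid, θ * autT ^ j = autT ^ k * P := by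
  have key : ∀ ψ : MulAut Pi1, ψ cusp = cusp → absTr (ψ genA) ≤ absTr (ψ (genA * genB)) →
      absTr (ψ genB) ≤ absTr (ψ (genA * genB)) → ∃ k : ℤ, ∃ P ∈ posMonoid, ψ = autT ^ k * P :=
    fun ψ h1 h2 h3 => eq_autT_zpow_mul_of_max _ ψ h1 h2 h3 (Int.self_le_toNat _)
  obtain ⟨a1, a2, a3⟩ := absTr_autT θ
  obtain ⟨b1, b2, b3⟩ := absTr_autT (θ * autT)
  rw [a3] at b1; rw [a1] at b2; rw [a2] at b3
  have hθ1 : (θ * autT) cusp = cusp := by rw [MulAut.mul_apply, autT_cusp, hθ]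
  have hθ2 : (θ * autT * autT) cusp = cusp := by rw [MulAut.mul_apply, autT_cusp, hθ1]
  by_cases h1 : absTr (θ genA) ≤ absTr (θ (genA * genB)) ∧
      absTr (θ genB) ≤ absTr (θ (genA * genB))
  · obtain ⟨k, P, hP, h⟩ := key θ hθ h1.1 h1.2
    exact ⟨k, 0, P, hP, by simpa using h⟩
  · by_cases h2 : absTr (θ genA) ≤ absTr (θ genB) ∧ absTr (θ (genA * genB)) ≤ absTr (θ genB)
    · obtain ⟨k, P, hP, h⟩ := key (θ * autT) hθ1 (by rw [a1, a3]; exact h2.2)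
        (by rw [a2, a3]; exact h2.1)
      exact ⟨k, 1, P, hP, by simpa using h⟩
    · obtain ⟨k, P, hP, h⟩ := key (θ * autT * autT) hθ2 (by rw [b1, b3]; omega)
        (by rw [b2, b3]; omega)
      exact ⟨k, 2, P, hP, by rw [← h, zpow_two, mul_assoc]⟩

theorem posMonoid_hmat {P : MulAut Pi1} (hP : P ∈ posMonoid) :
    (∀ i j, 0 ≤ hmat P i j) ∧ 1 ≤ hmat P 0 0 ∧ 1 ≤ hmat P 1 1 ∧ (hmat P).det = 1 ∧
      (P = 1 ∨ 1 ≤ hmat P 0 1 + hmat P 1 0) := by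
  induction hP using Submonoid.closure_induction with
  | mem x hx =>
    rcases hx with rfl | hx
    · rw [hmat_autU]
      refine ⟨fun i j => ?_, by simp, by simp, by simp [Matrix.det_fin_two], Or.inr (by simp)⟩
      fin_cases i <;> fin_cases j <;> simp
    · rw [Set.mem_singleton_iff] at hx
      rw [hx, hmat_autV]
      refine ⟨fun i j => ?_, by simp, by simp, by simp [Matrix.det_fin_two], Or.inr (by simp)⟩
      fin_cases i <;> fin_cases j <;> simp
  | one =>
    rw [map_one]
    refine ⟨fun i j => ?_, by simp, by simp, by simp, Or.inl rfl⟩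
    fin_cases i <;> fin_cases j <;> simp
  | mul x y _ _ hx hy =>
    obtain ⟨x1, x2, x3, x4, x5⟩ := hx
    obtain ⟨y1, y2, y3, y4, y5⟩ := hy
    rw [map_mul]
    simp only [Matrix.mul_apply, Fin.sum_univ_two, Matrix.det_mul, x4, y4, mul_one]
    have a := x1 0 1
    have b := x1 1 0
    have c := y1 0 1
    have d := y1 1 0
    refine ⟨fun i j => ?_, by nlinarith, by nlinarith, trivial, ?_⟩
    · have := x1 i 0
      have := x1 i 1
      have := y1 0 j
      have := y1 1 j
      positivity
    · rcases x5 with rfl | x5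
      · rcases y5 with rfl | y5
        · left; simp
        · right; nlinarith
      · right; nlinarith

/-! ### Mapping classes are determined by homology -/

theorem hmat_autT_pow_six : hmat (autT ^ 6) = 1 := by
  rw [autT_pow_six, hmat_conj]

theorem exists_normal_form_mcg {θ : MulAut Pi1} (hθ : θ ∈ MCG) :
    ∃ c : Pi1, ∃ k j : ℤ, ∃ P ∈ posMonoid, MulAut.conj c * θ * autT ^ j = autT ^ k * P := by
  obtain ⟨c, hc⟩ := isConj_iff.1 (show IsConj (θ cusp) cusp from hθ)
  have : (MulAut.conj c * θ) cusp = cusp := by simpa using hc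
  obtain ⟨k, j, P, hP, h⟩ := exists_normal_form this
  exact ⟨c, k, j, P, hP, h⟩

/-- In the normal form the positive part acts on homology as a power of the matrix of order six of
`autT`. Only the identity among these powers has non-negative entries and positive diagonal, so the
positive part is trivial and the exponent is divisible by six, which makes the automorphism inner.
-/
theorem mem_range_conj_of_hmat {θ : MulAut Pi1} (hθ : θ ∈ MCG) (h1 : hmat θ = 1) :
    ∃ g, θ = MulAut.conj g := by
  obtain ⟨c, k, j, P, hP, h⟩ := exists_normal_form_mcg hθ
  obtain ⟨p1, p2, p3, p4, p5⟩ := posMonoid_hmat hP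
  have hP' : P = autT ^ (-k) * (MulAut.conj c * θ) * autT ^ j := by
    rw [mul_assoc, h, ← mul_assoc, ← zpow_add]; simp
  have hmP : hmat P = hmat (autT ^ (j - k)) := by
    rw [hP', map_mul, map_mul, map_mul, hmat_conj, h1, mul_one, mul_one, ← map_mul, ← zpow_add]
    congr 2; ring
  have hker : ∀ q : ℤ, hmat ((autT ^ 6) ^ q) = 1 := fun q =>
    (MonoidHom.mem_ker (f := hmat)).1
      (zpow_mem ((MonoidHom.mem_ker (f := hmat)).2 hmat_autT_pow_six) q)
  obtain ⟨q, r, hr0, hr6, hqr⟩ : ∃ q r : ℤ, 0 ≤ r ∧ r < 6 ∧ j - k = 6 * q + r :=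
    ⟨(j - k) / 6, (j - k) % 6, by omega, by omega, by omega⟩
  have hT : autT ^ (j - k) = (autT ^ 6) ^ q * autT ^ r := by
    rw [hqr, zpow_add, zpow_mul]; rfl
  rw [hT, map_mul, hker, one_mul] at hmP
  have hr : r = 0 := by
    have h00 := p2
    have h11 := p3
    have h01 := p1 0 1
    rw [hmP] at h00 h11 h01
    interval_cases r
    · rfl
    all_goals
      exfalso
      revert h00 h11 h01
      have e : ∀ m : ℕ, hmat (autT ^ (m : ℤ)) = !![1, -1; 1, 0] ^ m := fun m => by
        rw [zpow_natCast, map_pow, hmat_autT]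
    · rw [show (1 : ℤ) = ((1 : ℕ) : ℤ) from rfl, e]; decide
    · rw [show (2 : ℤ) = ((2 : ℕ) : ℤ) from rfl, e]; decide
    · rw [show (3 : ℤ) = ((3 : ℕ) : ℤ) from rfl, e]; decide
    · rw [show (4 : ℤ) = ((4 : ℕ) : ℤ) from rfl, e]; decide
    · rw [show (5 : ℤ) = ((5 : ℕ) : ℤ) from rfl, e]; decide
  subst hr
  have hP1 : P = 1 := by
    rcases p5 with h | h
    · exact h
    · rw [hmP] at h
      simp at h
  rw [hP1, mul_one] at h
  have h2 : MulAut.conj c * θ = (autT ^ 6) ^ (-q) := by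
    have h3 : MulAut.conj c * θ = autT ^ (k - j) := by
      rw [zpow_sub, ← h]; group
    have h6 : (autT ^ 6 : MulAut Pi1) = autT ^ (6 : ℤ) := rfl
    rw [h3, h6, ← zpow_mul]
    congr 1
    omega
  rw [autT_pow_six, ← map_zpow] at h2
  refine ⟨c⁻¹ * cusp ^ (-q), ?_⟩
  rw [map_mul, ← h2, map_inv]
  group

theorem det_hmat {θ : MulAut Pi1} (hθ : θ ∈ MCG) : (hmat θ).det = 1 := by
  obtain ⟨c, k, j, P, hP, h⟩ := exists_normal_form_mcg hθ
  have hT : ∀ n : ℤ, (hmat (autT ^ n)).det = 1 := by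
    have : autT ∈ (Matrix.detMonoidHom.comp hmat).ker := by
      rw [MonoidHom.mem_ker]
      show (hmat autT).det = 1
      rw [hmat_autT]; simp [Matrix.det_fin_two]
    exact fun n => (MonoidHom.mem_ker (f := Matrix.detMonoidHom.comp hmat)).1 (zpow_mem this n)
  have h2 := congrArg (fun ψ => (hmat ψ).det) h
  simp only [map_mul, Matrix.det_mul, hT, (posMonoid_hmat hP).2.2.2.1, hmat_conj,
    Matrix.det_one] at h2
  linarith

/-- `ψ⁻¹ φ` fixes the class of `a`, so it acts on homology by an upper unipotent matrix. Composing
with a power of `autU`, which fixes `a` itself, makes the action trivial and hence the automorphism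
inner. -/
theorem isConj_of_expSum_eq {φ ψ : MulAut Pi1} (hφ : φ ∈ MCG) (hψ : ψ ∈ MCG)
    (h : ∀ i, expSum i (φ genA) = expSum i (ψ genA)) : IsConj (ψ genA) (φ genA) := by
  have hθ : ψ⁻¹ * φ ∈ MCG := MCG.mul_mem (MCG.inv_mem hψ) hφ
  have hmul : hmat φ = hmat ψ * hmat (ψ⁻¹ * φ) := by rw [← map_mul]; simp
  have hd := det_hmat hθ
  have hdψ := det_hmat hψ
  set N := hmat (ψ⁻¹ * φ) with hN
  have e0 := congrFun (congrFun hmul 0) 0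
  have e1 := congrFun (congrFun hmul 1) 0
  simp only [Matrix.mul_apply, Fin.sum_univ_two, hmat_apply] at e0 e1
  simp only [hmat_apply, Matrix.det_fin_two_of] at hdψ
  simp at e0 e1
  rw [h 0] at e0
  rw [h 1] at e1
  rw [Matrix.det_fin_two] at hd
  have n00 : N 0 0 = 1 := by
    linear_combination (1 - N 0 0) * hdψ - expSum 1 (ψ genB) * e0 + expSum 0 (ψ genB) * e1
  have n10 : N 1 0 = 0 := by
    linear_combination -N 1 0 * hdψ + expSum 1 (ψ genA) * e0 - expSum 0 (ψ genA) * e1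
  have n11 : N 1 1 = 1 := by rw [n00, n10] at hd; linarith
  have hU : ∀ k : ℤ, hmat (autU ^ k) = !![1, k; 0, 1] := by
    intro k
    induction k with
    | zero => ext i j; fin_cases i <;> fin_cases j <;> simp
    | succ n ih =>
      rw [zpow_add_one, map_mul, ih, hmat_autU]
      ext i j; fin_cases i <;> fin_cases j <;> simp [Matrix.mul_apply, Fin.sum_univ_two]; ring
    | pred n ih =>
      have hi : hmat autU⁻¹ = !![1, -1; 0, 1] := by
        simp [hmat_apply, expSum_mul, expSum_inv, expSum_genA, expSum_genB]
      rw [zpow_sub_one, map_mul, ih, hi]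
      ext i j; fin_cases i <;> fin_cases j <;> simp [Matrix.mul_apply, Fin.sum_univ_two]; ring
  have hfixA : ∀ k : ℤ, (autU ^ k) genA = genA := by
    intro k
    have : autU ∈ MulAction.stabilizer (MulAut Pi1) genA := autU_genA
    exact zpow_mem this k
  have h1 : hmat (ψ⁻¹ * φ * autU ^ (-(N 0 1))) = 1 := by
    rw [map_mul, ← hN, hU]
    ext i j
    fin_cases i <;> fin_cases j <;> simp [Matrix.mul_apply, Fin.sum_univ_two, n00, n10, n11]
  obtain ⟨g, hg⟩ := mem_range_conj_of_hmat (MCG.mul_mem hθ (MCG.zpow_mem autU_mem _)) h1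
  have h2 := DFunLike.congr_fun hg genA
  rw [MulAut.mul_apply, hfixA, MulAut.conj_apply, MulAut.mul_apply] at h2
  have h3 : φ genA = ψ (g * genA * g⁻¹) := by rw [← h2, MulAut.apply_inv_self]
  rw [h3]
  exact isConj_iff.2 ⟨ψ g, by simp⟩

theorem exists_hmat_eq (M : SL(2, ℤ)) : ∃ θ ∈ MCG, hmat θ = M.val := by
  have hM : M ∈ Subgroup.closure {ModularGroup.S, ModularGroup.T} := by
    rw [SpecialLinearGroup.SL2Z_generators]; trivial
  induction hM using Subgroup.closure_induction with
  | mem x hx =>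
    rcases hx with rfl | hx
    · exact ⟨autS, autS_mem, by rw [hmat_autS]; rfl⟩
    · rw [Set.mem_singleton_iff] at hx
      exact ⟨autU, autU_mem, by rw [hmat_autU, hx]; rfl⟩
  | one => exact ⟨1, MCG.one_mem, by simp⟩
  | mul x y _ _ hx hy =>
    obtain ⟨θ, hθ, h1⟩ := hx
    obtain ⟨ψ, hψ, h2⟩ := hy
    exact ⟨θ * ψ, MCG.mul_mem hθ hψ, by rw [map_mul, h1, h2, Matrix.SpecialLinearGroup.coe_mul]⟩
  | inv x _ hx =>
    obtain ⟨θ, hθ, h1⟩ := hx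
    refine ⟨θ⁻¹, MCG.inv_mem hθ, ?_⟩
    have h2 : hmat θ⁻¹ * x.val = 1 := by rw [← h1, ← map_mul]; simp
    have h3 : x.val * (x⁻¹).val = 1 := by rw [← Matrix.SpecialLinearGroup.coe_mul]; simp
    calc hmat θ⁻¹ = hmat θ⁻¹ * (x.val * (x⁻¹).val) := by rw [h3, mul_one]
      _ = (x⁻¹).val := by rw [← mul_assoc, h2, one_mul]

/-- Simple closed curves with non-negative coordinates are represented by positive words. -/
theorem exists_positive_word (n : ℕ) : ∀ p q : ℕ, p + q ≤ n → Nat.Coprime p q →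
    ∃ θ ∈ MCG, θ genA ∈ Submonoid.closure {genA, genB} ∧
      expSum 0 (θ genA) = p ∧ expSum 1 (θ genA) = q := by
  have pos : ∀ (ψ : MulAut Pi1), ψ genA ∈ Submonoid.closure ({genA, genB} : Set Pi1) →
      ψ genB ∈ Submonoid.closure ({genA, genB} : Set Pi1) → ∀ g ∈ Submonoid.closure {genA, genB},
      ψ g ∈ Submonoid.closure ({genA, genB} : Set Pi1) := by
    intro ψ hA hB g hg
    induction hg using Submonoid.closure_induction with
    | mem x hx =>
      rcases hx with rfl | hx
      · exact hA
      · rw [Set.mem_singleton_iff] at hx; rw [hx]; exact hB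
    | one => rw [map_one]; exact Submonoid.one_mem _
    | mul x y _ _ hx hy => rw [map_mul]; exact Submonoid.mul_mem _ hx hy
  have hA : genA ∈ Submonoid.closure ({genA, genB} : Set Pi1) :=
    Submonoid.subset_closure (by simp)
  have hB : genB ∈ Submonoid.closure ({genA, genB} : Set Pi1) :=
    Submonoid.subset_closure (by simp)
  induction n with
  | zero =>
    intro p q h hc
    obtain ⟨rfl, rfl⟩ : p = 0 ∧ q = 0 := by omega
    simp at hc
  | succ n ih =>
    intro p q h hc
    rcases Nat.eq_zero_or_pos q with rfl | hq
    · have hp : p = 1 := by simpa using hc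
      exact ⟨1, MCG.one_mem, hA, by simp [expSum_genA, hp], by simp [expSum_genA]⟩
    rcases Nat.eq_zero_or_pos p with rfl | hp
    · have hq : q = 1 := by simpa using hc
      exact ⟨autS, autS_mem, by simpa using hB, by simp [expSum_genB], by simp [expSum_genB, hq]⟩
    rcases le_total q p with hqp | hpq
    · obtain ⟨θ, hθ, h1, h2, h3⟩ := ih (p - q) q (by omega)
        (by rwa [Nat.coprime_sub_self_left hqp])
      refine ⟨autU * θ, MCG.mul_mem autU_mem hθ, ?_, ?_, ?_⟩
      · exact pos autU (by simpa using hA) (by simpa using mul_mem hB hA) _ h1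
      · have := expSum_hom 0 autU.toMonoidHom (θ genA)
        rw [h2, h3] at this
        simp [expSum_mul, expSum_genA, expSum_genB] at this
        simp; omega
      · have := expSum_hom 1 autU.toMonoidHom (θ genA)
        rw [h2, h3] at this
        simp [expSum_mul, expSum_genA, expSum_genB] at this
        simp; omega
    · obtain ⟨θ, hθ, h1, h2, h3⟩ := ih p (q - p) (by omega)
        (by rwa [Nat.coprime_sub_self_right hpq])
      refine ⟨autV * θ, MCG.mul_mem autV_mem hθ, ?_, ?_, ?_⟩
      · exact pos autV (by simpa using mul_mem hA hB) (by simpa using hB) _ h1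
      · have := expSum_hom 0 autV.toMonoidHom (θ genA)
        rw [h2, h3] at this
        simp [expSum_mul, expSum_genA, expSum_genB] at this
        simp; omega
      · have := expSum_hom 1 autV.toMonoidHom (θ genA)
        rw [h2, h3] at this
        simp [expSum_mul, expSum_genA, expSum_genB] at this
        simp; omega

/-! ### Homology classes of simple closed curves -/

/-- The algebraic intersection form on homology. -/
def cross (u v : ℤ × ℤ) : ℤ := u.1 * v.2 - u.2 * v.1

/-- The homology class of an element of the fundamental group. -/
def homCls (g : Pi1) : ℤ × ℤ := (expSum 0 g, expSum 1 g)

theorem homCls_mul (g h : Pi1) : homCls (g * h) = homCls g + homCls h := by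
  simp [homCls, expSum_mul]

theorem homCls_inv (g : Pi1) : homCls g⁻¹ = -homCls g := by
  simp [homCls, expSum_inv]

/-- The primitive homology classes. -/
def Prim (u : ℤ × ℤ) : Prop := ∃ v, cross u v = 1

theorem cross_add_left (u v w : ℤ × ℤ) : cross (u + v) w = cross u w + cross v w := by
  simp [cross]; ring

theorem cross_add_right (u v w : ℤ × ℤ) : cross u (v + w) = cross u v + cross u w := by
  simp [cross]; ring

theorem cross_neg_left (u v : ℤ × ℤ) : cross (-u) v = -cross u v := by
  simp [cross]; ring

theorem cross_neg_right (u v : ℤ × ℤ) : cross u (-v) = -cross u v := by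
  simp [cross]; ring

theorem cross_self (u : ℤ × ℤ) : cross u u = 0 := by
  simp [cross]; ring

theorem cross_comm (u v : ℤ × ℤ) : cross v u = -cross u v := by
  simp [cross]; ring

theorem cross_sub_left (u v w : ℤ × ℤ) : cross (u - v) w = cross u w - cross v w := by
  simp [cross]; ring

theorem cross_sub_right (u v w : ℤ × ℤ) : cross u (v - w) = cross u v - cross u w := by
  simp [cross]; ring

theorem Prim.of_cross_right {u v : ℤ × ℤ} (h : cross u v = 1) : Prim v :=
  ⟨-u, by rw [cross_neg_right, cross_comm, neg_neg, h]⟩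

theorem Prim.neg {u : ℤ × ℤ} (h : Prim u) : Prim (-u) := by
  obtain ⟨v, hv⟩ := h
  exact ⟨-v, by rw [cross_neg_left, cross_neg_right, neg_neg, hv]⟩

theorem cross_homCls {φ : MulAut Pi1} (hφ : φ ∈ MCG) :
    cross (homCls (φ genA)) (homCls (φ genB)) = 1 := by
  have h := det_hmat hφ
  rw [hmat_apply, Matrix.det_fin_two_of] at h
  simp only [cross, homCls]
  linarith

theorem exists_basis_of_cross {u v : ℤ × ℤ} (h : cross u v = 1) :
    ∃ φ ∈ MCG, homCls (φ genA) = u ∧ homCls (φ genB) = v := by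
  obtain ⟨φ, hφ, h1⟩ := exists_hmat_eq ⟨!![u.1, v.1; u.2, v.2], by
    rw [Matrix.det_fin_two_of]; simp only [cross] at h; linarith⟩
  rw [hmat_apply] at h1
  have e00 := congrFun (congrFun h1 0) 0
  have e01 := congrFun (congrFun h1 0) 1
  have e10 := congrFun (congrFun h1 1) 0
  have e11 := congrFun (congrFun h1 1) 1
  simp at e00 e01 e10 e11
  exact ⟨φ, hφ, Prod.ext e00 e10, Prod.ext e01 e11⟩

theorem Prim.exists_mcg {u : ℤ × ℤ} (h : Prim u) : ∃ φ ∈ MCG, homCls (φ genA) = u := by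
  obtain ⟨v, hv⟩ := h
  obtain ⟨φ, hφ, h1, -⟩ := exists_basis_of_cross hv
  exact ⟨φ, hφ, h1⟩

/-- The homology class of a simple closed curve. -/
def SimpleCurve.cls (γ : SimpleCurve) : ℤ × ℤ := homCls γ.1

theorem SimpleCurve.prim (γ : SimpleCurve) : Prim γ.cls := by
  obtain ⟨g, φ, hφ, rfl⟩ := γ
  exact ⟨_, cross_homCls hφ⟩

theorem Prim.exists_curve {u : ℤ × ℤ} (h : Prim u) : ∃ γ : SimpleCurve, γ.cls = u := by
  obtain ⟨φ, hφ, h1⟩ := h.exists_mcg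
  exact ⟨⟨φ genA, φ, hφ, rfl⟩, h1⟩

theorem inter_eq (γ δ : SimpleCurve) : inter γ δ = |((cross γ.cls δ.cls : ℤ) : ℝ)| := rfl

/-! ### Traces of curves on Teichmüller space -/

theorem ProjConj.abs_tr {ρ σ : Pi1 →* SL(2, ℝ)} (h : ProjConj ρ σ) (g : Pi1) :
    |tr (ρ g)| = |tr (σ g)| := by
  obtain ⟨C, hC⟩ := h
  rcases hC g with h | h <;> rw [h]
  · rw [tr_conj]
  · rw [tr_neg, abs_neg, tr_conj]

/-- The absolute value of the trace of the holonomy. -/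
def Teich.trc (X : Teich) (g : Pi1) : ℝ :=
  Quotient.lift (fun ρ : FuchsianRep => |tr (ρ.toHom g)|) (fun _ _ h => ProjConj.abs_tr h g) X

theorem Teich.trc_mk (ρ : FuchsianRep) (g : Pi1) : (Teich.mk ρ).trc g = |tr (ρ.toHom g)| := rfl

theorem Teich.exists_rep (X : Teich) : ∃ ρ, Teich.mk ρ = X := Quotient.exists_rep X

theorem continuous_toHom (g : Pi1) : Continuous fun ρ : FuchsianRep => ρ.toHom g :=
  (continuous_apply g).comp continuous_induced_dom

theorem Teich.continuous_trc (g : Pi1) : Continuous fun X : Teich => X.trc g :=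
  continuous_quot_lift _ (continuous_abs.comp (continuous_tr.comp (continuous_toHom g)))

theorem Teich.trc_conj (X : Teich) (g h : Pi1) : X.trc (h * g * h⁻¹) = X.trc g := by
  obtain ⟨ρ, rfl⟩ := X.exists_rep
  rw [trc_mk, trc_mk, map_mul, map_mul, map_inv, tr_conj]

theorem Teich.trc_inv (X : Teich) (g : Pi1) : X.trc g⁻¹ = X.trc g := by
  obtain ⟨ρ, rfl⟩ := X.exists_rep
  rw [trc_mk, trc_mk, map_inv, tr_inv]

theorem Teich.trc_isConj (X : Teich) {g h : Pi1} (H : IsConj g h) : X.trc g = X.trc h := by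
  obtain ⟨c, rfl⟩ := isConj_iff.1 H
  rw [trc_conj]

theorem tr_comp_cusp (ρ : FuchsianRep) {φ : MulAut Pi1} (hφ : φ ∈ MCG) :
    tr ((ρ.toHom.comp φ.toMonoidHom) cusp) = -2 := by
  obtain ⟨c, hc⟩ := isConj_iff.1 (show IsConj (φ cusp) cusp from hφ)
  have h := ρ.tr_cusp
  rw [← hc, map_mul, map_mul, map_inv, tr_conj] at h
  exact h

theorem tr_comp_genA_ne_zero (ρ : FuchsianRep) (φ : MulAut Pi1) :
    tr ((ρ.toHom.comp φ.toMonoidHom) genA) ≠ 0 := by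
  intro h
  have h1 : φ (genA * genA) = 1 := by
    apply ρ.faithful
    right
    rw [map_mul, map_mul]
    exact mul_self_of_tr_eq_zero h
  exact genA_mul_self_ne_one ((MulEquiv.map_eq_one_iff φ).1 h1)

/-- The action of a mapping class on representations. -/
def FuchsianRep.precomp (ρ : FuchsianRep) {φ : MulAut Pi1} (hφ : φ ∈ MCG) : FuchsianRep :=
  mkRep (ρ.toHom.comp φ.toMonoidHom) (tr_comp_cusp ρ hφ) (tr_comp_genA_ne_zero ρ φ)

theorem FuchsianRep.precomp_apply (ρ : FuchsianRep) {φ : MulAut Pi1} (hφ : φ ∈ MCG) (g : Pi1) :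
    (ρ.precomp hφ).toHom g = ρ.toHom (φ g) := rfl

open Classical in
/-- The absolute trace of the simple closed curve in a primitive homology class. -/
noncomputable def Teich.m (X : Teich) (u : ℤ × ℤ) : ℝ :=
  if h : ∃ φ ∈ MCG, homCls (φ genA) = u then X.trc (h.choose genA) else 0

/-- The choice made in `Teich.m` is harmless, since homologous simple closed curves are conjugate.
Classes that are not primitive get the filler value `0`. -/
theorem Teich.m_homCls (X : Teich) {φ : MulAut Pi1} (hφ : φ ∈ MCG) :
    X.m (homCls (φ genA)) = X.trc (φ genA) := by
  have h : ∃ ψ ∈ MCG, homCls (ψ genA) = homCls (φ genA) := ⟨φ, hφ, rfl⟩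
  rw [m, dif_pos h]
  obtain ⟨h1, h2⟩ := h.choose_spec
  refine X.trc_isConj (isConj_of_expSum_eq hφ h1 fun i => ?_).symm.symm
  fin_cases i
  · exact (congrArg Prod.fst h2).symm
  · exact (congrArg Prod.snd h2).symm

theorem Teich.m_cls (X : Teich) (γ : SimpleCurve) : X.m γ.cls = X.trc γ.1 := by
  obtain ⟨g, φ, hφ, rfl⟩ := γ
  exact X.m_homCls hφ

theorem Teich.continuous_m (u : ℤ × ℤ) : Continuous fun X : Teich => X.m u := by
  unfold m
  split
  · exact continuous_trc _
  · exact continuous_const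

theorem Teich.m_genB (X : Teich) {φ : MulAut Pi1} (hφ : φ ∈ MCG) :
    X.m (homCls (φ genB)) = X.trc (φ genB) := by
  simpa using X.m_homCls (MCG.mul_mem hφ autS_mem)

theorem Teich.m_add (X : Teich) {φ : MulAut Pi1} (hφ : φ ∈ MCG) :
    X.m (homCls (φ genA) + homCls (φ genB)) = X.trc (φ (genA * genB)) := by
  have := X.m_homCls (MCG.mul_mem hφ autV_mem)
  rw [MulAut.mul_apply, autV_genA] at this
  rw [← this, map_mul, homCls_mul]

theorem Teich.m_sub (X : Teich) {φ : MulAut Pi1} (hφ : φ ∈ MCG) :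
    X.m (homCls (φ genA) - homCls (φ genB)) = X.trc (φ (genA * genB⁻¹)) := by
  have := X.m_homCls (MCG.mul_mem hφ (MCG.inv_mem autV_mem))
  rw [MulAut.mul_apply, autV_inv_genA] at this
  rw [← this, map_mul, homCls_mul, map_inv, homCls_inv, sub_eq_add_neg]

theorem Teich.m_neg (X : Teich) (u : ℤ × ℤ) : X.m (-u) = X.m u := by
  by_cases h : ∃ φ ∈ MCG, homCls (φ genA) = u
  · obtain ⟨φ, hφ, rfl⟩ := h
    have := X.m_homCls (MCG.mul_mem (MCG.mul_mem hφ autS_mem) autS_mem)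
    simp only [MulAut.mul_apply, autS_genA, autS_genB, map_inv, homCls_inv] at this
    rw [this, X.m_homCls hφ, trc_inv]
  · have h' : ¬ ∃ φ ∈ MCG, homCls (φ genA) = -u := by
      rintro ⟨φ, hφ, h1⟩
      refine h ⟨φ * autS * autS, MCG.mul_mem (MCG.mul_mem hφ autS_mem) autS_mem, ?_⟩
      simp only [MulAut.mul_apply, autS_genA, autS_genB, map_inv, homCls_inv, h1, neg_neg]
    rw [m, m, dif_neg h, dif_neg h']

theorem two_lt_of_mem_triples {x y z : ℝ} (h : (x, y, z) ∈ Triples) : 2 < x := by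
  obtain ⟨hx, hy, hz, hr⟩ := h
  simp only at hx hy hz hr
  by_contra hc
  push Not at hc
  have : 0 ≤ y * z * (2 - x) := by
    have := mul_pos hy hz
    exact mul_nonneg this.le (by linarith)
  nlinarith [sq_nonneg (y - z)]

theorem Teich.m_mem_triples (X : Teich) {u v : ℤ × ℤ} (h : cross u v = 1) :
    (X.m u, X.m v, X.m (u + v)) ∈ Triples := by
  obtain ⟨φ, hφ, rfl, rfl⟩ := exists_basis_of_cross h
  obtain ⟨ρ, rfl⟩ := X.exists_rep
  rw [m_homCls _ hφ, m_genB _ hφ, m_add _ hφ]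
  exact abs_tr_mem_triples (tr_comp_cusp ρ hφ) (tr_comp_genA_ne_zero ρ φ)

theorem Teich.two_lt_m (X : Teich) {u : ℤ × ℤ} (h : Prim u) : 2 < X.m u := by
  obtain ⟨v, hv⟩ := h
  exact two_lt_of_mem_triples (X.m_mem_triples hv)

theorem Teich.m_markov (X : Teich) {u v : ℤ × ℤ} (h : cross u v = 1) :
    X.m u ^ 2 + X.m v ^ 2 + X.m (u + v) ^ 2 = X.m u * X.m v * X.m (u + v) :=
  (X.m_mem_triples h).2.2.2

/-- The traces of product and quotient have the same sign, because their product is a sum of two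
squares, so the trace identity holds for absolute values. -/
theorem Teich.m_add_m_sub (X : Teich) {u v : ℤ × ℤ} (h : cross u v = 1) :
    X.m (u + v) + X.m (u - v) = X.m u * X.m v := by
  have h1 := X.m_markov h
  have h2 := (X.m_mem_triples h).2.2.1
  obtain ⟨φ, hφ, rfl, rfl⟩ := exists_basis_of_cross h
  obtain ⟨ρ, rfl⟩ := X.exists_rep
  rw [m_sub _ hφ]
  rw [m_homCls _ hφ, m_genB _ hφ, m_add _ hφ] at *
  rw [trc_mk, trc_mk, trc_mk, trc_mk] at *
  have h3 := tr_mul_add (ρ.toHom (φ genA)) (ρ.toHom (φ genB))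
  rw [← map_inv, ← map_inv, ← map_mul, ← map_mul, ← map_mul, ← map_mul] at h3
  simp only [sq_abs, ← abs_mul] at h1 ⊢
  rw [← h3]
  have h4 : 0 < tr (ρ.toHom (φ (genA * genB))) * tr (ρ.toHom (φ (genA * genB⁻¹))) := by
    have hC := tr_sq_rel (tr_comp_cusp ρ hφ)
    have hA := tr_comp_genA_ne_zero ρ φ
    change tr (ρ.toHom (φ genA)) ≠ 0 at hA
    change tr (ρ.toHom (φ genA)) ^ 2 + tr (ρ.toHom (φ genB)) ^ 2 +
      tr (ρ.toHom (φ (genA * genB))) ^ 2 = tr (ρ.toHom (φ genA)) * tr (ρ.toHom (φ genB)) *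
      tr (ρ.toHom (φ (genA * genB))) at hC
    have e : tr (ρ.toHom (φ (genA * genB))) * tr (ρ.toHom (φ (genA * genB⁻¹))) =
        tr (ρ.toHom (φ genA)) ^ 2 + tr (ρ.toHom (φ genB)) ^ 2 := by
      linear_combination tr (ρ.toHom (φ (genA * genB))) * h3 - hC
    rw [e]
    positivity
  rcases pos_and_pos_or_neg_and_neg_of_mul_pos h4 with ⟨p, q⟩ | ⟨p, q⟩
  · rw [abs_of_pos p, abs_of_pos q, abs_of_pos (by linarith)]
  · rw [abs_of_neg p, abs_of_neg q, abs_of_neg (by linarith)]; ring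

/-! ### Existence of twists -/

theorem sq_sub_four_pos {x : ℝ} (h : 2 < |x|) : 0 < x ^ 2 - 4 := by
  rw [← sq_abs]; nlinarith

theorem det_axisTranslation {A : SL(2, ℝ)} (hA : 2 < |tr A|) (s : ℝ) :
    (axisTranslation A s).det = 1 := by
  have hpos := sq_sub_four_pos hA
  have hsq := Real.sq_sqrt hpos.le
  have hs : Real.sqrt (tr A ^ 2 - 4) ≠ 0 := (Real.sqrt_pos.2 hpos).ne'
  have hsign : ((SignType.sign (tr A) : SignType) : ℝ) ^ 2 = 1 := by
    rcases lt_trichotomy (tr A) 0 with h | h | h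
    · rw [sign_neg h]; simp
    · rw [h] at hA; simp at hA; linarith
    · rw [sign_pos h]; simp
  have d := det_entries A
  have hc := Real.cosh_sq (s / 2)
  rw [axisTranslation]
  change (_ + (Real.sinh (s / 2) * (SignType.sign (tr A) : ℝ) / Real.sqrt (tr A ^ 2 - 4)) •
    ((2 : ℝ) • A.val - tr A • (1 : Matrix (Fin 2) (Fin 2) ℝ))).det = 1
  set β := Real.sinh (s / 2) * (SignType.sign (tr A) : ℝ) / Real.sqrt (tr A ^ 2 - 4) with hβ
  have hβ2 : β ^ 2 * (tr A ^ 2 - 4) = Real.sinh (s / 2) ^ 2 := by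
    rw [hβ, div_pow, hsq, mul_pow, hsign]; field_simp
  have ht := tr_def A
  rw [Matrix.det_fin_two]
  simp
  rw [ht] at hβ2 ⊢
  linear_combination hc - hβ2 + 4 * β ^ 2 * d

theorem axisTranslation_comm (A : SL(2, ℝ)) (s : ℝ) :
    axisTranslation A s * A.val = A.val * axisTranslation A s := by
  simp [axisTranslation, Matrix.add_mul, Matrix.mul_add, Matrix.sub_mul, Matrix.mul_sub]

theorem two_lt_abs_tr (ρ : FuchsianRep) {φ : MulAut Pi1} (hφ : φ ∈ MCG) :
    2 < |tr (ρ.toHom (φ genA))| := by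
  rw [← Teich.trc_mk, ← Teich.m_homCls _ hφ]
  exact Teich.two_lt_m _ ⟨_, cross_homCls hφ⟩

/-- The translation along the axis of `φ a` commutes with the image of `φ a`, so the twist leaves
the commutator unchanged. Trace `-2` then yields discreteness and faithfulness through `mkRep`. -/
theorem exists_isTwist (X : Teich) (γ : SimpleCurve) (s : ℝ) : ∃ Y, IsTwist X γ s Y := by
  obtain ⟨g, φ, hφ, rfl⟩ := γ
  obtain ⟨ρ, rfl⟩ := X.exists_rep
  have h2 := two_lt_abs_tr ρ hφ
  let T : SL(2, ℝ) := ⟨axisTranslation (ρ.toHom (φ genA)) s, det_axisTranslation h2 s⟩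
  have hT : T * ρ.toHom (φ genA) = ρ.toHom (φ genA) * T :=
    Subtype.ext (axisTranslation_comm _ s)
  let τ : Pi1 →* SL(2, ℝ) := FreeGroup.lift ![ρ.toHom (φ genA), ρ.toHom (φ genB) * T]
  have hτA : τ genA = ρ.toHom (φ genA) := by simp [τ, genA]
  have hτB : τ genB = ρ.toHom (φ genB) * T := by simp [τ, genB]
  have hC : tr (τ cusp) = -2 := by
    rw [← tr_comp_cusp ρ hφ, map_cusp, map_cusp, hτA, hτB]
    congr 1
    show _ = ρ.toHom (φ genA) * ρ.toHom (φ genB) * (ρ.toHom (φ genA))⁻¹ * (ρ.toHom (φ genB))⁻¹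
    have h3 : T * (ρ.toHom (φ genA))⁻¹ = (ρ.toHom (φ genA))⁻¹ * T := by
      rw [eq_inv_mul_iff_mul_eq, ← mul_assoc, ← hT]; group
    rw [mul_inv_rev, mul_assoc, mul_assoc, mul_assoc, mul_assoc, mul_assoc]
    congr 2
    rw [← mul_assoc T, h3]; group
  have hA : tr (τ genA) ≠ 0 := by rw [hτA]; exact tr_comp_genA_ne_zero ρ φ
  refine ⟨Teich.mk ((mkRep τ hC hA).precomp (MCG.inv_mem hφ)), φ, hφ, rfl, ρ, _, rfl, rfl, ?_, ?_⟩
  · rw [FuchsianRep.precomp_apply, MulAut.inv_apply_self]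
    exact hτA
  · rw [FuchsianRep.precomp_apply, MulAut.inv_apply_self]
    show (τ genB).val = _
    rw [hτB]; rfl

/-! ### Traces along twists -/

/-- The trace of a curve that crosses once, after a twist. -/
noncomputable def twistTrace (x y z s : ℝ) : ℝ :=
  Real.cosh (s / 2) * y + Real.sinh (s / 2) / Real.sqrt (x ^ 2 - 4) * (2 * z - x * y)

/-- By Markov's equation `(2z - xy)² = y² (x² - 4) - 4x²`, so the coefficient of `sinh` is smaller
in absolute value than that of `cosh`. -/
theorem twistTrace_pos {x y z : ℝ} (h : (x, y, z) ∈ Triples) (s : ℝ) : 0 < twistTrace x y z s := by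
  have hx := two_lt_of_mem_triples h
  obtain ⟨-, hy, hz, hr⟩ := h
  simp only at hy hz hr
  have hpos : 0 < x ^ 2 - 4 := by nlinarith
  have hD := Real.sqrt_pos.2 hpos
  have hsq := Real.sq_sqrt hpos.le
  set D := Real.sqrt (x ^ 2 - 4)
  have h1 : |2 * z - x * y| < D * y := by
    apply abs_lt_of_sq_lt_sq
    · rw [mul_pow, hsq]; nlinarith
    · positivity
  have h2 : |Real.sinh (s / 2)| < Real.cosh (s / 2) := by
    apply abs_lt_of_sq_lt_sq
    · rw [Real.cosh_sq]; linarith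
    · exact (Real.cosh_pos _).le
  have h3 : |Real.sinh (s / 2) / D * (2 * z - x * y)| < Real.cosh (s / 2) * y := by
    rw [abs_mul, abs_div, abs_of_pos hD, div_mul_eq_mul_div, div_lt_iff₀ hD]
    calc _ ≤ |Real.sinh (s / 2)| * (D * y) := mul_le_mul_of_nonneg_left h1.le (abs_nonneg _)
      _ < Real.cosh (s / 2) * (D * y) := mul_lt_mul_of_pos_right h2 (by positivity)
      _ = _ := by ring
  have := (abs_lt.1 h3).1
  rw [twistTrace]; linarith

theorem abs_add_mul_sign {x y z c d : ℝ} (h : 0 < x * y * z)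
    (hp : 0 < c * |y| + d * (2 * |z| - |x| * |y|)) :
    |c * y + d * (SignType.sign x : ℝ) * (2 * z - x * y)| =
      c * |y| + d * (2 * |z| - |x| * |y|) := by
  rcases lt_trichotomy x 0 with hx | rfl | hx
  · have hyz : y * z < 0 := by nlinarith
    rcases mul_neg_iff.1 hyz with ⟨hy, hz⟩ | ⟨hy, hz⟩
    · rw [abs_of_neg hx, abs_of_pos hy, abs_of_neg hz] at *
      rw [sign_neg hx, ← abs_of_pos hp]
      congr 1
      simp; ring
    · rw [abs_of_neg hx, abs_of_neg hy, abs_of_pos hz] at *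
      rw [sign_neg hx, ← abs_of_pos hp, ← abs_neg]
      congr 1
      simp; ring
  · simp at h
  · have hyz : 0 < y * z := by
      rw [mul_assoc] at h
      exact (pos_iff_pos_of_mul_pos h).1 hx
    rcases pos_and_pos_or_neg_and_neg_of_mul_pos hyz with ⟨hy, hz⟩ | ⟨hy, hz⟩
    · rw [abs_of_pos hx, abs_of_pos hy, abs_of_pos hz] at *
      rw [sign_pos hx, ← abs_of_pos hp]
      congr 1
      simp
    · rw [abs_of_pos hx, abs_of_neg hy, abs_of_neg hz] at *
      rw [sign_pos hx, ← abs_of_pos hp, ← abs_neg]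
      congr 1
      simp; ring

theorem trace_mul_axisTranslation (A B : SL(2, ℝ)) (s : ℝ) :
    (B.val * axisTranslation A s).trace = Real.cosh (s / 2) * tr B +
      Real.sinh (s / 2) / Real.sqrt (tr A ^ 2 - 4) * (SignType.sign (tr A) : ℝ) *
        (2 * tr (A * B) - tr A * tr B) := by
  rw [axisTranslation, tr_mul_comm A B]
  simp only [tr, Matrix.SpecialLinearGroup.coe_mul, Matrix.mul_add, Matrix.trace_add,
    Matrix.mul_smul, Matrix.trace_smul, Matrix.mul_sub, Matrix.trace_sub, Matrix.mul_one,
    smul_eq_mul]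
  ring

theorem FuchsianRep.tr_prod_pos (ρ : FuchsianRep) {φ : MulAut Pi1} (hφ : φ ∈ MCG) :
    0 < tr (ρ.toHom (φ genA)) * tr (ρ.toHom (φ genB)) * tr (ρ.toHom (φ (genA * genB))) := by
  have h := tr_sq_rel (tr_comp_cusp ρ hφ)
  have hA := tr_comp_genA_ne_zero ρ φ
  change tr (ρ.toHom (φ genA)) ≠ 0 at hA
  change tr (ρ.toHom (φ genA)) ^ 2 + tr (ρ.toHom (φ genB)) ^ 2 +
    tr (ρ.toHom (φ (genA * genB))) ^ 2 = tr (ρ.toHom (φ genA)) * tr (ρ.toHom (φ genB)) *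
    tr (ρ.toHom (φ (genA * genB))) at h
  rw [← h]
  positivity

theorem abs_trace_mul_axisTranslation (ρ : FuchsianRep) {φ : MulAut Pi1} (hφ : φ ∈ MCG) (s : ℝ) :
    |((ρ.toHom (φ genB)).val * axisTranslation (ρ.toHom (φ genA)) s).trace| =
      twistTrace |tr (ρ.toHom (φ genA))| |tr (ρ.toHom (φ genB))|
        |tr (ρ.toHom (φ (genA * genB)))| s := by
  have hT := abs_tr_mem_triples (tr_comp_cusp ρ hφ) (tr_comp_genA_ne_zero ρ φ)
  have hp := twistTrace_pos hT s
  rw [twistTrace, sq_abs] at hp ⊢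
  rw [trace_mul_axisTranslation, ← map_mul, ← map_mul]
  exact abs_add_mul_sign (ρ.tr_prod_pos hφ) hp

/-- A twist is defined through a single dual curve `φ b`. All other dual classes arise from it by
powers of `autU`, and since the translation commutes with powers of the holonomy of `γ`, the same
multiplication rule holds for each of them. -/
theorem IsTwist.formula {X Y : Teich} {γ : SimpleCurve} {s : ℝ} (h : IsTwist X γ s Y) :
    Y.m γ.cls = X.m γ.cls ∧ ∀ v, cross γ.cls v = 1 →
      Y.m v = twistTrace (X.m γ.cls) (X.m v) (X.m (γ.cls + v)) s := by
  obtain ⟨φ, hφ, hγ, ρ, σ, rfl, rfl, hA, hB⟩ := h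
  have hcls : γ.cls = homCls (φ genA) := by rw [SimpleCurve.cls, hγ]
  rw [hcls]
  set u := homCls (φ genA) with hu
  have hmu : (Teich.mk σ).m u = (Teich.mk ρ).m u := by
    rw [Teich.m_homCls _ hφ, Teich.m_homCls _ hφ, Teich.trc_mk, Teich.trc_mk, hA]
  refine ⟨hmu, ?_⟩
  have main : ∀ ψ ∈ MCG, φ genA = ψ genA →
      (σ.toHom (ψ genB)).val = (ρ.toHom (ψ genB)).val * axisTranslation (ρ.toHom (φ genA)) s →
      (Teich.mk σ).m (homCls (ψ genB)) = twistTrace ((Teich.mk ρ).m u)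
        ((Teich.mk ρ).m (homCls (ψ genB))) ((Teich.mk ρ).m (u + homCls (ψ genB))) s := by
    intro ψ hψ h1 h2
    rw [hu, h1, Teich.m_genB _ hψ, Teich.m_genB _ hψ, Teich.m_homCls _ hψ, Teich.m_add _ hψ,
      Teich.trc_mk, Teich.trc_mk, Teich.trc_mk, Teich.trc_mk, ← abs_trace_mul_axisTranslation ρ hψ,
      ← h1, ← h2, tr]
  intro v hv
  have hfix : ∀ k : ℤ, (autU ^ k) genA = genA := by
    intro k
    have : autU ∈ MulAction.stabilizer (MulAut Pi1) genA := autU_genA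
    exact zpow_mem this k
  have hgenB : ∀ k : ℤ, (autU ^ k) genB = genB * genA ^ k := by
    intro k
    induction k with
    | zero => simp
    | succ n ih =>
      rw [add_comm, zpow_add, MulAut.mul_apply, ih, map_mul, map_zpow, zpow_one, autU_genB,
        autU_genA,
        zpow_add, zpow_one, mul_assoc]
    | pred n ih =>
      rw [sub_eq_neg_add, zpow_add, MulAut.mul_apply, ih, map_mul, map_zpow, zpow_neg_one,
        autU_inv_genB, autU_inv_genA, zpow_add, zpow_neg_one, mul_assoc]
  have hBT : ∀ k : ℤ, (σ.toHom ((φ * autU ^ k) genB)).val =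
      (ρ.toHom ((φ * autU ^ k) genB)).val * axisTranslation (ρ.toHom (φ genA)) s := by
    intro k
    have hc : Commute (axisTranslation (ρ.toHom (φ genA)) s) (ρ.toHom (φ genA)).val :=
      axisTranslation_comm _ _
    have hT1 : (axisTranslation (ρ.toHom (φ genA)) s) * (ρ.toHom (φ (genA ^ k))).val =
        (ρ.toHom (φ (genA ^ k))).val * (axisTranslation (ρ.toHom (φ genA)) s) := by
      let T : SL(2, ℝ) :=
        ⟨axisTranslation (ρ.toHom (φ genA)) s, det_axisTranslation (two_lt_abs_tr ρ hφ) s⟩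
      have hT : Commute T (ρ.toHom (φ genA)) := Subtype.ext (axisTranslation_comm _ s)
      have := hT.zpow_right k
      rw [← map_zpow, ← map_zpow] at this
      exact congrArg Subtype.val this
    rw [MulAut.mul_apply, hgenB, map_mul, map_mul, map_mul, Matrix.SpecialLinearGroup.coe_mul,
      Matrix.SpecialLinearGroup.coe_mul, hB, Matrix.mul_assoc, Matrix.mul_assoc, ← hT1, map_zpow,
      map_zpow, map_zpow, hA]
  -- The classes that cross `u` once positively form a single coset of `ℤ u`.
  obtain ⟨k, hk⟩ : ∃ k : ℤ, v = homCls ((φ * autU ^ k) genB) := by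
    have h1 := cross_homCls hφ
    have hz : ∀ k : ℤ, homCls ((φ * autU ^ k) genB) = homCls (φ genB) + k • u := by
      intro k
      rw [MulAut.mul_apply, hgenB, map_mul, homCls_mul, map_zpow]
      congr 1
      induction k with
      | zero => simp [homCls, expSum_one]
      | succ n ih => rw [zpow_add_one, homCls_mul, ih, add_smul, one_smul]
      | pred n ih => rw [zpow_sub_one, homCls_mul, ih, homCls_inv, sub_smul, one_smul]; rfl
    rw [← hu] at h1
    refine ⟨cross (homCls (φ genB)) v * (-1), ?_⟩
    rw [hz]
    set w := homCls (φ genB)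
    simp only [cross] at h1 hv ⊢
    ext
    · simp
      linear_combination w.1 * hv - v.1 * h1
    · simp
      linear_combination w.2 * hv - v.2 * h1
  rw [hk]
  exact main _ (MCG.mul_mem hφ (MCG.zpow_mem autU_mem k)) (by rw [MulAut.mul_apply, hfix]) (hBT k)

/-! ### Sums of exponentials with non-negative coefficients -/

/-- Finite sums of functions `c * exp (k * s)` with `0 ≤ c` and `|k| ≤ N`. -/
inductive PosExp (N : ℝ) : (ℝ → ℝ) → Prop
  | exp (c k : ℝ) (hc : 0 ≤ c) (hk : |k| ≤ N) : PosExp N fun s => c * Real.exp (k * s)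
  | add (f g : ℝ → ℝ) (hf : PosExp N f) (hg : PosExp N g) : PosExp N fun s => f s + g s

namespace PosExp

variable {N N' : ℝ} {f g : ℝ → ℝ}

theorem const {c : ℝ} (hc : 0 ≤ c) (hN : 0 ≤ N) : PosExp N fun _ => c := by
  have := PosExp.exp (N := N) c 0 hc (by simpa using hN)
  simpa using this

theorem mul (hf : PosExp N f) (hg : PosExp N' g) : PosExp (N + N') fun s => f s * g s := by
  induction hf with
  | exp c k hc hk =>
    induction hg with
    | exp c' k' hc' hk' =>
      have := PosExp.exp (N := N + N') (c * c') (k + k') (mul_nonneg hc hc')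
        ((abs_add_le _ _).trans (add_le_add hk hk'))
      convert this using 2 with s
      rw [add_mul, Real.exp_add]; ring
    | add f g _ _ hf hg => simpa only [mul_add] using PosExp.add _ _ hf hg
  | add f g _ _ hf hg => simpa only [add_mul] using PosExp.add _ _ hf hg

theorem nonneg (hf : PosExp N f) (s : ℝ) : 0 ≤ f s := by
  induction hf with
  | exp c k hc hk => positivity
  | add f g _ _ hf hg => positivity

theorem convexOn (hf : PosExp N f) : ConvexOn ℝ Set.univ f := by
  induction hf with
  | exp c k hc hk =>
    have h : ConvexOn ℝ Set.univ fun s : ℝ => Real.exp (k * s) :=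
      convexOn_exp.comp_linearMap (LinearMap.mul ℝ ℝ k)
    exact h.smul hc
  | add f g _ _ hf hg => exact hf.add hg

theorem le_exp_mul (hf : PosExp N f) (s h : ℝ) : f (s + h) ≤ Real.exp (N * |h|) * f s := by
  induction hf with
  | exp c k hc hk =>
    have h1 : k * h ≤ N * |h| := by
      calc k * h ≤ |k * h| := le_abs_self _
        _ = |k| * |h| := abs_mul _ _
        _ ≤ N * |h| := mul_le_mul_of_nonneg_right hk (abs_nonneg _)
    show c * Real.exp (k * (s + h)) ≤ Real.exp (N * |h|) * (c * Real.exp (k * s))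
    rw [mul_add, Real.exp_add]
    have := Real.exp_le_exp.2 h1
    calc c * (Real.exp (k * s) * Real.exp (k * h))
        = Real.exp (k * h) * (c * Real.exp (k * s)) := by ring
      _ ≤ _ := mul_le_mul_of_nonneg_right this (by positivity)
  | add f g _ _ hf hg => rw [mul_add]; exact add_le_add hf hg

/-- This bound on second differences depends only on `N` and passes to limits, where it gives
differentiability together with convexity. -/
theorem add_le_cosh_mul (hf : PosExp N f) (s h : ℝ) :
    f (s + h) + f (s - h) ≤ 2 * Real.cosh (N * h) * f s := by
  induction hf with
  | exp c k hc hk =>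
    have h1 : Real.cosh (k * h) ≤ Real.cosh (N * h) := by
      rw [Real.cosh_le_cosh, abs_mul, abs_mul]
      exact mul_le_mul_of_nonneg_right (hk.trans (le_abs_self _)) (abs_nonneg _)
    have e : c * Real.exp (k * (s + h)) + c * Real.exp (k * (s - h)) =
        2 * Real.cosh (k * h) * (c * Real.exp (k * s)) := by
      rw [Real.cosh_eq, mul_add, mul_sub, Real.exp_add, Real.exp_sub, Real.exp_neg]
      field_simp
    rw [e]
    exact mul_le_mul_of_nonneg_right (by linarith) (by positivity)
  | add f g _ _ hf hg => rw [mul_add]; linarith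

end PosExp

/-! ### The twist in diagonal coordinates -/

/-- Coordinates in which the holonomy of the twisting curve is diagonal. -/
structure TwistModel (x y z : ℝ) where
  mu : ℝ
  p : ℝ
  q : ℝ
  t : ℝ
  one_lt_mu : 1 < mu
  p_pos : 0 < p
  q_pos : 0 < q
  t_pos : 0 < t
  hx : x = mu + mu⁻¹
  hy : y = p + t
  hz : z = p * mu + t * mu⁻¹
  hdet : p * t = 1 + q ^ 2
  hq : q * (mu - mu⁻¹) = 2

/-- Diagonalize the first matrix, with eigenvalue `mu > 1`. The traces `y` and `z` determine the
diagonal `p`, `t` of the second, positive by the inequality behind `twistTrace_pos`; its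
off-diagonal entries are scaled to a common `q`, whose value is dictated by the commutator having
trace `-2`. -/
theorem exists_twistModel {x y z : ℝ} (h : (x, y, z) ∈ Triples) : Nonempty (TwistModel x y z) := by
  have hx2 := two_lt_of_mem_triples h
  obtain ⟨-, hy, hz, hr⟩ := h
  simp only at hy hz hr
  have hpos : 0 < x ^ 2 - 4 := by nlinarith
  have hD := Real.sqrt_pos.2 hpos
  have hsq := Real.sq_sqrt hpos.le
  set D := Real.sqrt (x ^ 2 - 4)
  have hinv : ((x + D) / 2)⁻¹ = (x - D) / 2 :=
    inv_eq_of_mul_eq_one_right (by linear_combination -hsq / 4)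
  have h1 : |2 * z - x * y| < D * y := by
    apply abs_lt_of_sq_lt_sq
    · rw [mul_pow, hsq]; nlinarith
    · positivity
  obtain ⟨h2, h3⟩ := abs_lt.1 h1
  refine ⟨⟨(x + D) / 2, (D * y + (2 * z - x * y)) / (2 * D), 2 / D,
    (D * y - (2 * z - x * y)) / (2 * D), ?_, ?_, by positivity, ?_, ?_, ?_, ?_, ?_, ?_⟩⟩
  · linarith
  · exact div_pos (by linarith) (by positivity)
  · exact div_pos (by linarith) (by positivity)
  · rw [hinv]; ring
  · field_simp; ring
  · rw [hinv]; field_simp; ring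
  · have : D * y + (2 * z - x * y) ≠ 0 := by linarith
    field_simp
    linear_combination (y ^ 2 - 4) * hsq + (-4) * hr
  · rw [hinv]; field_simp; ring

namespace TwistModel

variable {x y z : ℝ} (T : TwistModel x y z)

theorem inv_lt : T.mu⁻¹ < T.mu := by
  have h := T.one_lt_mu
  exact (inv_lt_one_of_one_lt₀ h).trans h

theorem mu_mul_inv : T.mu * T.mu⁻¹ = 1 :=
  mul_inv_cancel₀ (zero_lt_one.trans T.one_lt_mu).ne'

theorem sqrt_eq : Real.sqrt (x ^ 2 - 4) = T.mu - T.mu⁻¹ := by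
  rw [Real.sqrt_eq_iff_mul_self_eq_of_pos (sub_pos.2 T.inv_lt)]
  linear_combination (-(x + T.mu + T.mu⁻¹)) * T.hx - 4 * T.mu_mul_inv

/-- The first generator. -/
noncomputable def matA : SL(2, ℝ) := ⟨!![T.mu, 0; 0, T.mu⁻¹], by
  have hmu : T.mu ≠ 0 := by have := T.one_lt_mu; positivity
  rw [Matrix.det_fin_two_of]; field_simp; simp⟩

/-- The second generator, twisted by `s`. -/
noncomputable def matB (s : ℝ) : SL(2, ℝ) :=
  ⟨!![T.p * Real.exp (1 / 2 * s), T.q * Real.exp (-1 / 2 * s);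
      T.q * Real.exp (1 / 2 * s), T.t * Real.exp (-1 / 2 * s)], by
    rw [Matrix.det_fin_two_of]
    have h : Real.exp (1 / 2 * s) * Real.exp (-1 / 2 * s) = 1 := by
      rw [← Real.exp_add, Real.exp_eq_one_iff]; ring
    have := T.hdet
    linear_combination (T.p * T.t - T.q ^ 2) * h + this⟩

/-- The twisted representation. -/
noncomputable def hom (s : ℝ) : Pi1 →* SL(2, ℝ) := FreeGroup.lift ![T.matA, T.matB s]

theorem hom_genA (s : ℝ) : T.hom s genA = T.matA := by simp [hom, genA]

theorem hom_genB (s : ℝ) : T.hom s genB = T.matB s := by simp [hom, genB]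

theorem tr_matA : tr T.matA = x := by
  have h : tr T.matA = T.mu + T.mu⁻¹ := by rw [tr_def]; simp [matA]
  rw [h]; exact T.hx.symm

theorem exp_half_add (s : ℝ) : Real.exp (1 / 2 * s) = Real.cosh (s / 2) + Real.sinh (s / 2) := by
  rw [Real.cosh_add_sinh]; ring_nf

theorem exp_half_sub (s : ℝ) : Real.exp (-1 / 2 * s) = Real.cosh (s / 2) - Real.sinh (s / 2) := by
  rw [Real.cosh_sub_sinh]; ring_nf

theorem tr_matB_eq (s : ℝ) :
    tr (T.matB s) = T.p * Real.exp (1 / 2 * s) + T.t * Real.exp (-1 / 2 * s) := by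
  rw [tr_def]; rfl

theorem tr_mul_eq (s : ℝ) : tr (T.matA * T.matB s) =
    T.mu * (T.p * Real.exp (1 / 2 * s)) + T.mu⁻¹ * (T.t * Real.exp (-1 / 2 * s)) := by
  rw [tr_def, Matrix.SpecialLinearGroup.coe_mul, Matrix.mul_apply, Matrix.mul_apply,
    Fin.sum_univ_two, Fin.sum_univ_two]
  simp [matA, matB]

theorem tr_matB (s : ℝ) : tr (T.matB s) = twistTrace x y z s := by
  have h : T.mu - T.mu⁻¹ ≠ 0 := (sub_pos.2 T.inv_lt).ne'
  have e : 2 * z - x * y = (T.p - T.t) * (T.mu - T.mu⁻¹) := by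
    linear_combination 2 * T.hz - y * T.hx - (T.mu + T.mu⁻¹) * T.hy
  rw [tr_matB_eq, twistTrace, T.sqrt_eq, e, exp_half_add, exp_half_sub]
  have e2 : Real.sinh (s / 2) / (T.mu - T.mu⁻¹) * ((T.p - T.t) * (T.mu - T.mu⁻¹)) =
      Real.sinh (s / 2) * (T.p - T.t) := by
    rw [mul_comm (T.p - T.t), ← mul_assoc, div_mul_cancel₀ _ h]
  linear_combination -e2 - Real.cosh (s / 2) * T.hy

/-- The product is again dual to the first generator, so the twist formula applies; `x * z - y` is
the trace of `a² b` before the twist. -/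
theorem tr_matA_mul_matB (s : ℝ) : tr (T.matA * T.matB s) = twistTrace x z (x * z - y) s := by
  have h : T.mu - T.mu⁻¹ ≠ 0 := (sub_pos.2 T.inv_lt).ne'
  have e : 2 * (x * z - y) - x * z = (T.p * T.mu - T.t * T.mu⁻¹) * (T.mu - T.mu⁻¹) := by
    linear_combination z * T.hx + (T.mu + T.mu⁻¹) * T.hz - 2 * T.hy +
      2 * (T.p + T.t) * T.mu_mul_inv
  rw [tr_mul_eq, twistTrace, T.sqrt_eq, e, exp_half_add, exp_half_sub]
  have e2 : Real.sinh (s / 2) / (T.mu - T.mu⁻¹) *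
      ((T.p * T.mu - T.t * T.mu⁻¹) * (T.mu - T.mu⁻¹)) =
      Real.sinh (s / 2) * (T.p * T.mu - T.t * T.mu⁻¹) := by
    rw [mul_comm (T.p * T.mu - T.t * T.mu⁻¹), ← mul_assoc, div_mul_cancel₀ _ h]
  linear_combination -e2 - Real.cosh (s / 2) * T.hz

theorem exp_mul_exp (s : ℝ) : Real.exp (1 / 2 * s) * Real.exp (-1 / 2 * s) = 1 := by
  rw [← Real.exp_add, Real.exp_eq_one_iff]; ring

theorem tr_cusp (s : ℝ) : tr (T.hom s cusp) = -2 := by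
  rw [map_cusp, hom_genA, hom_genB, tr_commutator, tr_matA, tr_matB_eq, tr_mul_eq]
  have h := exp_mul_exp s
  generalize Real.exp (1 / 2 * s) = E at *
  generalize Real.exp (-1 / 2 * s) = F at *
  have e3 : x ^ 2 - 4 = (T.mu - T.mu⁻¹) ^ 2 := by
    linear_combination (x + T.mu + T.mu⁻¹) * T.hx + 4 * T.mu_mul_inv
  have e4 : T.p * T.t * (x ^ 2 - 4) = x ^ 2 := by
    have : T.q ^ 2 * (T.mu - T.mu⁻¹) ^ 2 = 4 := by rw [← mul_pow, T.hq]; norm_num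
    linear_combination this + (x ^ 2 - 4) * T.hdet + T.q ^ 2 * e3
  linear_combination -e4 - T.p * T.t * (x ^ 2 - 4) * h -
    (T.p * E + T.t * F) * (T.mu * (T.p * E) + T.mu⁻¹ * (T.t * F)) * T.hx +
    T.p * T.t * E * F * (x + T.mu + T.mu⁻¹) * T.hx +
    (2 * T.p * E * T.t * F - (T.p * E) ^ 2 - (T.t * F) ^ 2) * T.mu_mul_inv

/-- All entries of both generators are non-negative, and each letter `b` contributes exponents
`±1/2`. A diagonal entry of a product dominates the product of the diagonal entries, so the lower
bounds `P`, `Q` multiply, and so does `P * Q`. -/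
theorem positive_word {g : Pi1} (hg : g ∈ Submonoid.closure ({genA, genB} : Set Pi1)) :
    ∃ n : ℕ, expSum 1 g = n ∧ (∀ i j, PosExp (n / 2) fun s => (T.hom s g).val i j) ∧
      ∃ P Q : ℝ, 0 < P ∧ 0 < Q ∧ P * Q = (T.p * T.t) ^ n ∧
        ∀ s, P * Real.exp (n / 2 * s) ≤ (T.hom s g).val 0 0 ∧
          Q * Real.exp (-(n / 2) * s) ≤ (T.hom s g).val 1 1 := by
  have hmu : 0 < T.mu := zero_lt_one.trans T.one_lt_mu
  have hp := T.p_pos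
  have hq := T.q_pos
  have ht := T.t_pos
  induction hg using Submonoid.closure_induction with
  | mem x hx =>
    rcases hx with rfl | hx
    · refine ⟨0, by simp [expSum_genA], fun i j => ?_, T.mu, T.mu⁻¹, hmu, by positivity,
        by rw [pow_zero, T.mu_mul_inv], fun s => ?_⟩
      · simp only [hom_genA]
        refine PosExp.const ?_ (by simp)
        fin_cases i <;> fin_cases j <;> simp [matA] <;> positivity
      · rw [hom_genA]
        simp [matA]
    · rw [Set.mem_singleton_iff] at hx
      subst hx
      refine ⟨1, by simp [expSum_genB], fun i j => ?_, T.p, T.t, hp, ht, by rw [pow_one],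
        fun s => ?_⟩
      · simp only [hom_genB]
        fin_cases i <;> fin_cases j
        · exact PosExp.exp _ _ hp.le (by norm_num)
        · exact PosExp.exp _ _ hq.le (by norm_num)
        · exact PosExp.exp _ _ hq.le (by norm_num)
        · exact PosExp.exp _ _ ht.le (by norm_num)
      · rw [hom_genB]
        simp [matB, neg_div]
  | one =>
    refine ⟨0, by simp [expSum_one], fun i j => ?_, 1, 1, one_pos, one_pos, by simp, fun s => ?_⟩
    · simp only [map_one, Matrix.SpecialLinearGroup.coe_one]
      refine PosExp.const ?_ (by simp)
      fin_cases i <;> fin_cases j <;> simp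
    · simp
  | mul x y _ _ hx hy =>
    obtain ⟨n, hn, h1, P, Q, hP, hQ, hPQ, h2⟩ := hx
    obtain ⟨n', hn', h1', P', Q', hP', hQ', hPQ', h2'⟩ := hy
    refine ⟨n + n', by rw [expSum_mul, hn, hn']; push_cast; ring, fun i j => ?_, P * P', Q * Q',
      by positivity, by positivity, by rw [pow_add, ← hPQ, ← hPQ']; ring, fun s => ?_⟩
    · simp only [map_mul, Matrix.SpecialLinearGroup.coe_mul, Matrix.mul_apply, Fin.sum_univ_two]
      have e : (((n + n' : ℕ) : ℝ)) / 2 = n / 2 + n' / 2 := by push_cast; ring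
      rw [e]
      exact PosExp.add _ _ ((h1 i 0).mul (h1' 0 j)) ((h1 i 1).mul (h1' 1 j))
    · rw [map_mul, Matrix.SpecialLinearGroup.coe_mul, Matrix.mul_apply, Matrix.mul_apply,
        Fin.sum_univ_two, Fin.sum_univ_two]
      have a := mul_nonneg ((h1 0 1).nonneg s) ((h1' 1 0).nonneg s)
      have b := mul_nonneg ((h1 1 0).nonneg s) ((h1' 0 1).nonneg s)
      obtain ⟨c1, c2⟩ := h2 s
      obtain ⟨d1, d2⟩ := h2' s
      have e1 := mul_le_mul c1 d1 (by positivity) ((h1 0 0).nonneg s)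
      have e2 := mul_le_mul c2 d2 (by positivity) ((h1 1 1).nonneg s)
      have f1 : P * P' * Real.exp (((n + n' : ℕ) : ℝ) / 2 * s) =
          P * Real.exp (n / 2 * s) * (P' * Real.exp (n' / 2 * s)) := by
        push_cast
        rw [add_div, add_mul, Real.exp_add]; ring
      have f2 : Q * Q' * Real.exp (-(((n + n' : ℕ) : ℝ) / 2) * s) =
          Q * Real.exp (-(n / 2) * s) * (Q' * Real.exp (-(n' / 2) * s)) := by
        push_cast
        rw [add_div, neg_add, add_mul, Real.exp_add]; ring
      rw [f1, f2]
      constructor <;> linarith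

/-- The lower bound comes from pairing the growing diagonal entry at time `s` with the opposite one
at time `0`, where `P * Q ≥ 1`; the last claim is `(P + Q)² ≥ 4 P Q`. -/
theorem tr_positive_word {g : Pi1} (hg : g ∈ Submonoid.closure ({genA, genB} : Set Pi1)) {n : ℕ}
    (hn : expSum 1 g = n) :
    PosExp (n / 2) (fun s => tr (T.hom s g)) ∧
      (∀ s, Real.exp (n / 2 * |s|) ≤ tr (T.hom s g) * tr (T.hom 0 g)) ∧
      4 * (T.p * T.t) ^ n ≤ tr (T.hom 0 g) ^ 2 := by
  obtain ⟨n', hn', h1, P, Q, hP, hQ, hPQ, h2⟩ := T.positive_word hg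
  obtain rfl : n' = n := by rw [hn] at hn'; exact_mod_cast hn'.symm
  have hpt : 1 ≤ (T.p * T.t) ^ n' := one_le_pow₀ (by rw [T.hdet]; nlinarith [sq_nonneg T.q])
  have h0 := h2 0
  simp only [mul_zero, Real.exp_zero, mul_one] at h0
  refine ⟨?_, fun s => ?_, ?_⟩
  · simp only [tr_def]
    exact PosExp.add _ _ (h1 0 0) (h1 1 1)
  · rw [tr_def, tr_def]
    have hs := h2 s
    have e1 : P * Real.exp (n' / 2 * s) * Q ≤ (T.hom s g).val 0 0 * (T.hom 0 g).val 1 1 :=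
      mul_le_mul hs.1 h0.2 hQ.le ((h1 0 0).nonneg s)
    have e2 : Q * Real.exp (-(n' / 2) * s) * P ≤ (T.hom s g).val 1 1 * (T.hom 0 g).val 0 0 :=
      mul_le_mul hs.2 h0.1 hP.le ((h1 1 1).nonneg s)
    have a := mul_nonneg ((h1 0 0).nonneg s) ((h1 0 0).nonneg 0)
    have b := mul_nonneg ((h1 1 1).nonneg s) ((h1 1 1).nonneg 0)
    have c1 : Real.exp (n' / 2 * s) ≤ P * Real.exp (n' / 2 * s) * Q := by
      calc _ = 1 * Real.exp (n' / 2 * s) := (one_mul _).symm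
        _ ≤ (P * Q) * Real.exp (n' / 2 * s) :=
          mul_le_mul_of_nonneg_right (by rw [hPQ]; exact hpt) (Real.exp_pos _).le
        _ = _ := by ring
    have c2 : Real.exp (-(n' / 2) * s) ≤ Q * Real.exp (-(n' / 2) * s) * P := by
      calc _ = 1 * Real.exp (-(n' / 2) * s) := (one_mul _).symm
        _ ≤ (P * Q) * Real.exp (-(n' / 2) * s) :=
          mul_le_mul_of_nonneg_right (by rw [hPQ]; exact hpt) (Real.exp_pos _).le
        _ = _ := by ring
    have p1 := Real.exp_pos (n' / 2 * s)
    have p2 := Real.exp_pos (-(n' / 2) * s)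
    rcases abs_choice s with h | h
    · rw [h]; nlinarith
    · rw [h, mul_neg, ← neg_mul]; nlinarith
  · rw [← hPQ, tr_def]
    nlinarith [sq_nonneg (P - Q)]

end TwistModel

/-! ### Lengths along twists -/

theorem abs_tr_eq_of_triple {ρ σ : Pi1 →* SL(2, ℝ)} (hC : tr (ρ cusp) = -2) (hA : tr (ρ genA) ≠ 0)
    (hC' : tr (σ cusp) = -2) (h1 : |tr (ρ genA)| = |tr (σ genA)|)
    (h2 : |tr (ρ genB)| = |tr (σ genB)|)
    (h3 : |tr (ρ (genA * genB))| = |tr (σ (genA * genB))|) (g : Pi1) :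
    |tr (ρ g)| = |tr (σ g)| := by
  have hA' : tr (σ genA) ≠ 0 := by rw [← abs_ne_zero, ← h1, abs_ne_zero]; exact hA
  have e : absTriple hC hA = absTriple hC' hA' := by
    apply Subtype.ext
    simp only [absTriple, h1, h2, h3]
  rw [abs_tr_eq_nfHom hC hA, abs_tr_eq_nfHom hC' hA', e]

theorem cross_expand (u v w : ℤ × ℤ) (h : cross u v = 1) :
    w = cross w v • u + cross u w • v := by
  simp only [cross] at *
  ext
  · simp; linear_combination (-w.1) * h
  · simp; linear_combination (-w.2) * h

theorem Prim.isCoprime {u v w : ℤ × ℤ} (hw : Prim w) (h : cross u v = 1) :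
    IsCoprime (cross w v) (cross u w) := by
  obtain ⟨r, hr⟩ := hw
  refine ⟨cross u r, cross v r, ?_⟩
  have := congrArg (fun x => cross x r) (cross_expand u v w h)
  simp only [cross] at this hr ⊢
  simp at this
  linear_combination hr - this

/-- Subtracting a large multiple of `u` from the dual class makes both coordinates of `w`
non-negative, so that a positive word represents it. The sign of `w` matters only when `w = ±u`. -/
theorem exists_nonneg_coords {u w : ℤ × ℤ} (hu : Prim u) (hw : Prim w) (hpos : 0 ≤ cross u w) :
    ∃ v w' : ℤ × ℤ, ∃ k n : ℕ, cross u v = 1 ∧ (w' = w ∨ w' = -w) ∧ w' = (k : ℤ) • u + (n : ℤ) • v ∧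
      k.Coprime n ∧ (n : ℤ) = cross u w := by
  obtain ⟨v₀, hv₀⟩ := hu
  rcases hpos.eq_or_lt with h0 | h0
  · have h1 := hw.isCoprime hv₀
    rw [← h0, isCoprime_zero_right, Int.isUnit_iff] at h1
    have h2 := cross_expand u v₀ w hv₀
    rw [← h0] at h2
    refine ⟨v₀, u, 1, 0, hv₀, ?_, by simp, by simp, by simpa using h0⟩
    rcases h1 with h1 | h1 <;> rw [h1] at h2 <;> simp at h2 <;> simp [h2]
  -- This multiple is enough, because `cross u w ≥ 1`.
  · set j := |cross w v₀| with hj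
    have hv : cross u (v₀ - j • u) = 1 := by
      have := cross_self u
      simp only [cross] at this hv₀ ⊢
      simp
      linear_combination hv₀
    have hk : 0 ≤ cross w (v₀ - j • u) := by
      have e : cross w (v₀ - j • u) = cross w v₀ + j * cross u w := by
        simp [cross]; ring
      rw [e]
      nlinarith [neg_abs_le (cross w v₀), abs_nonneg (cross w v₀)]
    refine ⟨v₀ - j • u, w, (cross w (v₀ - j • u)).toNat, (cross u w).toNat, hv, Or.inl rfl, ?_, ?_,
      by simp [hpos]⟩
    · rw [Int.toNat_of_nonneg hk, Int.toNat_of_nonneg hpos]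
      exact cross_expand u _ w hv
    · rw [← Nat.isCoprime_iff_coprime, Int.toNat_of_nonneg hk, Int.toNat_of_nonneg hpos]
      exact hw.isCoprime hv

theorem IsTwist.refl (X : Teich) (γ : SimpleCurve) : IsTwist X γ 0 X := by
  obtain ⟨g, φ, hφ, rfl⟩ := γ
  obtain ⟨ρ, rfl⟩ := X.exists_rep
  exact ⟨φ, hφ, rfl, ρ, ρ, rfl, rfl, rfl, by simp [axisTranslation]⟩

/-- The trace of any simple closed curve along the twists about another one. -/
theorem exists_twist_profile (X : Teich) {u w : ℤ × ℤ} (hu : Prim u) (hw : Prim w) :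
    ∃ f : ℝ → ℝ, PosExp (|(cross u w : ℝ)| / 2) f ∧
      (∀ (γ : SimpleCurve) (s : ℝ) (Y : Teich), γ.cls = u → IsTwist X γ s Y → Y.m w = f s) ∧
      (∀ s, Real.exp (|(cross u w : ℝ)| / 2 * |s|) ≤ f s * X.m w) ∧
      4 * (1 + 4 / (X.m u ^ 2 - 4)) ^ (cross u w).natAbs ≤ X.m w ^ 2 := by
  wlog hpos : 0 ≤ cross u w generalizing w
  · obtain ⟨f, h1, h2, h3, h4⟩ := this hw.neg (by rw [cross_neg_right]; omega)
    rw [cross_neg_right] at h1 h3 h4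
    rw [X.m_neg] at h4
    push_cast at h1 h3
    rw [abs_neg] at h1
    refine ⟨f, h1, fun γ s Y hγ hY => by rw [← h2 γ s Y hγ hY, Y.m_neg], fun s => ?_, ?_⟩
    · have := h3 s
      rwa [abs_neg, X.m_neg] at this
    · rwa [Int.natAbs_neg] at h4
  obtain ⟨v, w', k, n, hv, hw', hkn, hcop, hn⟩ := exists_nonneg_coords hu hw hpos
  obtain ⟨φ, hφ, hφA, hφB⟩ := exists_basis_of_cross hv
  -- Up to sign `w` is the image under `φ` of a positive word with `n` letters `b`, where `n` is the
  -- number of crossings with `u`.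
  obtain ⟨θ, hθ, hword, hθ0, hθ1⟩ := exists_positive_word (k + n) k n le_rfl hcop
  obtain ⟨T⟩ := exists_twistModel (X.m_mem_triples hv)
  have hcls : homCls ((φ * θ) genA) = w' := by
    have e : ∀ i, expSum i (φ (θ genA)) = expSum i (φ genA) * k + expSum i (φ genB) * n := by
      intro i
      have := expSum_hom i φ.toMonoidHom (θ genA)
      rw [hθ0, hθ1] at this
      exact this
    rw [hkn, ← hφA, ← hφB, MulAut.mul_apply]
    ext <;> simp [homCls, e, mul_comm]
  have hmw : ∀ Y : Teich, Y.m w = Y.trc (φ (θ genA)) := by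
    intro Y
    have h1 : Y.m w' = Y.m w := by
      rcases hw' with h | h <;> rw [h]
      exact Y.m_neg w
    rw [← h1, ← hcls, Y.m_homCls (MCG.mul_mem hφ hθ), MulAut.mul_apply]
  obtain ⟨t1, t2, t3⟩ := T.tr_positive_word hword hθ1
  -- The twisted surface and the model agree in the absolute traces of `a`, `b`, `ab` (transported
  -- by `φ`), hence in all of them.
  have hfor : ∀ (γ : SimpleCurve) (s : ℝ) (Y : Teich), γ.cls = u → IsTwist X γ s Y →
      Y.m w = tr (T.hom s (θ genA)) := by
    intro γ s Y hγ hY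
    obtain ⟨f1, f2⟩ := hY.formula
    rw [hγ] at f1 f2
    have g1 := f2 v hv
    have huv : cross u (u + v) = 1 := by rw [cross_add_right, cross_self, hv, zero_add]
    have g2 := f2 (u + v) huv
    have g3 : X.m (u + (u + v)) = X.m u * X.m (u + v) - X.m v := by
      have := X.m_add_m_sub huv
      have e : u - (u + v) = -v := by abel
      rw [e, X.m_neg] at this
      linarith
    rw [g3] at g2
    rw [hmw]
    obtain ⟨σ, rfl⟩ := Y.exists_rep
    have pA := tr_comp_genA_ne_zero σ φ
    rw [← hφA, Teich.m_homCls _ hφ, Teich.m_homCls _ hφ] at f1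
    have hB := Teich.m_genB (Teich.mk σ) hφ
    have hAB := Teich.m_add (Teich.mk σ) hφ
    rw [hφB] at hB
    rw [hφA, hφB] at hAB
    have pos1 := twistTrace_pos (X.m_mem_triples hv) s
    have hA' : (Teich.mk σ).trc (φ genA) = |tr (T.hom s genA)| := by
      rw [T.hom_genA, T.tr_matA, f1, ← X.m_homCls hφ, hφA, abs_of_pos]
      linarith [X.two_lt_m hu]
    have hB' : (Teich.mk σ).trc (φ genB) = |tr (T.hom s genB)| := by
      rw [T.hom_genB, T.tr_matB, ← hB, g1, abs_of_pos pos1]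
    have hAB' : (Teich.mk σ).trc (φ (genA * genB)) = |tr (T.hom s (genA * genB))| := by
      rw [map_mul (T.hom s), T.hom_genA, T.hom_genB, T.tr_matA_mul_matB, ← hAB, g2, abs_of_pos]
      rw [← g2, hAB]
      have := abs_tr_mem_triples (tr_comp_cusp σ hφ) pA
      exact this.2.2.1
    have := abs_tr_eq_of_triple (tr_comp_cusp σ hφ) pA (T.tr_cusp s) hA' hB' hAB' (θ genA)
    change (Teich.mk σ).trc (φ (θ genA)) = _ at this
    rw [this, abs_of_nonneg (t1.nonneg s)]
  have hcast : |(cross u w : ℝ)| = n := by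
    rw [← hn]; simp
  obtain ⟨γ, hγ⟩ := hu.exists_curve
  have h0 := hfor γ 0 X hγ (IsTwist.refl X γ)
  -- By `hdet` and `hq` the product is `1 + q²` with `q = 2 / (mu - mu⁻¹)`.
  have hpt : T.p * T.t = 1 + 4 / (X.m u ^ 2 - 4) := by
    have hD := sub_pos.2 T.inv_lt
    have e3 : X.m u ^ 2 - 4 = (T.mu - T.mu⁻¹) ^ 2 := by
      linear_combination (X.m u + T.mu + T.mu⁻¹) * T.hx + 4 * T.mu_mul_inv
    have : T.q ^ 2 * (T.mu - T.mu⁻¹) ^ 2 = 4 := by rw [← mul_pow, T.hq]; norm_num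
    rw [T.hdet, e3, ← this, mul_div_cancel_right₀ _ (by positivity)]
  refine ⟨fun s => tr (T.hom s (θ genA)), by rw [hcast]; exact t1, hfor, ?_, ?_⟩
  · intro s
    rw [hcast, h0]
    exact t2 s
  · rw [← hpt, h0]
    have : (cross u w).natAbs = n := by omega
    rw [this]
    exact t3

/-! ### Edges whose cone contains a given irrational direction -/

/-- The pairing of a direction with a homology class. -/
def pair (lam : ℝ × ℝ) (u : ℤ × ℤ) : ℝ := lam.1 * u.2 - lam.2 * u.1

theorem pair_add (lam : ℝ × ℝ) (u v : ℤ × ℤ) : pair lam (u + v) = pair lam u + pair lam v := by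
  simp [pair]; ring

theorem pair_neg (lam : ℝ × ℝ) (u : ℤ × ℤ) : pair lam (-u) = -pair lam u := by
  simp [pair]; ring

theorem pair_smul (lam : ℝ × ℝ) (k : ℤ) (u : ℤ × ℤ) : pair lam (k • u) = k * pair lam u := by
  simp [pair]; ring

/-- A direction that is not a multiple of a homology class. -/
def Irr (lam : ℝ × ℝ) : Prop := ∀ u, Prim u → pair lam u ≠ 0

/-- The pair `u`, `v` is a positive basis and `lam` lies in the open cone that it spans. -/
structure InCone (lam : ℝ × ℝ) (u v : ℤ × ℤ) : Prop where
  cross_eq : cross u v = 1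
  left : pair lam u < 0
  right : 0 < pair lam v

variable {lam : ℝ × ℝ} {u v : ℤ × ℤ}

theorem cross_left_add (h : cross u v = 1) : cross u (u + v) = 1 := by
  rw [cross_add_right, cross_self, h, zero_add]

theorem cross_add_right_self (h : cross u v = 1) : cross (u + v) v = 1 := by
  rw [cross_add_left, cross_self, h, add_zero]

theorem cross_left_sub (h : cross u v = 1) : cross u (v - u) = 1 := by
  rw [cross_sub_right, cross_self, h, sub_zero]

theorem cross_rot (h : cross u v = 1) : cross v (-u) = 1 := by
  rw [cross_neg_right, cross_comm, neg_neg, h]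

theorem prim_left (h : cross u v = 1) : Prim u := ⟨v, h⟩

theorem prim_right (h : cross u v = 1) : Prim v := Prim.of_cross_right h

theorem prim_add (h : cross u v = 1) : Prim (u + v) := prim_left (cross_add_right_self h)

theorem prim_sub (h : cross u v = 1) : Prim (u - v) := by
  have := (prim_right (cross_left_sub h)).neg
  rwa [neg_sub] at this

theorem InCone.step (hirr : Irr lam) (h : InCone lam u v) :
    InCone lam u (u + v) ∨ InCone lam (u + v) v := by
  have h0 := hirr _ (prim_add h.cross_eq)
  rcases h0.lt_or_gt with h1 | h1
  · exact Or.inr ⟨cross_add_right_self h.cross_eq, h1, h.right⟩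
  · exact Or.inl ⟨cross_left_add h.cross_eq, h.left, h1⟩

/-- A property of edges that is inherited along the Farey path to `lam`. -/
def Inherited (lam : ℝ × ℝ) (R : ℤ × ℤ → ℤ × ℤ → Prop) : Prop :=
  ∀ u v, InCone lam u v → R u v → (InCone lam u (u + v) → R u (u + v)) ∧
    (InCone lam (u + v) v → R (u + v) v)

theorem Inherited.left_iterate {R : ℤ × ℤ → ℤ × ℤ → Prop} (hR : Inherited lam R)
    (h : InCone lam u v) (hr : R u v) (k : ℕ) (hk : 0 < pair lam (v + (k : ℤ) • u)) :
    InCone lam u (v + (k : ℤ) • u) ∧ R u (v + (k : ℤ) • u) := by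
  induction k with
  | zero => simpa using ⟨h, hr⟩
  | succ k ih =>
    have e : v + ((k + 1 : ℕ) : ℤ) • u = u + (v + (k : ℤ) • u) := by
      push_cast; rw [add_smul, one_smul]; abel
    rw [e] at hk ⊢
    have hk' : 0 < pair lam (v + (k : ℤ) • u) := by
      rw [pair_add] at hk; linarith [h.left]
    obtain ⟨i1, i2⟩ := ih hk'
    have i3 : InCone lam u (u + (v + (k : ℤ) • u)) := ⟨cross_left_add i1.cross_eq, h.left, hk⟩
    exact ⟨i3, (hR _ _ i1 i2).1 i3⟩

theorem Inherited.right_iterate {R : ℤ × ℤ → ℤ × ℤ → Prop} (hR : Inherited lam R)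
    (h : InCone lam u v) (hr : R u v) (k : ℕ) (hk : pair lam (u + (k : ℤ) • v) < 0) :
    InCone lam (u + (k : ℤ) • v) v ∧ R (u + (k : ℤ) • v) v := by
  induction k with
  | zero => simpa using ⟨h, hr⟩
  | succ k ih =>
    have e : u + ((k + 1 : ℕ) : ℤ) • v = (u + (k : ℤ) • v) + v := by
      push_cast; rw [add_smul, one_smul]; abel
    rw [e] at hk ⊢
    have hk' : pair lam (u + (k : ℤ) • v) < 0 := by
      rw [pair_add] at hk; linarith [h.right]
    obtain ⟨i1, i2⟩ := ih hk'
    have i3 : InCone lam (u + (k : ℤ) • v + v) v := ⟨cross_add_right_self i1.cross_eq, hk, h.right⟩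
    exact ⟨i3, (hR _ _ i1 i2).2 i3⟩

/-- Division with remainder `r < b` and quotient at least `1`: since `a + b ≥ r + 2b`, the sum `r +
b` is at most two thirds of `a + b`. -/
theorem exists_floor_step {a b : ℝ} (hb : 0 < b) (hab : b < a) :
    ∃ k : ℕ, k * b ≤ a ∧ a - k * b + b ≤ 2 / 3 * (a + b) := by
  refine ⟨⌊a / b⌋₊, ?_, ?_⟩
  · rw [← le_div_iff₀ hb]
    exact Nat.floor_le (div_nonneg (hb.le.trans hab.le) hb.le)
  · have h1 : a < (⌊a / b⌋₊ + 1) * b := by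
      rw [← div_lt_iff₀ hb]; exact Nat.lt_floor_add_one _
    have h2 : (1 : ℝ) ≤ ⌊a / b⌋₊ := by
      have : 1 ≤ ⌊a / b⌋₊ := by
        rw [Nat.one_le_floor_iff, le_div_iff₀ hb]; linarith
      exact_mod_cast this
    nlinarith

/-- A single Farey step can shrink the pairings arbitrarily little. Taking all consecutive steps on
one side at once, as for a digit of a continued fraction, gains a fixed factor. -/
theorem Inherited.exists_shrink {R : ℤ × ℤ → ℤ × ℤ → Prop} (hR : Inherited lam R) (hirr : Irr lam)
    (h : InCone lam u v) (hr : R u v) :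
    ∃ u' v', InCone lam u' v' ∧ R u' v' ∧
      pair lam v' - pair lam u' ≤ 2 / 3 * (pair lam v - pair lam u) := by
  have h0 := hirr _ (prim_add h.cross_eq)
  rw [pair_add] at h0
  have hl := h.left
  have hr' := h.right
  rcases h0.lt_or_gt with h1 | h1
  · obtain ⟨k, k1, k2⟩ := exists_floor_step (a := -pair lam u) (b := pair lam v) hr' (by linarith)
    have e : pair lam (u + (k : ℤ) • v) = pair lam u + k * pair lam v := by
      rw [pair_add, pair_smul]; simp
    have hc : cross (u + (k : ℤ) • v) v = 1 := by
      have := h.cross_eq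
      simp only [cross] at this ⊢
      simp; linear_combination this
    have hne := hirr _ (prim_left hc)
    have hneg : pair lam (u + (k : ℤ) • v) < 0 :=
      lt_of_le_of_ne (by rw [e]; linarith) hne
    obtain ⟨i1, i2⟩ := hR.right_iterate h hr k hneg
    exact ⟨_, _, i1, i2, by rw [e]; linarith⟩
  · obtain ⟨k, k1, k2⟩ := exists_floor_step (a := pair lam v) (b := -pair lam u) (by linarith)
      (by linarith)
    have e : pair lam (v + (k : ℤ) • u) = pair lam v + k * pair lam u := by
      rw [pair_add, pair_smul]; simp
    have hc : cross u (v + (k : ℤ) • u) = 1 := by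
      have := h.cross_eq
      simp only [cross] at this ⊢
      simp; linear_combination this
    have hne := hirr _ (prim_right hc)
    have hpos : 0 < pair lam (v + (k : ℤ) • u) :=
      lt_of_le_of_ne (by rw [e]; linarith) hne.symm
    obtain ⟨i1, i2⟩ := hR.left_iterate h hr k hpos
    exact ⟨_, _, i1, i2, by rw [e]; linarith⟩

theorem Inherited.exists_small {R : ℤ × ℤ → ℤ × ℤ → Prop} (hR : Inherited lam R) (hirr : Irr lam)
    (h : InCone lam u v) (hr : R u v) {ε : ℝ} (hε : 0 < ε) :
    ∃ u' v', InCone lam u' v' ∧ R u' v' ∧ pair lam v' - pair lam u' < ε := by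
  have key : ∀ n : ℕ, ∃ u' v', InCone lam u' v' ∧ R u' v' ∧
      pair lam v' - pair lam u' ≤ (2 / 3) ^ n * (pair lam v - pair lam u) := by
    intro n
    induction n with
    | zero => exact ⟨u, v, h, hr, by simp⟩
    | succ n ih =>
      obtain ⟨u1, v1, i1, i2, i3⟩ := ih
      obtain ⟨u2, v2, j1, j2, j3⟩ := hR.exists_shrink hirr i1 i2
      refine ⟨u2, v2, j1, j2, j3.trans ?_⟩
      rw [pow_succ]; linarith
  have hS : 0 < pair lam v - pair lam u := by linarith [h.left, h.right]
  obtain ⟨n, hn⟩ := exists_pow_lt_of_lt_one (div_pos hε hS) (by norm_num : (2 / 3 : ℝ) < 1)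
  obtain ⟨u', v', i1, i2, i3⟩ := key n
  refine ⟨u', v', i1, i2, i3.trans_lt ?_⟩
  rwa [← lt_div_iff₀ hS]

theorem exists_inCone (hirr : Irr lam) : ∃ u v, InCone lam u v := by
  have h1 : lam.1 ≠ 0 := by
    have := hirr (0, 1) ⟨(-1, 0), by simp [cross]⟩
    simpa [pair] using this
  have h2 : lam.2 ≠ 0 := by
    have := hirr (1, 0) ⟨(0, 1), by simp [cross]⟩
    simpa [pair] using this
  rcases h1.lt_or_gt with h1 | h1 <;> rcases h2.lt_or_gt with h2 | h2
  · exact ⟨(-1, 0), (0, -1), by simp [cross], by simpa [pair] using h2, by simpa [pair] using h1⟩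
  · exact ⟨(0, 1), (-1, 0), by simp [cross], by simpa [pair] using h1, by simpa [pair] using h2⟩
  · exact ⟨(0, -1), (1, 0), by simp [cross], by simpa [pair] using h1, by simpa [pair] using h2⟩
  · exact ⟨(1, 0), (0, 1), by simp [cross], by simpa [pair] using h2, by simpa [pair] using h1⟩

/-- Adding `δ` to a dual class lowers its pairing with `lam` by `|pair lam δ|` when `pair lam δ <
0`. The floor leaves a remainder `v` strictly between `0` and `|pair lam δ|`, and the next class `u
= v + δ` lies on the other side of `lam`. -/
theorem exists_inCone_sub (hirr : Irr lam) {δ : ℤ × ℤ} (hδ : Prim δ) :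
    ∃ u v, InCone lam u v ∧ (u - v = δ ∨ u - v = -δ) ∧ pair lam v - pair lam u = |pair lam δ| := by
  wlog hneg : pair lam δ < 0 generalizing δ
  · have h0 := hirr δ hδ
    have hpos : 0 < pair lam δ := lt_of_le_of_ne (not_lt.1 hneg) h0.symm
    obtain ⟨u, v, i1, i2, i3⟩ := this hδ.neg (by rw [pair_neg]; linarith)
    rw [pair_neg, abs_neg] at i3
    exact ⟨u, v, i1, by rw [neg_neg] at i2; exact i2.symm, i3⟩
  obtain ⟨w, hw⟩ := hδ
  obtain ⟨β, hβ⟩ : ∃ β, β = -pair lam δ := ⟨_, rfl⟩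
  have hβpos : 0 < β := by rw [hβ]; linarith
  set k := ⌊pair lam w / β⌋ with hk
  have k1 : k * β ≤ pair lam w := by
    rw [← le_div_iff₀ hβpos]; exact Int.floor_le _
  have k2 : pair lam w < (k + 1) * β := by
    rw [← div_lt_iff₀ hβpos]; exact Int.lt_floor_add_one _
  have e : pair lam (w + k • δ) = pair lam w - k * β := by
    rw [pair_add, pair_smul, hβ]; ring
  have hc : cross δ (w + k • δ) = 1 := by
    simp only [cross] at hw ⊢
    simp; linear_combination hw
  have hne := hirr _ (prim_right hc)
  have hpos : 0 < pair lam (w + k • δ) := lt_of_le_of_ne (by rw [e]; linarith) hne.symm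
  refine ⟨δ + (w + k • δ), w + k • δ, ⟨cross_add_right_self hc, ?_, hpos⟩, Or.inl (by abel), ?_⟩
  · rw [pair_add, e]; linarith
  · rw [pair_add lam δ, abs_of_neg hneg]; ring

/-! ### Markov functions and their derivatives -/

/-- The first-order data at one time: a function `m` that satisfies the trace relations and a
derivative `d` of it, bounded by the direction `lam`. -/
structure Tangent (lam : ℝ × ℝ) (m d : ℤ × ℤ → ℝ) : Prop where
  m_neg : ∀ u, m (-u) = m u
  d_neg : ∀ u, d (-u) = d u
  m_pos : ∀ u, Prim u → 2 < m u
  markov : ∀ u v, cross u v = 1 → m u ^ 2 + m v ^ 2 + m (u + v) ^ 2 = m u * m v * m (u + v)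
  quad : ∀ u v, cross u v = 1 → m (u + v) + m (u - v) = m u * m v
  d_markov : ∀ u v, cross u v = 1 → 2 * m u * d u + 2 * m v * d v + 2 * m (u + v) * d (u + v) =
    d u * m v * m (u + v) + m u * d v * m (u + v) + m u * m v * d (u + v)
  d_quad : ∀ u v, cross u v = 1 → d (u + v) + d (u - v) = d u * m v + m u * d v
  bound : ∀ u, Prim u → |d u| ≤ |pair lam u| / 2 * m u

namespace Tangent

variable {m d : ℤ × ℤ → ℝ}

theorem neg (T : Tangent lam m d) : Tangent lam m (fun u => -d u) where
  m_neg := T.m_neg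
  d_neg u := by rw [T.d_neg]
  m_pos := T.m_pos
  markov := T.markov
  quad := T.quad
  d_markov u v h := by linear_combination -T.d_markov u v h
  d_quad u v h := by linear_combination -T.d_quad u v h
  bound u h := by rw [abs_neg]; exact T.bound u h

/-- For the logarithmic derivatives `a`, `b`, `c` of `x`, `y`, `z` the differentiated Markov
equation reads `z (2z - xy) (c - a - b) = 2 a y² + 2 b x²`. -/
theorem superadditive (T : Tangent lam m d) (h : cross u v = 1)
    (hg : m u * m v < 2 * m (u + v)) (hu : 0 ≤ d u) (hv : 0 ≤ d v) :
    d u / m u + d v / m v ≤ d (u + v) / m (u + v) := by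
  have hx := T.m_pos _ (prim_left h)
  have hy := T.m_pos _ (prim_right h)
  have hz := T.m_pos _ (prim_add h)
  have h1 := T.markov u v h
  have h2 := T.d_markov u v h
  set x := m u
  set y := m v
  set z := m (u + v)
  have hx0 : 0 < x := by linarith
  have hy0 : 0 < y := by linarith
  have hz0 : 0 < z := by linarith
  have hD : 0 < z * (2 * z - x * y) := mul_pos hz0 (by linarith)
  obtain ⟨a, ha⟩ : ∃ a, a = d u / x := ⟨_, rfl⟩
  obtain ⟨b, hb⟩ : ∃ b, b = d v / y := ⟨_, rfl⟩
  obtain ⟨c, hc⟩ : ∃ c, c = d (u + v) / z := ⟨_, rfl⟩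
  have ha' : d u = a * x := by rw [ha]; field_simp
  have hb' : d v = b * y := by rw [hb]; field_simp
  have hc' : d (u + v) = c * z := by rw [hc]; field_simp
  have ha0 : 0 ≤ a := by rw [ha]; positivity
  have hb0 : 0 ≤ b := by rw [hb]; positivity
  rw [← ha, ← hb, ← hc]
  rw [ha', hb', hc'] at h2
  have key : (z * (2 * z - x * y)) * (c - a - b) = 2 * a * y ^ 2 + 2 * b * x ^ 2 := by
    linear_combination h2 - 2 * (a + b) * h1
  have : 0 ≤ (z * (2 * z - x * y)) * (c - a - b) := by rw [key]; positivity
  have := nonneg_of_mul_nonneg_right this hD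
  linarith

/-- The edge is long on the side of the sum. -/
def StrictGood (m : ℤ × ℤ → ℝ) (u v : ℤ × ℤ) : Prop := m u * m v < 2 * m (u + v)

/-- Once the trace of the sum is at least that of the difference, traces keep growing along all
further Farey steps. The identity `y (xz - 2y) = z (2z - xy) + 2x²` shows it for one step and makes
it strict. -/
theorem strictGood_left (T : Tangent lam m d) (h : cross u v = 1)
    (hg : m u * m v ≤ 2 * m (u + v)) : StrictGood m u (u + v) := by
  have h1 := T.markov u v h
  have h2 := T.quad u (u + v) (cross_left_add h)
  have e : u - (u + v) = -v := by abel
  rw [e, T.m_neg] at h2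
  have hx := T.m_pos _ (prim_left h)
  have hy := T.m_pos _ (prim_right h)
  have hz := T.m_pos _ (prim_add h)
  have h3 : 0 < m v * (m u * m (u + v) - 2 * m v) := by
    have : m v * (m u * m (u + v) - 2 * m v) =
      m (u + v) * (2 * m (u + v) - m u * m v) + 2 * m u ^ 2 := by linear_combination -2 * h1
    rw [this]
    have : 0 ≤ m (u + v) * (2 * m (u + v) - m u * m v) := mul_nonneg (by linarith) (by linarith)
    have : 0 < m u ^ 2 := by positivity
    linarith
  have := (pos_iff_pos_of_mul_pos h3).1 (by linarith)
  rw [StrictGood]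
  linarith

theorem strictGood_right (T : Tangent lam m d) (h : cross u v = 1)
    (hg : m u * m v ≤ 2 * m (u + v)) : StrictGood m (u + v) v := by
  have h1 := T.markov u v h
  have h2 := T.quad (u + v) v (cross_add_right_self h)
  have e : u + v - v = u := by abel
  rw [e] at h2
  have hx := T.m_pos _ (prim_left h)
  have hy := T.m_pos _ (prim_right h)
  have hz := T.m_pos _ (prim_add h)
  have h3 : 0 < m u * (m v * m (u + v) - 2 * m u) := by
    have : m u * (m v * m (u + v) - 2 * m u) =
      m (u + v) * (2 * m (u + v) - m u * m v) + 2 * m v ^ 2 := by linear_combination -2 * h1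
    rw [this]
    have : 0 ≤ m (u + v) * (2 * m (u + v) - m u * m v) := mul_nonneg (by linarith) (by linarith)
    have : 0 < m v ^ 2 := by positivity
    linarith
  have := (pos_iff_pos_of_mul_pos h3).1 (by linarith)
  rw [StrictGood]
  linarith

theorem inherited_strictGood (T : Tangent lam m d) : Inherited lam (StrictGood m) := by
  intro u v h hg
  exact ⟨fun _ => T.strictGood_left h.cross_eq (le_of_lt hg),
    fun _ => T.strictGood_right h.cross_eq (le_of_lt hg)⟩

/-- By superadditivity the sum of the two logarithmic derivatives does not decrease along the Farey
path to `lam`. It is at most half the sum of the pairings, which tends to `0`, so it vanishes from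
the start. -/
theorem eq_zero_of_nonneg (T : Tangent lam m d) (hirr : Irr lam) (h : InCone lam u v)
    (hg : StrictGood m u v) (hu : 0 ≤ d u) (hv : 0 ≤ d v) : d u = 0 ∧ d v = 0 := by
  have hx := T.m_pos _ (prim_left h.cross_eq)
  have hy := T.m_pos _ (prim_right h.cross_eq)
  have hinh : Inherited lam (fun u' v' => StrictGood m u' v' ∧ 0 ≤ d u' ∧ 0 ≤ d v' ∧
      d u / m u + d v / m v ≤ d u' / m u' + d v' / m v') := by
    rintro a b hab ⟨g1, g2, g3, g4⟩
    have hs := T.superadditive hab.cross_eq g1 g2 g3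
    have ma := T.m_pos _ (prim_left hab.cross_eq)
    have mb := T.m_pos _ (prim_right hab.cross_eq)
    have mc := T.m_pos _ (prim_add hab.cross_eq)
    have pa : 0 ≤ d a / m a := div_nonneg g2 (by linarith)
    have pb : 0 ≤ d b / m b := div_nonneg g3 (by linarith)
    have pc : 0 ≤ d (a + b) := by
      have : 0 ≤ d (a + b) / m (a + b) := by linarith
      have h2 := mul_nonneg this (by linarith : 0 ≤ m (a + b))
      rwa [div_mul_cancel₀ _ (by linarith)] at h2
    have hi := T.inherited_strictGood a b hab g1
    exact ⟨fun i => ⟨hi.1 i, g2, pc, by linarith⟩, fun i => ⟨hi.2 i, pc, g3, by linarith⟩⟩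
  have pu : 0 ≤ d u / m u := div_nonneg hu (by linarith)
  have pv : 0 ≤ d v / m v := div_nonneg hv (by linarith)
  have hle : d u / m u + d v / m v ≤ 0 := by
    refine le_of_forall_pos_lt_add fun ε hε => ?_
    obtain ⟨u', v', i, ⟨-, j2, j3, j4⟩, k⟩ := hinh.exists_small hirr h ⟨hg, hu, hv, le_rfl⟩ hε
    have b1 := T.bound _ (prim_left i.cross_eq)
    have b2 := T.bound _ (prim_right i.cross_eq)
    have mu := T.m_pos _ (prim_left i.cross_eq)
    have mv := T.m_pos _ (prim_right i.cross_eq)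
    rw [abs_of_nonneg j2, abs_of_neg i.left, ← div_le_iff₀ (by linarith)] at b1
    rw [abs_of_nonneg j3, abs_of_pos i.right, ← div_le_iff₀ (by linarith)] at b2
    linarith [i.left, i.right]
  have e1 : d u / m u = 0 := by linarith
  have e2 : d v / m v = 0 := by linarith
  rw [div_eq_zero_iff] at e1 e2
  constructor
  · rcases e1 with h | h
    · exact h
    · linarith
  · rcases e2 with h | h
    · exact h
    · linarith

/-- If the derivative vanishes on a triangle, then it vanishes on all curves. -/
theorem eq_zero_of_triangle (T : Tangent lam m d) (h : cross u v = 1) (hu : d u = 0) (hv : d v = 0)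
    (huv : d (u + v) = 0) {w : ℤ × ℤ} (hw : Prim w) : d w = 0 := by
  let Z : ℤ × ℤ → ℤ × ℤ → Prop := fun a b => d a = 0 ∧ d b = 0 ∧ d (a + b) = 0
  -- Euclid's algorithm on the coordinates: the differentiated trace relation carries the vanishing
  -- from a triangle to its neighbours.
  have key : ∀ n : ℕ, ∀ a b : ℤ × ℤ, ∀ p q : ℕ, cross a b = 1 → Z a b → p + q ≤ n →
      IsCoprime (p : ℤ) q → d ((p : ℤ) • a + (q : ℤ) • b) = 0 := by
    intro n
    induction n with
    | zero =>
      intro a b p q hab hz hn hc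
      obtain ⟨rfl, rfl⟩ : p = 0 ∧ q = 0 := by omega
      rw [Nat.isCoprime_iff_coprime] at hc
      simp at hc
    | succ n ih =>
      intro a b p q hab hz hn hc
      obtain ⟨z1, z2, z3⟩ := hz
      rcases Nat.eq_zero_or_pos q with rfl | hq
      · have hp : p = 1 := by
          rw [Nat.isCoprime_iff_coprime] at hc; simpa using hc
        simp [hp, z1]
      rcases Nat.eq_zero_or_pos p with rfl | hp
      · have hp : q = 1 := by
          rw [Nat.isCoprime_iff_coprime] at hc; simpa using hc
        simp [hp, z2]
      rcases le_total q p with hqp | hpq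
      · have hz' : Z a (a + b) := by
          refine ⟨z1, z3, ?_⟩
          have := T.d_quad a (a + b) (cross_left_add hab)
          have e : a - (a + b) = -b := by abel
          rw [e, T.d_neg, z1, z2, z3] at this
          linarith
        have := ih a (a + b) (p - q) q (cross_left_add hab) hz' (by omega) (by
          rw [Nat.isCoprime_iff_coprime] at hc ⊢
          rwa [Nat.coprime_sub_self_left hqp])
        rw [← this]
        congr 1
        push_cast [hqp]
        module
      · have hz' : Z (a + b) b := by
          refine ⟨z3, z2, ?_⟩
          have := T.d_quad (a + b) b (cross_add_right_self hab)
          have e : a + b - b = a := by abel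
          rw [e, z1, z2, z3] at this
          linarith
        have := ih (a + b) b p (q - p) (cross_add_right_self hab) hz' (by omega) (by
          rw [Nat.isCoprime_iff_coprime] at hc ⊢
          rwa [Nat.coprime_sub_self_right hpq])
        rw [← this]
        congr 1
        push_cast [hpq]
        module
  have hsub : d (v + -u) = 0 := by
    have := T.d_quad u v h
    rw [hu, hv, huv] at this
    rw [← T.d_neg]
    have e : -(v + -u) = u - v := by abel
    rw [e]
    linarith
  have hexp := cross_expand u v w h
  have hcop := hw.isCoprime h
  have hneg : d w = d (-w) := (T.d_neg w).symm
  obtain ⟨p, hp⟩ := Int.eq_nat_or_neg (cross w v)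
  obtain ⟨q, hq⟩ := Int.eq_nat_or_neg (cross u w)
  have same := key (p + q) u v p q h ⟨hu, hv, huv⟩ le_rfl
  -- Coordinates of opposite sign become non-negative in the basis `v`, `-u`.
  have opp := key (q + p) v (-u) q p (cross_rot h) ⟨hv, by rw [T.d_neg, hu], hsub⟩ le_rfl
  rcases hp with hp | hp <;> rcases hq with hq | hq <;> rw [hp, hq] at hexp hcop
  · rw [hexp]; exact same hcop
  · rw [hneg, hexp]
    rw [← opp (isCoprime_comm.1 ((IsCoprime.neg_right_iff _ _).1 hcop))]
    congr 1; module
  · rw [hexp]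
    rw [← opp (isCoprime_comm.1 ((IsCoprime.neg_left_iff _ _).1 hcop))]
    congr 1; module
  · rw [hneg, hexp]
    rw [← same ((IsCoprime.neg_neg_iff _ _).1 hcop)]
    congr 1; module

/-- Unless the derivative vanishes identically, it has opposite signs at the ends of a good edge. -/
theorem opposite_signs (T : Tangent lam m d) (hirr : Irr lam) (h : InCone lam u v)
    (hg : StrictGood m u v) {w : ℤ × ℤ} (hw : Prim w) (hdw : d w ≠ 0) :
    (d u < 0 ∧ 0 < d v) ∨ (0 < d u ∧ d v < 0) := by
  -- On a good edge the differentiated Markov equation determines the third derivative, so two zeros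
  -- would give a triangle of zeros. Reversing time, in `n2`, handles two non-positive derivatives.
  have main : ¬ (d u = 0 ∧ d v = 0) := by
    rintro ⟨e1, e2⟩
    have h1 := T.d_markov u v h.cross_eq
    rw [e1, e2] at h1
    have h2 : d (u + v) * (2 * m (u + v) - m u * m v) = 0 := by linear_combination h1
    have h3 : 2 * m (u + v) - m u * m v ≠ 0 := by
      have : m u * m v < 2 * m (u + v) := hg
      linarith
    exact hdw (T.eq_zero_of_triangle h.cross_eq e1 e2 ((mul_eq_zero.1 h2).resolve_right h3) hw)
  have n1 : ¬ (0 ≤ d u ∧ 0 ≤ d v) := fun h' => main (T.eq_zero_of_nonneg hirr h hg h'.1 h'.2)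
  have n2 : ¬ (d u ≤ 0 ∧ d v ≤ 0) := fun h' => by
    have := T.neg.eq_zero_of_nonneg hirr h hg (by linarith [h'.1]) (by linarith [h'.2])
    exact main ⟨by linarith [this.1], by linarith [this.2]⟩
  rcases lt_or_ge (d u) 0 with h1 | h1
  · left
    refine ⟨h1, ?_⟩
    by_contra hc
    exact n2 ⟨h1.le, not_lt.1 hc⟩
  · right
    have hv : d v < 0 := by
      by_contra hc
      exact n1 ⟨h1, not_lt.1 hc⟩
    refine ⟨?_, hv⟩
    by_contra hc
    exact n2 ⟨not_lt.1 hc, hv.le⟩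

/-- If the next edge is not good, then the product of its traces is less than `2 / κ` times that of
the present one, by the trace relation. As every product is at least `κ²`, a good edge must come up.
-/
theorem exists_good (T : Tangent lam m d) (hirr : Irr lam) {κ : ℝ} (hκ : 2 < κ)
    (hm : ∀ u, Prim u → κ ≤ m u) (n : ℕ) : ∀ u v, InCone lam u v →
    m u * m v < κ ^ 2 * (κ / 2) ^ n →
      ∃ u' v', InCone lam u' v' ∧ m u' * m v' ≤ 2 * m (u' + v') := by
  induction n with
  | zero =>
    intro u v h hlt
    have h1 := hm _ (prim_left h.cross_eq)
    have h2 := hm _ (prim_right h.cross_eq)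
    exfalso
    rw [pow_zero, mul_one] at hlt
    nlinarith
  | succ n ih =>
    intro u v h hlt
    have hx := hm _ (prim_left h.cross_eq)
    have hy := hm _ (prim_right h.cross_eq)
    have hstep : ∀ x y p : ℝ, κ ≤ x → p < 2 * y → x * y < κ ^ 2 * (κ / 2) ^ (n + 1) →
        0 < y → p < κ ^ 2 * (κ / 2) ^ n := by
      intro x y p hx hp hxy hy0
      have : κ * y ≤ x * y := mul_le_mul_of_nonneg_right hx hy0.le
      have e : κ ^ 2 * (κ / 2) ^ (n + 1) = κ / 2 * (κ ^ 2 * (κ / 2) ^ n) := by ring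
      rw [e] at hxy
      have h3 : κ / 2 * p < κ / 2 * (κ ^ 2 * (κ / 2) ^ n) := by nlinarith
      exact lt_of_mul_lt_mul_left h3 (by linarith)
    rcases h.step hirr with hs | hs
    · by_cases hg : m u * m (u + v) ≤ 2 * m (u + (u + v))
      · exact ⟨_, _, hs, hg⟩
      · push Not at hg
        have h2 := T.quad u (u + v) (cross_left_add h.cross_eq)
        have e : u - (u + v) = -v := by abel
        rw [e, T.m_neg] at h2
        exact ih _ _ hs (hstep (m u) (m v) _ hx (by linarith) hlt (by linarith))
    · by_cases hg : m (u + v) * m v ≤ 2 * m (u + v + v)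
      · exact ⟨_, _, hs, hg⟩
      · push Not at hg
        have h2 := T.quad (u + v) v (cross_add_right_self h.cross_eq)
        have e : u + v - v = u := by abel
        rw [e] at h2
        exact ih _ _ hs (hstep (m v) (m u) _ hy (by linarith) (by linarith) (by linarith))

theorem exists_small_strictGood (T : Tangent lam m d) (hirr : Irr lam) {κ : ℝ} (hκ : 2 < κ)
    (hm : ∀ u, Prim u → κ ≤ m u) {ε : ℝ} (hε : 0 < ε) :
    ∃ u v, InCone lam u v ∧ StrictGood m u v ∧ pair lam v - pair lam u < ε := by
  obtain ⟨u, v, h⟩ := exists_inCone hirr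
  obtain ⟨n, hn⟩ := pow_unbounded_of_one_lt (m u * m v / κ ^ 2) (by linarith : 1 < κ / 2)
  rw [div_lt_iff₀ (by positivity), mul_comm ((κ / 2) ^ n)] at hn
  obtain ⟨u', v', i1, i2⟩ := T.exists_good hirr hκ hm n u v h hn
  rcases i1.step hirr with hs | hs
  · exact T.inherited_strictGood.exists_small hirr hs (T.strictGood_left i1.cross_eq i2) hε
  · exact T.inherited_strictGood.exists_small hirr hs (T.strictGood_right i1.cross_eq i2) hε

end Tangent

/-! ### The lengths of curves along an irrational earthquake -/

/-- The largest variable is the smaller root of its quadratic equation, so `y` is not between the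
roots: `(x - 2) y² ≤ x²`. Hence `x ≤ 3`, then `(κ - 2) y² ≤ 9`, and `z ≤ 3y / 2`. -/
theorem sq_le_of_reduced_sorted {κ x y z : ℝ} (hκ : 2 < κ) (hx : κ ≤ x) (hxy : x ≤ y) (hyz : y ≤ z)
    (hz : 2 * z ≤ x * y) (h : x ^ 2 + y ^ 2 + z ^ 2 = x * y * z) :
    z ^ 2 ≤ 81 / (4 * (κ - 2)) := by
  have h1 : 0 ≤ (z - y) * (x * y - y - z) := mul_nonneg (by linarith) (by linarith)
  have h2 : (x - 2) * y ^ 2 ≤ x ^ 2 := by linarith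
  have h3 : x ≤ 3 := by
    by_contra hc
    push Not at hc
    have : 0 < (x - 3) * y ^ 2 := mul_pos (by linarith) (by nlinarith)
    nlinarith
  have h4 : (κ - 2) * y ^ 2 ≤ 9 := by
    have : 0 ≤ (x - κ) * y ^ 2 := mul_nonneg (by linarith) (sq_nonneg y)
    nlinarith
  have h5 : 2 * z ≤ 3 * y := by nlinarith
  have h6 : 4 * z ^ 2 ≤ 9 * y ^ 2 := by nlinarith
  rw [le_div_iff₀ (by linarith)]
  have h7 : (κ - 2) * (4 * z ^ 2) ≤ (κ - 2) * (9 * y ^ 2) :=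
    mul_le_mul_of_nonneg_left h6 (by linarith)
  linarith

theorem sq_le_of_reduced {κ x y z : ℝ} (hκ : 2 < κ) (hx : κ ≤ x) (hy : κ ≤ y) (hz : κ ≤ z)
    (rx : 2 * x ≤ y * z) (ry : 2 * y ≤ x * z) (rz : 2 * z ≤ x * y)
    (h : x ^ 2 + y ^ 2 + z ^ 2 = x * y * z) :
    x ^ 2 ≤ 81 / (4 * (κ - 2)) ∧ y ^ 2 ≤ 81 / (4 * (κ - 2)) := by
  have x0 : 0 < x := by linarith
  have y0 : 0 < y := by linarith
  have z0 : 0 < z := by linarith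
  have mono : ∀ {a b : ℝ}, 0 < a → a ≤ b → b ^ 2 ≤ 81 / (4 * (κ - 2)) →
      a ^ 2 ≤ 81 / (4 * (κ - 2)) := fun ha hab hb => (pow_le_pow_left₀ ha.le hab 2).trans hb
  rcases le_total x y with h1 | h1 <;> rcases le_total y z with h2 | h2 <;>
    rcases le_total x z with h3 | h3
  · have := sq_le_of_reduced_sorted hκ hx h1 h2 rz h
    exact ⟨mono x0 h3 this, mono y0 h2 this⟩
  · have := sq_le_of_reduced_sorted hκ hx h1 h2 rz h
    exact ⟨mono x0 (h1.trans h2) this, mono y0 h2 this⟩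
  · have := sq_le_of_reduced_sorted hκ hx h3 h2 (by linarith) (by linarith)
    exact ⟨mono x0 h1 this, this⟩
  · have := sq_le_of_reduced_sorted hκ hz h3 h1 (by linarith) (by linarith)
    exact ⟨mono x0 h1 this, this⟩
  · have := sq_le_of_reduced_sorted hκ hy h1 h3 (by linarith) (by linarith)
    exact ⟨mono x0 h3 this, mono y0 h2 this⟩
  · have := sq_le_of_reduced_sorted hκ hy h2 h3 (by linarith) (by linarith)
    exact ⟨this, mono y0 h1 this⟩
  · have := sq_le_of_reduced_sorted hκ hz h2 h1 (by linarith) (by linarith)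
    exact ⟨this, mono y0 h1 this⟩
  · have := sq_le_of_reduced_sorted hκ hz h2 h1 (by linarith) (by linarith)
    exact ⟨this, mono y0 h1 this⟩

/-- The properties of the traces along an earthquake. -/
structure Flow (lam : ℝ × ℝ) (f : ℤ × ℤ → ℝ → ℝ) : Prop where
  convex : ∀ u, Prim u → ConvexOn ℝ Set.univ (f u)
  diff : ∀ u, Prim u → Differentiable ℝ (f u)
  tangent : ∀ t, Tangent lam (fun u => f u t) (fun u => deriv (f u) t)
  growth : ∀ u, Prim u → Tendsto (f u) atTop atTop
  lower : ∃ L > 0, ∀ t u v, cross u v = 1 →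
    L ≤ |pair lam v| * Real.log (f u t) + |pair lam u| * Real.log (f v t)

namespace Flow

variable {lam : ℝ × ℝ} {f : ℤ × ℤ → ℝ → ℝ}

theorem monotone_deriv (F : Flow lam f) {u : ℤ × ℤ} (hu : Prim u) : Monotone (deriv (f u)) := by
  have := (F.convex u hu).monotoneOn_deriv (fun x _ => F.diff u hu x)
  exact monotoneOn_univ.1 this

theorem exists_deriv_pos (F : Flow lam f) {u : ℤ × ℤ} (hu : Prim u) (t : ℝ) :
    ∃ t' > t, 0 < deriv (f u) t' := by
  obtain ⟨s, hs1, hs2⟩ := (((F.growth u hu).eventually_gt_atTop (f u t)).and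
    (eventually_gt_atTop t)).exists
  obtain ⟨c, hc, hc'⟩ := exists_deriv_eq_slope (f u) hs2 (F.diff u hu).continuous.continuousOn
    (F.diff u hu).differentiableOn
  refine ⟨c, hc.1, ?_⟩
  rw [hc']
  exact div_pos (by linarith) (by linarith)

/-- The trace tends to infinity, so its derivative is positive somewhere later and has a zero in
between by Darboux's theorem. By convexity the trace does not increase before that zero. -/
theorem exists_critical (F : Flow lam f) {u : ℤ × ℤ} (hu : Prim u) {t : ℝ}
    (ht : deriv (f u) t < 0) : ∃ t' > t, deriv (f u) t' = 0 ∧ f u t' ≤ f u t := by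
  obtain ⟨s, hs, hs'⟩ := F.exists_deriv_pos hu t
  obtain ⟨c, hc, hc'⟩ := exists_hasDerivWithinAt_eq_of_gt_of_lt hs.le
    (fun x _ => (F.diff u hu x).hasDerivAt.hasDerivWithinAt) ht hs'
  refine ⟨c, hc.1, hc', ?_⟩
  have hanti : AntitoneOn (f u) (Set.Icc t c) := by
    refine antitoneOn_of_deriv_nonpos (convex_Icc t c) (F.diff u hu).continuous.continuousOn
      (F.diff u hu).differentiableOn fun x hx => ?_
    rw [interior_Icc] at hx
    rw [← hc']
    exact F.monotone_deriv hu hx.2.le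
  exact hanti ⟨le_rfl, hc.1.le⟩ ⟨hc.1.le, le_rfl⟩ hc.1.le

/-- Along an irrational earthquake short curves appear at arbitrarily large times. -/
theorem exists_short (F : Flow lam f) (hirr : Irr lam) {κ : ℝ} (hκ : 2 < κ) (T : ℝ) :
    ∃ t ≥ T, ∃ u, Prim u ∧ f u t < κ := by
  by_contra hcon
  push Not at hcon
  have hprim : Prim (1, 0) := ⟨(0, 1), by simp [cross]⟩
  obtain ⟨T0, hT0, hpos0⟩ := F.exists_deriv_pos hprim T
  -- By convexity one derivative stays positive from `T0` on, so the derivative never vanishes on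
  -- all curves at once.
  have hpos : ∀ t ≥ T0, deriv (f (1, 0)) t ≠ 0 := fun t ht =>
    (hpos0.trans_le (F.monotone_deriv hprim ht)).ne'
  obtain ⟨L, hL, hlow⟩ := F.lower
  -- `B / 2` bounds the logarithms of the traces of a reduced triple, and `ε` is small enough for
  -- `|pair lam δ| * B / 2` to stay below `L`. The summand `1` keeps the denominator positive.
  set B := |Real.log (81 / (4 * (κ - 2)))| with hB
  have hB0 : 0 ≤ B := abs_nonneg _
  set ε := L / (B / 2 + 1) with hε
  have hε0 : 0 < ε := by positivity
  have hεL : ε * (B / 2 + 1) = L := div_mul_cancel₀ _ (by positivity)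
  have hlog : ∀ x : ℝ, 2 < x → x ^ 2 ≤ 81 / (4 * (κ - 2)) → Real.log x ≤ B / 2 := by
    intro x hx h
    have h1 := Real.log_le_log (by positivity) h
    rw [Real.log_pow] at h1
    have := le_abs_self (Real.log (81 / (4 * (κ - 2))))
    push_cast at h1
    linarith
  -- No curve with small pairing can be getting shorter. Each round of the induction gains a factor
  -- `κ / 2`, until the trace would be below `κ`.
  have key : ∀ n : ℕ, ∀ δ t, Prim δ → T0 ≤ t → |pair lam δ| < ε → deriv (f δ) t < 0 →
      f δ t < κ * (κ / 2) ^ n → False := by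
    intro n
    induction n with
    | zero =>
      intro δ t hδ ht _ _ hlt
      rw [pow_zero, mul_one] at hlt
      exact absurd (hcon t (by linarith) δ hδ) (not_le.2 hlt)
    | succ n ih =>
      intro δ t hδ ht hsmall hneg hlt
      obtain ⟨s, hs, hs0, hsle⟩ := F.exists_critical hδ hneg
      obtain ⟨P, Q, hPQ, hsub, hlen⟩ := exists_inCone_sub hirr hδ
      have hsT : T ≤ s := by linarith
      have hsT0 : T0 ≤ s := by linarith
      have TT := F.tangent s
      have hc1 : cross (P - Q) Q = 1 := by
        rw [cross_sub_left, hPQ.cross_eq, cross_self, sub_zero]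
      have hz : f (P - Q) s = f δ s := by
        rcases hsub with h | h <;> rw [h]
        exact TT.m_neg δ
      have hdz : deriv (f (P - Q)) s = 0 := by
        rw [← hs0]
        rcases hsub with h | h <;> rw [h]
        exact TT.d_neg δ
      have hmk := TT.markov (P - Q) Q hc1
      have hdm := TT.d_markov (P - Q) Q hc1
      have hqd := TT.quad P Q hPQ.cross_eq
      rw [sub_add_cancel] at hmk hdm
      simp only [hdz] at hmk hdm hqd
      have hx := hcon s hsT P (prim_left hPQ.cross_eq)
      have hy := hcon s hsT Q (prim_right hPQ.cross_eq)
      have hzκ := hcon s hsT δ hδ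
      rw [hz] at hmk hdm hqd
      have hP := hPQ.left
      have hQ := hPQ.right
      have hlt' : f δ s < κ * (κ / 2) ^ (n + 1) := hsle.trans_lt hlt
      have hdesc : ∀ a b : ℝ, κ ≤ b → 0 < a → a * b ≤ 2 * f δ s → a < κ * (κ / 2) ^ n := by
        intro a b hb ha hab
        have h1 : a * κ ≤ a * b := mul_le_mul_of_nonneg_left hb ha.le
        have e : κ * (κ / 2) ^ (n + 1) = κ / 2 * (κ * (κ / 2) ^ n) := by ring
        rw [e] at hlt'
        have h3 : κ / 2 * a < κ / 2 * (κ * (κ / 2) ^ n) := by linarith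
        exact lt_of_mul_lt_mul_left h3 (by linarith)
      -- At the critical time `δ` is the difference of `P` and `Q`, up to sign. In the first case it
      -- is the long side of the triangle: both coefficients of the differentiated equation are
      -- positive, so one of `P`, `Q` shortens, and both traces are at most `2 / κ` times that of
      -- `δ`.
      rcases le_or_gt (f P s * f Q s) (2 * f δ s) with hcase | hcase
      · have g1 : 0 < f Q s * f δ s - 2 * f P s := by
          have : 0 < f P s * (f Q s * f δ s - 2 * f P s) := by
            have e : f P s * (f Q s * f δ s - 2 * f P s) =
              f δ s * (2 * f δ s - f P s * f Q s) + 2 * f Q s ^ 2 := by linear_combination -2 * hmk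
            rw [e]
            have : 0 ≤ f δ s * (2 * f δ s - f P s * f Q s) :=
              mul_nonneg (by linarith) (by linarith)
            have : 0 < f Q s ^ 2 := pow_pos (by linarith) 2
            linarith
          exact (pos_iff_pos_of_mul_pos this).1 (by linarith)
        have g2 : 0 < f P s * f δ s - 2 * f Q s := by
          have : 0 < f Q s * (f P s * f δ s - 2 * f Q s) := by
            have e : f Q s * (f P s * f δ s - 2 * f Q s) =
              f δ s * (2 * f δ s - f P s * f Q s) + 2 * f P s ^ 2 := by linear_combination -2 * hmk
            rw [e]
            have : 0 ≤ f δ s * (2 * f δ s - f P s * f Q s) :=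
              mul_nonneg (by linarith) (by linarith)
            have : 0 < f P s ^ 2 := pow_pos (by linarith) 2
            linarith
          exact (pos_iff_pos_of_mul_pos this).1 (by linarith)
        have hsum : deriv (f P) s * (f Q s * f δ s - 2 * f P s) +
            deriv (f Q) s * (f P s * f δ s - 2 * f Q s) = 0 := by linear_combination -hdm
        rcases lt_or_ge (deriv (f P) s) 0 with hdP | hdP
        · refine ih P s (prim_left hPQ.cross_eq) hsT0 ?_ hdP (hdesc _ _ hy (by linarith) hcase)
          rw [abs_of_neg hP]; linarith
        · rcases lt_or_ge (deriv (f Q) s) 0 with hdQ | hdQ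
          · refine ih Q s (prim_right hPQ.cross_eq) hsT0 ?_ hdQ
              (hdesc _ _ hx (by linarith) (by linarith))
            rw [abs_of_pos hQ]; linarith
          -- If neither end shortens, both derivatives vanish and so does the whole triangle, which
          -- `hpos` excludes.
          · have a1 := mul_nonneg hdP g1.le
            have a2 := mul_nonneg hdQ g2.le
            have b1 : deriv (f P) s = 0 :=
              (mul_eq_zero.1
                (by linarith : deriv (f P) s * (f Q s * f δ s - 2 * f P s) = 0)).resolve_right
                g1.ne'
            have b2 : deriv (f Q) s = 0 :=
              (mul_eq_zero.1
                (by linarith : deriv (f Q) s * (f P s * f δ s - 2 * f Q s) = 0)).resolve_right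
                g2.ne'
            exact hpos s hsT0 (TT.eq_zero_of_triangle hc1 hdz b2
              (by rw [sub_add_cancel]; exact b1) hprim)
      -- Otherwise the sum `P + Q` is longer than `δ`, so the derivatives at `P` and `Q` have
      -- opposite signs.
      · have hgood : Tangent.StrictGood (fun u => f u s) P Q := by
          show f P s * f Q s < 2 * f (P + Q) s
          linarith
        have hsum : deriv (f P) s * (f Q s * f δ s - 2 * f P s) +
            deriv (f Q) s * (f P s * f δ s - 2 * f Q s) = 0 := by linear_combination -hdm
        have hpr : 0 < f P s * (f Q s * f δ s - 2 * f P s) +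
            f Q s * (f P s * f δ s - 2 * f Q s) := by
          have e : f P s * (f Q s * f δ s - 2 * f P s) + f Q s * (f P s * f δ s - 2 * f Q s) =
            2 * f δ s ^ 2 := by linear_combination -2 * hmk
          rw [e]
          exact mul_pos two_pos (pow_pos (by linarith) 2)
        -- Opposite signs and `hsum` force the two coefficients to have the same sign, and `hpr`
        -- excludes that both are non-positive. So the triangle is reduced.
        have hred : 0 < f Q s * f δ s - 2 * f P s ∧ 0 < f P s * f δ s - 2 * f Q s := by
          have hP0 : 0 < f P s := by linarith
          have hQ0 : 0 < f Q s := by linarith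
          generalize f Q s * f δ s - 2 * f P s = A at *
          generalize f P s * f δ s - 2 * f Q s = C at *
          have hopp := TT.opposite_signs hirr hPQ hgood hprim (hpos s hsT0)
          have hAC : 0 < A ∨ 0 < C := by
            by_contra hno
            push Not at hno
            have := mul_nonneg hP0.le (neg_nonneg.2 hno.1)
            have := mul_nonneg hQ0.le (neg_nonneg.2 hno.2)
            linarith
          rcases hopp with ⟨o1, o2⟩ | ⟨o1, o2⟩ <;> rcases hAC with hA | hC
          · refine ⟨hA, ?_⟩
            have : 0 < deriv (f Q) s * C := by
              have := mul_neg_of_neg_of_pos o1 hA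
              linarith
            exact (pos_iff_pos_of_mul_pos this).1 o2
          · refine ⟨?_, hC⟩
            have : deriv (f P) s * A < 0 := by
              have := mul_pos o2 hC
              linarith
            by_contra hno
            have := mul_nonneg_of_nonpos_of_nonpos o1.le (not_lt.1 hno)
            linarith
          · refine ⟨hA, ?_⟩
            have : deriv (f Q) s * C < 0 := by
              have := mul_pos o1 hA
              linarith
            by_contra hno
            have := mul_nonneg_of_nonpos_of_nonpos o2.le (not_lt.1 hno)
            linarith
          · refine ⟨?_, hC⟩
            have : 0 < deriv (f P) s * A := by
              have := mul_neg_of_neg_of_pos o2 hC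
              linarith
            exact (pos_iff_pos_of_mul_pos this).1 o1
        obtain ⟨bx, byy⟩ := sq_le_of_reduced hκ hx hy hzκ (by linarith) (by linarith)
          (by linarith) (by linear_combination hmk)
        have l1 := hlog _ (by linarith) bx
        have l2 := hlog _ (by linarith) byy
        -- The pairings of `P` and `Q` add up to that of `δ`, which is less than `ε`; with bounded
        -- traces this violates the lower bound `L`.
        have hl := hlow s P Q hPQ.cross_eq
        rw [abs_of_pos hQ, abs_of_neg hP] at hl
        have m1 := mul_le_mul_of_nonneg_left l1 hQ.le
        have m2 := mul_le_mul_of_nonneg_left l2 (by linarith : 0 ≤ -pair lam P)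
        have m3 : |pair lam δ| * (B / 2 + 1) < ε * (B / 2 + 1) :=
          mul_lt_mul_of_pos_right hsmall (by positivity)
        rw [hεL, ← hlen] at m3
        nlinarith
  have TT := F.tangent T0
  -- A good edge far along the Farey path to `lam` supplies the first shortening curve.
  obtain ⟨u, v, h1, h2, h3⟩ := TT.exists_small_strictGood hirr hκ (hcon T0 hT0.le) hε0
  have hfin : ∀ δ, Prim δ → |pair lam δ| < ε → deriv (f δ) T0 < 0 → False := by
    intro δ hδ hsm hneg
    obtain ⟨n, hn⟩ := pow_unbounded_of_one_lt (f δ T0 / κ) (by linarith : 1 < κ / 2)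
    rw [div_lt_iff₀ (by linarith), mul_comm] at hn
    exact key n δ T0 hδ le_rfl hsm hneg hn
  rcases TT.opposite_signs hirr h1 h2 hprim (hpos T0 le_rfl) with ⟨o, -⟩ | ⟨-, o⟩
  · exact hfin u (prim_left h1.cross_eq) (by rw [abs_of_neg h1.left]; linarith [h1.right]) o
  · exact hfin v (prim_right h1.cross_eq) (by rw [abs_of_pos h1.right]; linarith [h1.left]) o

end Flow

/-! ### Calculus -/

/-- A convex function has one-sided derivatives, whose difference is at most the second difference
divided by `s`. The hypothesis makes that quotient tend to `0`. -/
theorem differentiable_of_add_le_cosh {f : ℝ → ℝ} {c : ℝ} (hf : ConvexOn ℝ Set.univ f)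
    (h : ∀ t s, f (t + s) + f (t - s) ≤ 2 * Real.cosh (c * s) * f t) : Differentiable ℝ f := by
  intro t
  have hmem : t ∈ interior (Set.univ : Set ℝ) := by simp
  have hR := hf.hasDerivWithinAt_rightDeriv_of_mem_interior hmem
  have hL := hf.hasDerivWithinAt_leftDeriv_of_mem_interior hmem
  have hLR := hf.leftDeriv_le_rightDeriv_of_mem_interior hmem
  set R := derivWithin f (Set.Ioi t) t
  set L := derivWithin f (Set.Iio t) t
  have hle : ∀ s > 0, R - L ≤ s⁻¹ * (2 * Real.cosh (c * s) * f t - 2 * f t) := by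
    intro s hs
    have h1 := hf.rightDeriv_le_slope_of_mem_interior hmem (Set.mem_univ (t + s)) (by linarith)
    have h2 := hf.slope_le_leftDeriv_of_mem_interior (Set.mem_univ (t - s)) hmem (by linarith)
    rw [slope_def_field] at h1 h2
    have e1 : t + s - t = s := by ring
    have e2 : t - (t - s) = s := by ring
    rw [e1, le_div_iff₀ hs] at h1
    rw [e2, div_le_iff₀ hs] at h2
    rw [← div_eq_inv_mul, le_div_iff₀ hs]
    change R * s ≤ _ at h1
    change _ ≤ L * s at h2
    linarith [h t s]
  have hd : HasDerivAt (fun s => 2 * Real.cosh (c * s) * f t) 0 0 := by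
    have h1 : HasDerivAt (fun s => c * s) c 0 := by simpa using (hasDerivAt_id (0 : ℝ)).const_mul c
    have := ((h1.cosh).const_mul 2).mul_const (f t)
    simpa using this
  have hlim := hd.tendsto_slope_zero_right
  have hRL : R - L ≤ 0 := by
    refine ge_of_tendsto hlim ?_
    filter_upwards [self_mem_nhdsWithin] with s hs
    simpa using hle s hs
  have e : R = L := le_antisymm (by linarith) hLR
  rw [e] at hR
  have := (hasDerivWithinAt_Ioi_iff_Ici.1 hR).union (hasDerivWithinAt_Iio_iff_Iic.1 hL)
  rw [Set.Ici_union_Iic] at this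
  exact (hasDerivWithinAt_univ.1 this).differentiableAt

/-- The hypothesis says that `exp (-c s) * f s` decreases and `exp (c s) * f s` increases;
differentiate both. -/
theorem abs_deriv_le_of_le_exp {f : ℝ → ℝ} {c : ℝ} (hf : Differentiable ℝ f)
    (h : ∀ t s, f (t + s) ≤ Real.exp (c * |s|) * f t) (t : ℝ) : |deriv f t| ≤ c * f t := by
  have hderiv : ∀ k : ℝ, HasDerivAt (fun s => Real.exp (k * s) * f s)
      (Real.exp (k * t) * k * f t + Real.exp (k * t) * deriv f t) t := by
    intro k
    have h1 : HasDerivAt (fun s => k * s) k t := by simpa using (hasDerivAt_id t).const_mul k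
    exact h1.exp.mul (hf t).hasDerivAt
  have hanti : Antitone fun s => Real.exp (-c * s) * f s := by
    intro a b hab
    have := h a (b - a)
    rw [abs_of_nonneg (by linarith), add_sub_cancel] at this
    calc Real.exp (-c * b) * f b ≤ Real.exp (-c * b) * (Real.exp (c * (b - a)) * f a) :=
          mul_le_mul_of_nonneg_left this (Real.exp_pos _).le
      _ = Real.exp (-c * a) * f a := by
        rw [← mul_assoc, ← Real.exp_add]; congr 2; ring
  have hmono : Monotone fun s => Real.exp (c * s) * f s := by
    intro a b hab
    have := h b (a - b)
    rw [abs_of_nonpos (by linarith), add_sub_cancel] at this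
    calc Real.exp (c * a) * f a ≤ Real.exp (c * a) * (Real.exp (c * -(a - b)) * f b) :=
          mul_le_mul_of_nonneg_left this (Real.exp_pos _).le
      _ = Real.exp (c * b) * f b := by
        rw [← mul_assoc, ← Real.exp_add]; congr 2; ring
  have h1 := hanti.deriv_nonpos (x := t)
  have h2 := hmono.deriv_nonneg (x := t)
  rw [(hderiv _).deriv] at h1 h2
  have p1 := Real.exp_pos (-c * t)
  have p2 := Real.exp_pos (c * t)
  rw [abs_le]
  constructor
  · have : 0 ≤ Real.exp (c * t) * (c * f t + deriv f t) := by linarith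
    have := nonneg_of_mul_nonneg_right this p2
    linarith
  · have : 0 ≤ Real.exp (-c * t) * (c * f t - deriv f t) := by linarith
    have := nonneg_of_mul_nonneg_right this p1
    linarith

/-! ### Measured laminations -/

/-- The lamination with a given direction. -/
def lamOf (lam : ℝ × ℝ) : SimpleCurve → ℝ := fun δ => |pair lam δ.cls|

theorem continuous_lamOf : Continuous lamOf := by
  refine continuous_pi fun δ => ?_
  unfold lamOf pair
  fun_prop

theorem weightedCurve_eq {w : ℝ} (hw : 0 ≤ w) (γ : SimpleCurve) :
    weightedCurve w γ = lamOf (w * (γ.cls.1 : ℝ), w * (γ.cls.2 : ℝ)) := by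
  ext δ
  rw [weightedCurve, inter_eq, lamOf, ← abs_of_nonneg hw, ← abs_mul, abs_of_nonneg hw]
  congr 1
  simp only [pair, cross]
  push_cast; ring

/-- The image of `lamOf` contains all weighted curves and is closed, since the intersection numbers
with the curves `(1, 0)` and `(0, 1)` are the absolute coordinates of `lam` and keep it in a compact
set. -/
theorem exists_lamOf {l : SimpleCurve → ℝ} (hl : l ∈ ML) : ∃ lam, l = lamOf lam := by
  have hsub : {l | ∃ w : ℝ, 0 ≤ w ∧ ∃ γ : SimpleCurve, l = weightedCurve w γ} ⊆
      Set.range lamOf := by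
    rintro _ ⟨w, hw, γ, rfl⟩
    exact ⟨_, (weightedCurve_eq hw γ).symm⟩
  have hl' : l ∈ closure (Set.range lamOf) := closure_mono hsub hl
  obtain ⟨a, ha⟩ := Prim.exists_curve (u := (1, 0)) ⟨(0, 1), by simp [cross]⟩
  obtain ⟨b, hb⟩ := Prim.exists_curve (u := (0, 1)) ⟨(-1, 0), by simp [cross]⟩
  let U : Set (SimpleCurve → ℝ) := {k | k a < l a + 1 ∧ k b < l b + 1}
  have hU : IsOpen U :=
    (isOpen_lt (continuous_apply a) continuous_const).inter
      (isOpen_lt (continuous_apply b) continuous_const)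
  have hlU : l ∈ U := ⟨by linarith, by linarith⟩
  let K : Set (ℝ × ℝ) := Metric.closedBall 0 (max (l a + 1) (l b + 1))
  have hK : IsCompact (lamOf '' K) := (isCompact_closedBall _ _).image continuous_lamOf
  have hsub2 : U ∩ Set.range lamOf ⊆ lamOf '' K := by
    rintro _ ⟨⟨h1, h2⟩, lam, rfl⟩
    refine ⟨lam, ?_, rfl⟩
    simp only [lamOf, ha, hb, pair] at h1 h2
    simp at h1 h2
    rw [mem_closedBall_zero_iff, Prod.norm_def, Real.norm_eq_abs, Real.norm_eq_abs]
    exact max_le (h2.le.trans (le_max_right _ _)) (h1.le.trans (le_max_left _ _))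
  have := closure_mono hsub2 (hU.inter_closure ⟨hlU, hl'⟩)
  rw [hK.isClosed.closure_eq] at this
  obtain ⟨lam, -, h⟩ := this
  exact ⟨lam, h.symm⟩

theorem isWeightedCurve_lamOf_iff (lam : ℝ × ℝ) : IsWeightedCurve (lamOf lam) ↔ ¬ Irr lam := by
  constructor
  · rintro ⟨w, hw, γ, h⟩ hirr
    have := congrFun h γ
    rw [weightedCurve, inter_eq, cross_self] at this
    simp [lamOf] at this
    exact hirr _ γ.prim this
  · intro h
    rw [Irr] at h
    push Not at h
    obtain ⟨u, hu, h0⟩ := h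
    obtain ⟨γ, hγ⟩ := hu.exists_curve
    obtain ⟨v, hv⟩ := hu
    -- `lam` is parallel to `u`, with factor `pair lam v` for a dual class `v`. The zero lamination
    -- is included, with weight `0`.
    refine ⟨|pair lam v|, abs_nonneg _, γ, ?_⟩
    ext δ
    rw [weightedCurve, inter_eq, lamOf, ← abs_mul, hγ]
    congr 1
    have hv' : (u.1 : ℝ) * v.2 - u.2 * v.1 = 1 := by
      simp only [cross] at hv; exact_mod_cast hv
    simp only [pair, cross] at h0 ⊢
    push_cast
    have e1 : lam.1 = (lam.1 * v.2 - lam.2 * v.1) * u.1 := by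
      linear_combination -lam.1 * hv' - v.1 * h0
    have e2 : lam.2 = (lam.1 * v.2 - lam.2 * v.1) * u.2 := by
      linear_combination -lam.2 * hv' - v.2 * h0
    linear_combination (δ.cls.2 : ℝ) * e1 - (δ.cls.1 : ℝ) * e2

/-! ### Submultiplicativity of traces -/

theorem Teich.m_add_le (X : Teich) {u v : ℤ × ℤ} (h : cross u v = 1) :
    X.m (u + v) ≤ X.m u * X.m v := by
  have := X.m_add_m_sub h
  have := X.two_lt_m (prim_sub h)
  linarith

theorem Teich.m_nat_combination_le (X : Teich) (n : ℕ) : ∀ (a b : ℤ × ℤ) (p q : ℕ), cross a b = 1 →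
    p + q ≤ n → p.Coprime q → X.m ((p : ℤ) • a + (q : ℤ) • b) ≤ X.m a ^ p * X.m b ^ q := by
  induction n with
  | zero =>
    intro a b p q hab hn hc
    obtain ⟨rfl, rfl⟩ : p = 0 ∧ q = 0 := by omega
    simp at hc
  | succ n ih =>
    intro a b p q hab hn hc
    have ha := X.two_lt_m (prim_left hab)
    have hb := X.two_lt_m (prim_right hab)
    have hab' := X.two_lt_m (prim_add hab)
    rcases Nat.eq_zero_or_pos q with rfl | hq
    · have hp : p = 1 := by simpa using hc
      simp [hp]
    rcases Nat.eq_zero_or_pos p with rfl | hp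
    · have hp : q = 1 := by simpa using hc
      simp [hp]
    rcases le_total q p with hqp | hpq
    · have h1 := ih a (a + b) (p - q) q (cross_left_add hab) (by omega)
        (by rwa [Nat.coprime_sub_self_left hqp])
      have e : ((p - q : ℕ) : ℤ) • a + (q : ℤ) • (a + b) = (p : ℤ) • a + (q : ℤ) • b := by
        push_cast [hqp]; module
      rw [e] at h1
      calc _ ≤ X.m a ^ (p - q) * X.m (a + b) ^ q := h1
        _ ≤ X.m a ^ (p - q) * (X.m a * X.m b) ^ q := by
          gcongr
          exact X.m_add_le hab
        _ = X.m a ^ (p - q + q) * X.m b ^ q := by ring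
        _ = _ := by rw [Nat.sub_add_cancel hqp]
    · have h1 := ih (a + b) b p (q - p) (cross_add_right_self hab) (by omega)
        (by rwa [Nat.coprime_sub_self_right hpq])
      have e : (p : ℤ) • (a + b) + ((q - p : ℕ) : ℤ) • b = (p : ℤ) • a + (q : ℤ) • b := by
        push_cast [hpq]; module
      rw [e] at h1
      calc _ ≤ X.m (a + b) ^ p * X.m b ^ (q - p) := h1
        _ ≤ (X.m a * X.m b) ^ p * X.m b ^ (q - p) := by
          gcongr
          exact X.m_add_le hab
        _ = X.m a ^ p * X.m b ^ (p + (q - p)) := by ring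
        _ = _ := by rw [Nat.add_sub_cancel' hpq]

/-- Euclid's algorithm and `m (u + v) ≤ m u * m v` in one of the bases `u, v` and `v, -u`, according
to the signs of the coordinates. Taking logarithms bounds the length of any curve by a combination
of two lengths. -/
theorem Teich.m_le (X : Teich) {u v w : ℤ × ℤ} (hw : Prim w) (h : cross u v = 1) :
    X.m w ≤ X.m u ^ (cross w v).natAbs * X.m v ^ (cross u w).natAbs := by
  have hexp := cross_expand u v w h
  have hcop := Int.isCoprime_iff_gcd_eq_one.1 (hw.isCoprime h)
  set k := cross w v
  set l := cross u w
  have hc : Nat.Coprime k.natAbs l.natAbs := hcop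
  have same := X.m_nat_combination_le _ u v k.natAbs l.natAbs h le_rfl hc
  have opp := X.m_nat_combination_le _ v (-u) l.natAbs k.natAbs (cross_rot h) le_rfl hc.symm
  rw [X.m_neg, mul_comm] at opp
  obtain ⟨p, hp⟩ := Int.eq_nat_or_neg k
  obtain ⟨q, hq⟩ := Int.eq_nat_or_neg l
  rcases hp with hp | hp <;> rcases hq with hq | hq <;> rw [hp, hq] at hexp same opp ⊢ <;>
    simp only [Int.natAbs_natCast, Int.natAbs_neg] at same opp ⊢
  · rw [hexp]; exact same
  · refine le_trans (le_of_eq ?_) opp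
    rw [← X.m_neg, hexp]; congr 1; module
  · refine le_trans (le_of_eq ?_) opp
    rw [hexp]; congr 1; module
  · refine le_trans (le_of_eq ?_) same
    rw [← X.m_neg, hexp]; congr 1; module

/-! ### Lengths along an earthquake -/

section Earthquake

variable {X : Teich} {lam : ℝ × ℝ} {E : ℝ → Teich}

theorem IsEarthquake.exists_profiles (hE : IsEarthquake X (lamOf lam) E) :
    ∃ (F : Filter (ℝ × SimpleCurve)) (Y : ℝ × SimpleCurve → ℝ → Teich), F.NeBot ∧
      (∀ᶠ p in F, 0 ≤ p.1) ∧ (∀ p t, IsTwist X p.2 (p.1 * t) (Y p t)) ∧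
      (∀ u, Prim u → Tendsto (fun p => p.1 * |(cross p.2.cls u : ℝ)|) F (𝓝 |pair lam u|)) ∧
      ∀ u t, Tendsto (fun p => (Y p t).m u) F (𝓝 ((E t).m u)) := by
  obtain ⟨F, Y, h1, h2, h3, h4, h5⟩ := hE
  refine ⟨F, Y, h1, h2, h4, fun u hu => ?_, fun u t => ?_⟩
  · obtain ⟨δ, rfl⟩ := hu.exists_curve
    exact (tendsto_pi_nhds.1 h3) δ
  · exact ((Teich.continuous_m u).tendsto _).comp (h5 t)

/-- Each clause is a closed condition that the twist profiles satisfy with exponent half the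
weighted intersection number, which converges to `|pair lam u| / 2`. -/
theorem IsEarthquake.estimates (hE : IsEarthquake X (lamOf lam) E) {u : ℤ × ℤ} (hu : Prim u) :
    ConvexOn ℝ Set.univ (fun t => (E t).m u) ∧
    (∀ t s, (E (t + s)).m u + (E (t - s)).m u ≤
      2 * Real.cosh (|pair lam u| / 2 * s) * (E t).m u) ∧
    (∀ t s, (E (t + s)).m u ≤ Real.exp (|pair lam u| / 2 * |s|) * (E t).m u) ∧
    (∀ t, Real.exp (|pair lam u| / 2 * |t|) ≤ (E t).m u * X.m u) := by
  obtain ⟨F, Y, h1, h2, h3, h4, h5⟩ := hE.exists_profiles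
  choose f f1 f2 f3 f4 using fun p : ℝ × SimpleCurve => exists_twist_profile X p.2.prim hu
  have hY : ∀ p t, (Y p t).m u = f p (p.1 * t) := fun p t => f2 p p.2 _ _ rfl (h3 p t)
  have hN : Tendsto (fun p : ℝ × SimpleCurve => |(cross p.2.cls u : ℝ)| / 2 * p.1) F
      (𝓝 (|pair lam u| / 2)) := by
    have := (h4 u hu).div_const 2
    refine this.congr fun p => ?_
    ring
  refine ⟨⟨convex_univ, fun x _ y _ a b ha hb hab => ?_⟩, fun t s => ?_, fun t s => ?_, fun t => ?_⟩
  · refine le_of_tendsto_of_tendsto (h5 u _)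
      (((h5 u x).const_smul a).add ((h5 u y).const_smul b)) (Eventually.of_forall fun p => ?_)
    simp only [hY]
    have := (f1 p).convexOn.2 (Set.mem_univ (p.1 * x)) (Set.mem_univ (p.1 * y)) ha hb hab
    convert this using 2
    simp only [smul_eq_mul]; ring
  · refine le_of_tendsto_of_tendsto ((h5 u _).add (h5 u _))
      ((((Real.continuous_cosh.tendsto _).comp (hN.mul_const s)).const_mul 2).mul (h5 u t))
      (Eventually.of_forall fun p => ?_)
    simp only [hY, Function.comp]
    have := (f1 p).add_le_cosh_mul (p.1 * t) (p.1 * s)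
    rw [mul_add, mul_sub, mul_assoc _ p.1 s]
    exact this
  · refine le_of_tendsto_of_tendsto (h5 u _)
      (((Real.continuous_exp.tendsto _).comp (hN.mul_const |s|)).mul (h5 u t)) ?_
    filter_upwards [h2] with p hp
    simp only [hY, Function.comp]
    have := (f1 p).le_exp_mul (p.1 * t) (p.1 * s)
    rw [abs_mul, abs_of_nonneg hp] at this
    rw [mul_add, mul_assoc _ p.1 |s|]
    exact this
  · refine le_of_tendsto_of_tendsto ((Real.continuous_exp.tendsto _).comp (hN.mul_const |t|))
      ((h5 u t).mul_const (X.m u)) ?_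
    filter_upwards [h2] with p hp
    simp only [hY, Function.comp]
    have := f3 p (p.1 * t)
    rw [abs_mul, abs_of_nonneg hp] at this
    rw [mul_assoc _ p.1 |t|]
    exact this

theorem IsEarthquake.differentiable (hE : IsEarthquake X (lamOf lam) E) {u : ℤ × ℤ} (hu : Prim u) :
    Differentiable ℝ fun t => (E t).m u :=
  differentiable_of_add_le_cosh (hE.estimates hu).1 (hE.estimates hu).2.1

/-- This expresses that the length of `lam` is constant and positive along its earthquake. A twist
about `γ` preserves the trace of `γ`; on the original surface that trace grows exponentially with
the crossings of `γ` with `(1, 0)`, and on the twisted one `Teich.m_le` bounds it by `u` and `v`.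
Multiply the logarithms by the weight and pass to the limit. -/
theorem IsEarthquake.lower (hE : IsEarthquake X (lamOf lam) E) (hirr : Irr lam) :
    ∃ L > 0, ∀ t u v, cross u v = 1 →
      L ≤ |pair lam v| * Real.log ((E t).m u) + |pair lam u| * Real.log ((E t).m v) := by
  obtain ⟨F, Y, h1, h2, h3, h4, h5⟩ := hE.exists_profiles
  have hprim : Prim (1, 0) := ⟨(0, 1), by simp [cross]⟩
  have hx := X.two_lt_m hprim
  set c := Real.log (1 + 4 / (X.m (1, 0) ^ 2 - 4)) with hc
  have hx4 : 0 < 4 / (X.m (1, 0) ^ 2 - 4) := div_pos (by norm_num) (by nlinarith)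
  have hc0 : 0 < c := Real.log_pos (by linarith)
  refine ⟨c / 2 * |pair lam (1, 0)|, mul_pos (by linarith) (abs_pos.2 (hirr _ hprim)),
    fun t u v huv => ?_⟩
  have hu := prim_left huv
  have hv := prim_right huv
  have logt : ∀ w, Prim w → Tendsto (fun p => Real.log ((Y p t).m w)) F
      (𝓝 (Real.log ((E t).m w))) := by
    intro w hw
    have := (E t).two_lt_m hw
    exact (h5 w t).log (by linarith)
  refine le_of_tendsto_of_tendsto ((h4 _ hprim).const_mul (c / 2))
    (((h4 v hv).mul (logt u hu)).add ((h4 u hu).mul (logt v hv))) ?_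
  filter_upwards [h2] with p hp
  have hg := p.2.prim
  have hmg : (Y p t).m p.2.cls = X.m p.2.cls := (h3 p t).formula.1
  have mg := X.two_lt_m hg
  have mu := (Y p t).two_lt_m hu
  have mv := (Y p t).two_lt_m hv
  obtain ⟨-, -, -, -, k⟩ := exists_twist_profile X hprim hg
  have k1 : ((cross (1, 0) p.2.cls).natAbs : ℝ) * c ≤ 2 * Real.log (X.m p.2.cls) := by
    have h6 : (1 + 4 / (X.m (1, 0) ^ 2 - 4)) ^ (cross (1, 0) p.2.cls).natAbs ≤ X.m p.2.cls ^ 2 := by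
      have : 0 ≤ (1 + 4 / (X.m (1, 0) ^ 2 - 4)) ^ (cross (1, 0) p.2.cls).natAbs := by positivity
      linarith
    have := Real.log_le_log (by positivity) h6
    rw [Real.log_pow, Real.log_pow] at this
    exact_mod_cast this
  have k2 : Real.log (X.m p.2.cls) ≤
      ((cross p.2.cls v).natAbs : ℝ) * Real.log ((Y p t).m u) +
      ((cross u p.2.cls).natAbs : ℝ) * Real.log ((Y p t).m v) := by
    have h6 := (Y p t).m_le hg huv
    rw [hmg] at h6
    have := Real.log_le_log (by linarith) h6
    rw [Real.log_mul (by positivity) (by positivity), Real.log_pow, Real.log_pow] at this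
    exact this
  have a1 : ((cross (1, 0) p.2.cls).natAbs : ℝ) = |(cross p.2.cls (1, 0) : ℝ)| := by
    rw [cross_comm, Int.natAbs_neg, Nat.cast_natAbs, Int.cast_abs]
  have a2 : ((cross p.2.cls v).natAbs : ℝ) = |(cross p.2.cls v : ℝ)| := by
    rw [Nat.cast_natAbs, Int.cast_abs]
  have a3 : ((cross u p.2.cls).natAbs : ℝ) = |(cross p.2.cls u : ℝ)| := by
    rw [cross_comm, Int.natAbs_neg, Nat.cast_natAbs, Int.cast_abs]
  rw [a1] at k1
  rw [a2, a3] at k2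
  have := mul_le_mul_of_nonneg_left (k1.trans (mul_le_mul_of_nonneg_left k2 two_pos.le)) hp
  linarith

theorem IsEarthquake.flow (hE : IsEarthquake X (lamOf lam) E) (hirr : Irr lam) :
    Flow lam fun u t => (E t).m u where
  convex u hu := (hE.estimates hu).1
  diff u hu := hE.differentiable hu
  growth u hu := by
    have h := (hE.estimates hu).2.2.2
    have hx := X.two_lt_m hu
    have hpos : 0 < |pair lam u| / 2 := half_pos (abs_pos.2 (hirr u hu))
    have h1 : Tendsto (fun t : ℝ => Real.exp (|pair lam u| / 2 * |t|) / X.m u) atTop atTop := by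
      refine Tendsto.atTop_div_const (by linarith) (Real.tendsto_exp_atTop.comp ?_)
      exact tendsto_abs_atTop_atTop.const_mul_atTop hpos
    refine tendsto_atTop_mono (fun t => ?_) h1
    rw [div_le_iff₀ (by linarith)]
    exact h t
  lower := hE.lower hirr
  tangent t := by
    have hd : ∀ u, Prim u → HasDerivAt (fun t => (E t).m u) (deriv (fun t => (E t).m u) t) t :=
      fun u hu => (hE.differentiable hu t).hasDerivAt
    refine ⟨fun u => (E t).m_neg u, fun u => ?_, fun u hu => (E t).two_lt_m hu,
      fun u v h => (E t).m_markov h, fun u v h => (E t).m_add_m_sub h, fun u v h => ?_,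
      fun u v h => ?_, fun u hu => ?_⟩
    · simp only [Teich.m_neg]
    · have du := hd u (prim_left h)
      have dv := hd v (prim_right h)
      have dw := hd (u + v) (prim_add h)
      have l := ((du.pow 2).add (dv.pow 2)).add (dw.pow 2)
      have r := (du.mul dv).mul dw
      have e : (((fun t => (E t).m u) ^ 2 + (fun t => (E t).m v) ^ 2) +
          (fun t => (E t).m (u + v)) ^ 2) =
          ((fun t => (E t).m u) * (fun t => (E t).m v)) * (fun t => (E t).m (u + v)) := by
        funext s
        exact (E s).m_markov h
      rw [e] at l
      have := l.unique r
      simp only [Nat.cast_ofNat, Nat.add_one_sub_one, pow_one, Pi.mul_apply] at this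
      linear_combination this
    · have du := hd u (prim_left h)
      have dv := hd v (prim_right h)
      have l := (hd (u + v) (prim_add h)).add (hd (u - v) (prim_sub h))
      have e : ((fun t => (E t).m (u + v)) + (fun t => (E t).m (u - v))) =
          (fun t => (E t).m u) * (fun t => (E t).m v) := by
        funext s
        exact (E s).m_add_m_sub h
      rw [e] at l
      exact l.unique (du.mul dv)
    · exact abs_deriv_le_of_le_exp (hE.differentiable hu) (hE.estimates hu).2.2.1 t

end Earthquake

/-! ### The gap in the trace spectrum -/

section Gap

variable {K al be ga : ℝ}

/-- The shapes of products of transition matrices. -/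
def GapShape (K : ℝ) (M : Matrix (Fin 2) (Fin 2) ℝ) : Prop :=
  (1 / K ^ 2 * M.det ≤ M 0 1 * M 1 0) ∨
  (M 1 0 = 0 ∧ M 0 0 = 1 ∧ M 1 1 ≤ K * M 0 1 ∧ 1 ≤ K * M 0 1) ∨
  (M 0 1 = 0 ∧ M 1 1 = 1 ∧ M 0 0 ≤ K * M 1 0 ∧ 1 ≤ K * M 1 0)

/-- The three shapes are: off-diagonal entries on both sides, upper triangular, lower triangular.
Products of triangular matrices of the same kind keep their shape; mixed ones become two-sided, with
the factor `1 / K²` coming from one bound of each; and a two-sided factor keeps the product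
two-sided. -/
theorem GapShape.mul (hK : 0 < K) {M N : Matrix (Fin 2) (Fin 2) ℝ} (hM : NonnegMat M)
    (hN : NonnegMat N) (sM : GapShape K M) (sN : GapShape K N) : GapShape K (M * N) := by
  have a00 := hM.1 0 0
  have a01 := hM.1 0 1
  have a10 := hM.1 1 0
  have a11 := hM.1 1 1
  have b00 := hN.1 0 0
  have b01 := hN.1 0 1
  have b10 := hN.1 1 0
  have b11 := hN.1 1 1
  have dM := hM.2
  have dN := hN.2
  rw [GapShape, Matrix.det_mul]
  simp only [Matrix.mul_apply, Fin.sum_univ_two]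
  have detM := Matrix.det_fin_two M
  have detN := Matrix.det_fin_two N
  have expand : M 0 1 * M 1 0 * (N 0 0 * N 1 1) + M 0 0 * M 1 1 * (N 0 1 * N 1 0) ≤
      (M 0 0 * N 0 1 + M 0 1 * N 1 1) * (M 1 0 * N 0 0 + M 1 1 * N 1 0) := by
    have h1 : 0 ≤ M 0 0 * N 0 1 * (M 1 0 * N 0 0) := by positivity
    have h2 : 0 ≤ M 0 1 * N 1 1 * (M 1 1 * N 1 0) := by positivity
    linarith
  rcases sM with sM | sM | sM
  · left
    have h1 : N.det ≤ N 0 0 * N 1 1 := by rw [detN]; nlinarith [mul_nonneg b01 b10]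
    have h2 : 1 / K ^ 2 * M.det * N.det ≤ M 0 1 * M 1 0 * (N 0 0 * N 1 1) :=
      mul_le_mul sM h1 dN.le (by positivity)
    have h3 : 0 ≤ M 0 0 * M 1 1 * (N 0 1 * N 1 0) := by positivity
    linarith
  · obtain ⟨m1, m2, m3, m4⟩ := sM
    rcases sN with sN | sN | sN
    · left
      have h1 : M.det ≤ M 0 0 * M 1 1 := by rw [detM]; nlinarith [mul_nonneg a01 a10]
      have h2 : M.det * (1 / K ^ 2 * N.det) ≤ M 0 0 * M 1 1 * (N 0 1 * N 1 0) :=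
        mul_le_mul h1 sN (by positivity) (by positivity)
      have h3 : 0 ≤ M 0 1 * M 1 0 * (N 0 0 * N 1 1) := by positivity
      linarith
    · obtain ⟨n1, n2, n3, n4⟩ := sN
      right; left
      rw [m1, m2, n1, n2]
      refine ⟨by ring, by ring, ?_, ?_⟩
      · have := mul_le_mul_of_nonneg_right m3 b11
        have := mul_nonneg hK.le b01
        nlinarith
      · have := mul_nonneg (mul_nonneg hK.le a01) b11
        nlinarith
    · obtain ⟨n1, n2, n3, n4⟩ := sN
      left
      rw [detM, detN, m1, m2, n1, n2]
      have h1 : 1 * N 0 0 ≤ K * M 0 1 * (K * N 1 0) := mul_le_mul m4 n3 b00 (by linarith)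
      have h2 : N 0 0 ≤ K ^ 2 * (M 0 1 * N 1 0) := by linarith
      have h3 : 1 / K ^ 2 * N 0 0 ≤ M 0 1 * N 1 0 := by
        rw [one_div, inv_mul_le_iff₀ (by positivity)]; exact h2
      have := mul_le_mul_of_nonneg_left h3 a11
      linarith
  · obtain ⟨m1, m2, m3, m4⟩ := sM
    rcases sN with sN | sN | sN
    · left
      have h1 : M.det ≤ M 0 0 * M 1 1 := by rw [detM]; nlinarith [mul_nonneg a01 a10]
      have h2 : M.det * (1 / K ^ 2 * N.det) ≤ M 0 0 * M 1 1 * (N 0 1 * N 1 0) :=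
        mul_le_mul h1 sN (by positivity) (by positivity)
      have h3 : 0 ≤ M 0 1 * M 1 0 * (N 0 0 * N 1 1) := by positivity
      linarith
    · obtain ⟨n1, n2, n3, n4⟩ := sN
      left
      rw [detM, detN, m1, m2, n1, n2]
      have h1 : 1 * N 1 1 ≤ K * M 1 0 * (K * N 0 1) := mul_le_mul m4 n3 b11 (by linarith)
      have h2 : N 1 1 ≤ K ^ 2 * (M 1 0 * N 0 1) := by linarith
      have h3 : 1 / K ^ 2 * N 1 1 ≤ M 1 0 * N 0 1 := by
        rw [one_div, inv_mul_le_iff₀ (by positivity)]; exact h2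
      have := mul_le_mul_of_nonneg_left h3 a00
      linarith
    · obtain ⟨n1, n2, n3, n4⟩ := sN
      right; right
      rw [m1, m2, n1, n2]
      refine ⟨by ring, by ring, ?_, ?_⟩
      · have := mul_le_mul_of_nonneg_right m3 b00
        have := mul_nonneg hK.le b10
        nlinarith
      · have := mul_nonneg (mul_nonneg hK.le a10) b00
        nlinarith

/-- The frame parameters are bounded in terms of `K`. -/
structure ParBound (K al be ga : ℝ) : Prop where
  al_pos : 0 < al
  be_pos : 0 < be
  ga_pos : 0 < ga
  rel : be * ga = 1 + al ^ 2
  K_pos : 0 < K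
  one_le_be : 1 ≤ K * be
  one_le_ga : 1 ≤ K * ga
  al_le_be : al ≤ K * be
  al_le_ga : al ≤ K * ga
  one_le_al : 1 ≤ K * al
  al_le : al ≤ K

theorem GapShape.trans (h : ParBound K al be ga) (s t : Letter) :
    GapShape K (trans al be ga s t) := by
  have ha := h.al_pos
  have hK := h.K_pos
  have c1 : 1 / K ^ 2 ≤ al * al := by
    rw [div_le_iff₀ (by positivity)]; nlinarith [h.one_le_al]
  have c2 : 1 / K ^ 2 ≤ 1 / al * (1 / al) := by
    rw [show 1 / al * (1 / al) = 1 / al ^ 2 by ring]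
    exact one_div_le_one_div_of_le (by positivity) (pow_le_pow_left₀ ha.le h.al_le 2)
  have bothA : GapShape K !![be, al; al, ga] := by
    left
    rw [Matrix.det_fin_two_of, show be * ga - al * al = 1 by linarith [h.rel]]
    simpa using c1
  have bothB : GapShape K !![ga / al, 1 / al; 1 / al, be / al] := by
    left
    have : ga / al * (be / al) - 1 / al * (1 / al) = 1 := by
      field_simp; linarith [h.rel]
    rw [Matrix.det_fin_two_of, this, mul_one]
    exact c2
  have up1 : GapShape K !![1, be; 0, al] := Or.inr (Or.inl ⟨rfl, rfl, h.al_le_be, h.one_le_be⟩)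
  have up2 : GapShape K !![1, ga / al; 0, 1 / al] := by
    refine Or.inr (Or.inl ⟨rfl, rfl, ?_, ?_⟩)
    · show 1 / al ≤ K * (ga / al)
      rw [← mul_div_assoc]
      exact div_le_div_of_nonneg_right h.one_le_ga ha.le
    · show 1 ≤ K * (ga / al)
      rw [← mul_div_assoc, le_div_iff₀ ha, one_mul]; exact h.al_le_ga
  have lo1 : GapShape K !![al, 0; ga, 1] := Or.inr (Or.inr ⟨rfl, rfl, h.al_le_ga, h.one_le_ga⟩)
  have lo2 : GapShape K !![1 / al, 0; be / al, 1] := by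
    refine Or.inr (Or.inr ⟨rfl, rfl, ?_, ?_⟩)
    · show 1 / al ≤ K * (be / al)
      rw [← mul_div_assoc]
      exact div_le_div_of_nonneg_right h.one_le_be ha.le
    · show 1 ≤ K * (be / al)
      rw [← mul_div_assoc, le_div_iff₀ ha, one_mul]; exact h.al_le_be
  obtain ⟨i, s⟩ := s
  obtain ⟨j, t⟩ := t
  fin_cases i <;> fin_cases j <;> cases s <;> cases t <;> assumption

theorem GapShape.chainMat (h : ParBound K al be ga) (t : Letter) : ∀ (s : Letter) (L : List Letter),
    GapShape K (chainMat al be ga (s :: L) t)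
  | s, [] => by
    rw [PuncturedTorus.chainMat, PuncturedTorus.chainMat, mul_one]
    exact GapShape.trans h _ _
  | s, r :: L => by
    rw [PuncturedTorus.chainMat]
    exact GapShape.mul h.K_pos (NonnegMat.trans h.al_pos h.be_pos h.ga_pos h.rel _ _)
      (NonnegMat.chainMat h.al_pos h.be_pos h.ga_pos h.rel _ _) (GapShape.trans h _ _)
      (GapShape.chainMat h t r L)

theorem det_frame_ne_zero (h : ParBound K al be ga) (s : Letter) : (frame al be ga s).det ≠ 0 := by
  have := h.al_pos
  have := h.rel
  obtain ⟨i, s⟩ := s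
  fin_cases i <;> cases s <;> simp [frame, Matrix.det_fin_two_of] <;> nlinarith

/-- For determinant `1` the squared trace is `(M 0 0 - M 1 1)² + 4 + 4 (M 0 1) (M 1 0)`; the
triangular shapes are unipotent. -/
theorem GapShape.trace_sq {M : Matrix (Fin 2) (Fin 2) ℝ} (h : GapShape K M) (hdet : M.det = 1) :
    M.trace ^ 2 = 4 ∨ 4 + 4 / K ^ 2 ≤ M.trace ^ 2 := by
  rw [Matrix.trace_fin_two]
  have d := Matrix.det_fin_two M
  rw [hdet] at d
  rcases h with h | ⟨h1, h2, -, -⟩ | ⟨h1, h2, -, -⟩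
  · right
    rw [hdet, mul_one] at h
    have e : 4 / K ^ 2 = 4 * (1 / K ^ 2) := by ring
    rw [e]
    nlinarith [sq_nonneg (M 0 0 - M 1 1)]
  · left
    rw [h1, h2] at d
    rw [h2, show M 1 1 = 1 by linarith]; norm_num
  · left
    rw [h1, h2] at d
    rw [h2, show M 0 0 = 1 by linarith]; norm_num

/-- The trace depends only on the cyclically reduced word. Running around that word from the frame
of its first letter back to the same frame makes its matrix conjugate, up to sign, to a product of
transition matrices. -/
theorem tr_sq_gap (p : Triples) (h : ParBound K (parA p) (parB p) (parC p)) (g : Pi1) :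
    tr (nfHom p g) ^ 2 = 4 ∨ 4 + 4 / K ^ 2 ≤ tr (nfHom p g) ^ 2 := by
  set L := FreeGroup.reduceCyclically g.toWord with hL
  have hcyc : FreeGroup.IsCyclicallyReduced L :=
    FreeGroup.reduceCyclically.isCyclicallyReduced FreeGroup.isReduced_toWord
  have htr : tr (nfHom p g) = tr (nfHom p (FreeGroup.mk L)) := by
    have hw := FreeGroup.reduceCyclically.conj_conjugator_reduceCyclically g.toWord
    have : g = FreeGroup.mk (FreeGroup.reduceCyclically.conjugator g.toWord) * FreeGroup.mk L *
        (FreeGroup.mk (FreeGroup.reduceCyclically.conjugator g.toWord))⁻¹ := by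
      rw [FreeGroup.inv_mk, FreeGroup.mul_mk, FreeGroup.mul_mk, hL, hw, FreeGroup.mk_toWord]
    conv_lhs => rw [this]
    rw [map_mul, map_mul, map_inv, tr_conj]
  rw [htr, tr, ← wordMat_par]
  rcases hLc : L with _ | ⟨s, L'⟩
  · left
    simp [wordMat]
    norm_num
  · rw [hLc] at hcyc
    -- Cyclic reducedness is what allows the word to be followed by its own first letter.
    have hred : FreeGroup.IsReduced (s :: L' ++ [s]) := by
      refine List.isChain_append.2 ⟨hcyc.1, List.isChain_singleton _, ?_⟩
      intro x hx y hy
      simp only [List.head?_cons, Option.mem_def, Option.some.injEq] at hy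
      subst hy
      exact hcyc.2 x hx s (by simp)
    have hw := wordMat_mul_frame h.al_pos h.be_pos h.rel s (s :: L') hred
    have hF := det_frame_ne_zero h s
    have hFu : IsUnit (frame (parA p) (parB p) (parC p) s).det := isUnit_iff_ne_zero.2 hF
    simp only [List.head?_cons, Option.getD_some] at hw
    set W := wordMat (parA p) (parB p) (parC p) (s :: L') with hW
    set F := frame (parA p) (parB p) (parC p) s
    set C := chainMat (parA p) (parB p) (parC p) (s :: L') s with hC
    have hdetW : W.det = 1 := by
      rw [hW, wordMat_par]; exact (nfHom p _).2
    have key : C.det = 1 ∧ W.trace ^ 2 = C.trace ^ 2 := by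
      have aux : ∀ D : Matrix (Fin 2) (Fin 2) ℝ, W * F = F * D → D.det = 1 ∧ W.trace = D.trace := by
        intro D hD
        have e : W = F * D * F⁻¹ := by
          rw [← hD, Matrix.mul_assoc, Matrix.mul_nonsing_inv _ hFu, Matrix.mul_one]
        constructor
        · have := congrArg Matrix.det hD
          rw [Matrix.det_mul, Matrix.det_mul, hdetW, one_mul] at this
          exact (mul_left_cancel₀ hF (by rw [mul_one]; exact this)).symm
        · rw [e, Matrix.trace_mul_comm, ← Matrix.mul_assoc, Matrix.nonsing_inv_mul _ hFu,
            Matrix.one_mul]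
      rcases hw with hw | hw
      · obtain ⟨a, b⟩ := aux C hw
        exact ⟨a, by rw [b]⟩
      · rw [← Matrix.mul_neg] at hw
        obtain ⟨a, b⟩ := aux (-C) hw
        refine ⟨?_, by rw [b, Matrix.trace_neg, neg_sq]⟩
        rw [Matrix.det_neg] at a
        simpa using a
    rw [key.2]
    exact (GapShape.chainMat h s s L').trace_sq key.1

/-- The delicate parameter is `parC`, which equals `(xy - z) / y`. It stays away from `0` because `z
(xy - z) = x² + y²`. -/
theorem parBound_of_le (p : Triples) {M : ℝ} (h1 : p.1.1 ≤ M) (h2 : p.1.2.1 ≤ M)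
    (h3 : p.1.2.2 ≤ M) :
    ParBound (M ^ 2) (parA p) (parB p) (parC p) := by
  obtain ⟨⟨x, y, z⟩, hp⟩ := p
  have hx := two_lt_of_mem_triples hp
  have hy : 2 < y := two_lt_of_mem_triples (x := y) (y := x) (z := z)
    ⟨hp.2.1, hp.1, hp.2.2.1, by have := hp.2.2.2; simp only at this ⊢; linarith⟩
  have hz : 2 < z := two_lt_of_mem_triples (x := z) (y := x) (z := y)
    ⟨hp.2.2.1, hp.1, hp.2.1, by have := hp.2.2.2; simp only at this ⊢; linarith⟩
  have hr : x ^ 2 + y ^ 2 + z ^ 2 = x * y * z := hp.2.2.2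
  simp only at h1 h2 h3
  have hM : 2 < M := by linarith
  have hMM : M * 2 ≤ M ^ 2 := by nlinarith
  have hw : 1 < x * y - z ∧ 2 < M * (x * y - z) := by
    have e : z * (x * y - z) = x ^ 2 + y ^ 2 := by linear_combination -hr
    have hpos : 0 < x * y - z := by
      have : 0 < z * (x * y - z) := by rw [e]; positivity
      exact (pos_iff_pos_of_mul_pos this).1 (by linarith)
    constructor
    · by_contra hc
      push Not at hc
      have : z * (x * y - z) ≤ z * 1 := mul_le_mul_of_nonneg_left hc (by linarith)
      have h5 : z ≤ x * y - 0 := by linarith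
      nlinarith
    · have : z * (x * y - z) ≤ M * (x * y - z) := mul_le_mul_of_nonneg_right h3 hpos.le
      nlinarith
  have hga : parC ⟨(x, y, z), hp⟩ = (x * y - z) / y := by
    simp only [parC]; field_simp
  refine ⟨parA_pos _, parB_pos _, parC_pos _, par_rel _, by positivity, ?_, ?_, ?_, ?_, ?_, ?_⟩
  · simp only [parB]
    rw [← mul_div_assoc, le_div_iff₀ (by linarith)]; nlinarith
  · rw [hga, ← mul_div_assoc, le_div_iff₀ (by linarith)]; nlinarith
  · simp only [parA, parB]
    rw [← mul_div_assoc]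
    exact div_le_div_of_nonneg_right (by nlinarith) (by linarith)
  · rw [hga]; simp only [parA]
    rw [← mul_div_assoc]
    exact div_le_div_of_nonneg_right (by nlinarith) (by linarith)
  · simp only [parA]
    rw [← mul_div_assoc, le_div_iff₀ (by linarith)]; nlinarith
  · simp only [parA]
    rw [div_le_iff₀ (by linarith)]; nlinarith

end Gap

/-! ### Translation lengths -/

/-- For hyperbolic `A` the last square vanishes exactly on the axis, so this determines the
translation length from the trace. -/
theorem sq_sinh_half_dist_smul (A : SL(2, ℝ)) (z : UpperHalfPlane) :
    4 * Real.sinh (dist z (A • z) / 2) ^ 2 = tr A ^ 2 - 4 +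
      ((A.val 1 0 * z.re ^ 2 + (A.val 1 1 - A.val 0 0) * z.re - A.val 0 1 +
        A.val 1 0 * z.im ^ 2) / z.im) ^ 2 := by
  have hy := z.im_pos
  have hd := det_entries A
  have h1 := UpperHalfPlane.cosh_dist z (A • z)
  have h2 : Real.cosh (dist z (A • z)) = 1 + 2 * Real.sinh (dist z (A • z) / 2) ^ 2 := by
    have := Real.cosh_two_mul (dist z (A • z) / 2)
    rw [mul_div_cancel₀ _ (two_ne_zero)] at this
    rw [this, Real.cosh_sq]; ring
  have hw : ((A • z : UpperHalfPlane) : ℂ) = ((A.val 0 0 : ℂ) * z + (A.val 0 1 : ℂ)) /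
      ((A.val 1 0 : ℂ) * z + (A.val 1 1 : ℂ)) := UpperHalfPlane.coe_specialLinearGroup_apply A z
  rw [tr_def]
  set a := A.val 0 0
  set b := A.val 0 1
  set c := A.val 1 0
  set d := A.val 1 1
  set D : ℂ := (c : ℂ) * z + (d : ℂ) with hD
  have hDre : D.re = c * z.re + d := by simp [hD]
  have hDim : D.im = c * z.im := by simp [hD]
  have hD0 : D ≠ 0 := by
    intro h0
    have e1 : c * z.im = 0 := by rw [← hDim, h0]; simp
    have e2 : c * z.re + d = 0 := by rw [← hDre, h0]; simp
    have hc : c = 0 := (mul_eq_zero.1 e1).resolve_right hy.ne'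
    rw [hc] at e2 hd
    rw [show d = 0 by linarith] at hd
    norm_num at hd
  have hN : Complex.normSq D = (c * z.re + d) ^ 2 + (c * z.im) ^ 2 := by
    rw [Complex.normSq_apply, hDre, hDim]; ring
  have hN0 : 0 < Complex.normSq D := Complex.normSq_pos.2 hD0
  have him : (A • z).im = z.im / Complex.normSq D := by
    rw [← UpperHalfPlane.coe_im, hw, Complex.div_im, hDre, hDim]
    simp
    rw [← sub_div]
    congr 1
    linear_combination z.im * hd
  have hdist : dist (z : ℂ) (A • z : UpperHalfPlane) ^ 2 = Complex.normSq (z * D - (a * z + b)) /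
      Complex.normSq D := by
    rw [Complex.dist_eq, ← Complex.normSq_eq_norm_sq, hw, ← Complex.normSq_div]
    congr 1
    field_simp
  have hQ : Complex.normSq (z * D - (a * z + b)) =
      (c * (z.re ^ 2 - z.im ^ 2) + (d - a) * z.re - b) ^ 2 +
        (z.im * (2 * c * z.re + d - a)) ^ 2 := by
    rw [Complex.normSq_apply]
    simp [hDre, hDim]
    ring
  rw [h2, hdist, him, hQ] at h1
  have e : ((c * (z.re ^ 2 - z.im ^ 2) + (d - a) * z.re - b) ^ 2 +
      (z.im * (2 * c * z.re + d - a)) ^ 2) / Complex.normSq D /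
      (2 * z.im * (z.im / Complex.normSq D)) =
      ((c * (z.re ^ 2 - z.im ^ 2) + (d - a) * z.re - b) ^ 2 +
      (z.im * (2 * c * z.re + d - a)) ^ 2) / (2 * z.im ^ 2) := by
    field_simp
  rw [e] at h1
  have h3 : 4 * Real.sinh (dist z (A • z) / 2) ^ 2 =
      ((c * (z.re ^ 2 - z.im ^ 2) + (d - a) * z.re - b) ^ 2 +
      (z.im * (2 * c * z.re + d - a)) ^ 2) / z.im ^ 2 := by
    have : 2 * Real.sinh (dist z (A • z) / 2) ^ 2 = _ := add_left_cancel h1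
    rw [show 4 * Real.sinh (dist z (A • z) / 2) ^ 2 =
      2 * (2 * Real.sinh (dist z (A • z) / 2) ^ 2) by ring, this]
    field_simp
  rw [h3, div_pow, div_eq_iff (by positivity), add_mul, div_mul_cancel₀ _ (by positivity)]
  linear_combination (-4) * z.im ^ 2 * hd

theorem le_translationLength {A : SL(2, ℝ)} {c : ℝ}
    (hc : 4 * Real.sinh (c / 2) ^ 2 ≤ tr A ^ 2 - 4) :
    c ≤ translationLength A := by
  refine le_ciInf fun z => ?_
  have h := sq_sinh_half_dist_smul A z
  have h1 : Real.sinh (c / 2) ^ 2 ≤ Real.sinh (dist z (A • z) / 2) ^ 2 := by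
    have := sq_nonneg ((A.val 1 0 * z.re ^ 2 + (A.val 1 1 - A.val 0 0) * z.re - A.val 0 1 +
        A.val 1 0 * z.im ^ 2) / z.im)
    linarith
  have h2 : 0 ≤ Real.sinh (dist z (A • z) / 2) := Real.sinh_nonneg_iff.2 (by positivity)
  have h3 := abs_le_of_sq_le_sq h1 h2
  have := Real.sinh_le_sinh.1 ((le_abs_self _).trans h3)
  linarith

theorem translationLength_nonneg (A : SL(2, ℝ)) : 0 ≤ translationLength A :=
  Real.iInf_nonneg fun _ => dist_nonneg

theorem translationLength_le {A : SL(2, ℝ)} {c : ℝ} (hc0 : 0 ≤ c) (h : 2 < |tr A|)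
    (hc : tr A ^ 2 - 4 ≤ 4 * Real.sinh (c / 2) ^ 2) : translationLength A ≤ c := by
  have hpos := sq_sub_four_pos h
  obtain ⟨z, hz⟩ : ∃ z : UpperHalfPlane, A.val 1 0 * z.re ^ 2 + (A.val 1 1 - A.val 0 0) * z.re -
      A.val 0 1 + A.val 1 0 * z.im ^ 2 = 0 := by
    have hd := det_entries A
    rw [tr_def] at hpos
    set a := A.val 0 0
    set b := A.val 0 1
    set c := A.val 1 0
    set d := A.val 1 1
    -- A point of the axis: on the vertical line above the finite fixed point if `c = 0`, otherwise
    -- the top of the half-circle through the two fixed points.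
    by_cases hc : c = 0
    · have hne : d - a ≠ 0 := by
        intro h0
        rw [hc] at hd
        have : d = a := by linarith
        rw [this] at hd hpos
        nlinarith
      refine ⟨⟨⟨b / (d - a), 1⟩, by simp⟩, ?_⟩
      show c * (b / (d - a)) ^ 2 + (d - a) * (b / (d - a)) - b + c * 1 ^ 2 = 0
      rw [hc]
      field_simp
      ring
    · have hs := Real.sqrt_pos.2 hpos
      have hsq := Real.sq_sqrt hpos.le
      refine ⟨⟨⟨(a - d) / (2 * c), Real.sqrt ((a + d) ^ 2 - 4) / (2 * |c|)⟩, by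
        have := abs_pos.2 hc
        show 0 < Real.sqrt ((a + d) ^ 2 - 4) / (2 * |c|)
        positivity⟩, ?_⟩
      show c * ((a - d) / (2 * c)) ^ 2 + (d - a) * ((a - d) / (2 * c)) - b +
        c * (Real.sqrt ((a + d) ^ 2 - 4) / (2 * |c|)) ^ 2 = 0
      rw [div_pow (Real.sqrt _), hsq, mul_pow, sq_abs]
      field_simp
      linear_combination 4 * hd
  have h1 := sq_sinh_half_dist_smul A z
  rw [hz, zero_div] at h1
  have h2 : Real.sinh (dist z (A • z) / 2) ^ 2 ≤ Real.sinh (c / 2) ^ 2 := by linarith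
  have h3 : 0 ≤ Real.sinh (c / 2) := Real.sinh_nonneg_iff.2 (by positivity)
  have h4 := (le_abs_self _).trans (abs_le_of_sq_le_sq h2 h3)
  have h5 := Real.sinh_le_sinh.1 h4
  refine (ciInf_le ⟨0, ?_⟩ z).trans (by linarith)
  rintro _ ⟨w, rfl⟩
  exact dist_nonneg

/-! ### Compactness -/

theorem tr_nfHom_genA (p : Triples) : tr (nfHom p genA) = p.1.1 := by
  rw [nfHom_genA, tr_def]
  simp [nfGenA, nfA]

theorem tr_nfHom_cusp (p : Triples) : tr (nfHom p cusp) = -2 := by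
  have hy : p.1.2.1 ≠ 0 := p.2.2.1.ne'
  have h3 : tr (nfGenA p * nfGenB p) = p.1.2.2 := by
    rw [tr_def, Matrix.SpecialLinearGroup.coe_mul]
    simp only [nfGenA, nfGenB, nfA, nfB, Matrix.mul_apply, Fin.sum_univ_two]
    simp
    field_simp
  have h2 : tr (nfGenB p) = p.1.2.1 := by
    rw [tr_def]
    simp [nfGenB, nfB]
  have h1 := tr_nfHom_genA p
  rw [nfHom_genA] at h1
  rw [map_cusp, nfHom_genA, nfHom_genB, tr_commutator, h1, h2, h3]
  have := p.2.2.2.2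
  linarith

theorem tr_nfHom_genA_ne_zero (p : Triples) : tr (nfHom p genA) ≠ 0 := by
  rw [tr_nfHom_genA]
  exact p.2.1.ne'

/-- Conjugation by the reflection `z ↦ -z̄`. -/
def mirror : SL(2, ℝ) →* SL(2, ℝ) where
  toFun A := ⟨!![A.val 0 0, -A.val 0 1; -A.val 1 0, A.val 1 1], by
    rw [Matrix.det_fin_two_of]; linear_combination det_entries A⟩
  map_one' := by
    ext i j
    fin_cases i <;> fin_cases j <;> simp
  map_mul' A B := by
    apply Subtype.ext
    show !![(A.val * B.val) 0 0, -(A.val * B.val) 0 1; -(A.val * B.val) 1 0, (A.val * B.val) 1 1] =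
      !![A.val 0 0, -A.val 0 1; -A.val 1 0, A.val 1 1] *
        !![B.val 0 0, -B.val 0 1; -B.val 1 0, B.val 1 1]
    ext i j
    fin_cases i <;> fin_cases j <;> simp [Matrix.mul_apply, Fin.sum_univ_two] <;> ring

theorem mirror_val (A : SL(2, ℝ)) :
    (mirror A).val = !![A.val 0 0, -A.val 0 1; -A.val 1 0, A.val 1 1] := rfl

theorem tr_mirror (A : SL(2, ℝ)) : tr (mirror A) = tr A := by
  rw [tr_def, tr_def, mirror_val]
  simp

theorem mul_mirror (A : SL(2, ℝ)) :
    !![(1 : ℝ), 0; 0, -1] * (mirror A).val = A.val * !![(1 : ℝ), 0; 0, -1] := by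
  rw [mirror_val]
  ext i j
  fin_cases i <;> fin_cases j <;> simp [Matrix.mul_apply, Fin.sum_univ_two]

theorem continuous_specialLinearGroup {T : Type*} [TopologicalSpace T] {f : T → SL(2, ℝ)}
    (h : ∀ i j, Continuous fun t => (f t).val i j) : Continuous f :=
  continuous_induced_rng.2 (continuous_matrix h)

theorem continuous_mirror : Continuous mirror := by
  refine continuous_specialLinearGroup fun i j => ?_
  have h : ∀ i j, Continuous fun A : SL(2, ℝ) => A.val i j := fun i j =>
    continuous_subtype_val.matrix_elem i j
  simp only [mirror_val]
  fin_cases i <;> fin_cases j <;> simp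
  · exact h 0 0
  · exact (h 0 1).neg
  · exact (h 1 0).neg
  · exact h 1 1

theorem continuous_nfHom (g : Pi1) : Continuous fun p => nfHom p g := by
  have hA : Continuous nfGenA := by
    refine continuous_specialLinearGroup fun i j => ?_
    have h : ∀ p : Triples, p.1.2.1 ≠ 0 := fun p => p.2.2.1.ne'
    fin_cases i <;> fin_cases j <;> simp [nfGenA, nfA] <;> fun_prop (disch := exact h)
  have hB : Continuous nfGenB := by
    refine continuous_specialLinearGroup fun i j => ?_
    fin_cases i <;> fin_cases j <;> simp [nfGenB, nfB] <;> fun_prop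
  have hgen : ∀ i, Continuous fun p => nfHom p (FreeGroup.of i) := by
    intro i
    fin_cases i
    · simpa [nfHom] using hA
    · simpa [nfHom] using hB
  induction g using FreeGroup.induction_on with
  | C1 => simpa using continuous_const
  | of i => exact hgen i
  | inv_of i h => simp only [map_inv]; exact continuous_inv.comp h
  | mul a b ha hb => simp only [map_mul]; exact ha.mul hb

/-- The representation in normal form, or its mirror image. -/
noncomputable def nfRep (m : Bool) (p : Triples) : FuchsianRep :=
  cond m (mkRep (mirror.comp (nfHom p)) (by rw [MonoidHom.comp_apply, tr_mirror, tr_nfHom_cusp])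
      (by rw [MonoidHom.comp_apply, tr_mirror]; exact tr_nfHom_genA_ne_zero p))
    (mkRep (nfHom p) (tr_nfHom_cusp p) (tr_nfHom_genA_ne_zero p))

theorem continuous_nfRep (m : Bool) : Continuous (nfRep m) := by
  refine continuous_induced_rng.2 (continuous_pi fun g => ?_)
  cases m
  · exact continuous_nfHom g
  · exact continuous_mirror.comp (continuous_nfHom g)

theorem projConj_of_mul_eq {ρ σ : Pi1 →* SL(2, ℝ)} {M : Matrix (Fin 2) (Fin 2) ℝ} (hM : 0 < M.det)
    (h : ∀ g, (ρ g).val * M = M * (σ g).val ∨ (ρ g).val * M = -(M * (σ g).val)) : ProjConj σ ρ := by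
  have hs := Real.sqrt_pos.2 hM
  have hsq := Real.sq_sqrt hM.le
  let C : SL(2, ℝ) := ⟨(Real.sqrt M.det)⁻¹ • M, by
    rw [Matrix.det_smul, Fintype.card_fin, inv_pow, hsq, inv_mul_cancel₀ hM.ne']⟩
  refine ⟨C, fun g => ?_⟩
  rcases h g with h | h
  · left
    rw [eq_mul_inv_iff_mul_eq]
    apply Subtype.ext
    show (ρ g).val * ((Real.sqrt M.det)⁻¹ • M) = ((Real.sqrt M.det)⁻¹ • M) * (σ g).val
    rw [Matrix.mul_smul, h, Matrix.smul_mul]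
  · right
    rw [← neg_mul, eq_mul_inv_iff_mul_eq]
    apply Subtype.ext
    rw [Matrix.SpecialLinearGroup.coe_mul, Matrix.SpecialLinearGroup.coe_neg]
    show (ρ g).val * ((Real.sqrt M.det)⁻¹ • M) = -(((Real.sqrt M.det)⁻¹ • M) * (σ g).val)
    rw [Matrix.mul_smul, h, Matrix.smul_mul, smul_neg]

/-- A conjugating matrix of negative determinant is composed with a reflection, at the price of
passing to the mirror image. These are the two copies of the usual Teichmüller space. -/
theorem exists_mk_eq_nfRep (ρ : FuchsianRep) :
    ∃ m, Teich.mk (nfRep m (absTriple ρ.tr_cusp ρ.tr_genA_ne_zero)) = Teich.mk ρ := by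
  obtain ⟨M, hM, h⟩ := exists_conj_nfHom ρ.tr_cusp ρ.tr_genA_ne_zero
  rcases hM.lt_or_gt with hneg | hpos
  · refine ⟨true, Quotient.sound (projConj_of_mul_eq (M := M * !![(1 : ℝ), 0; 0, -1]) ?_
      fun g => ?_)⟩
    · rw [Matrix.det_mul, Matrix.det_fin_two_of]; linarith
    · show _ = (M * _) * (mirror _).val ∨ _ = -((M * _) * (mirror _).val)
      rw [Matrix.mul_assoc, mul_mirror, ← Matrix.mul_assoc, ← Matrix.mul_assoc]
      rcases h g with h | h
      · left; rw [h]
      · right; rw [h, Matrix.neg_mul]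
  · exact ⟨false, Quotient.sound (projConj_of_mul_eq hpos h)⟩

/-- The traces at most `M`. -/
def box (M : ℝ) : Set Triples := {p | p.1.1 ≤ M ∧ p.1.2.1 ≤ M ∧ p.1.2.2 ≤ M}

/-- Every positive solution has coordinates larger than `2`, so positivity may be replaced by the
closed condition `2 ≤ x, y, z`. -/
theorem isCompact_box (M : ℝ) : IsCompact (box M) := by
  rw [Subtype.isCompact_iff]
  have : Subtype.val '' box M = Set.Icc ((2 : ℝ), (2 : ℝ), (2 : ℝ)) (M, M, M) ∩
      {p | p.1 ^ 2 + p.2.1 ^ 2 + p.2.2 ^ 2 = p.1 * p.2.1 * p.2.2} := by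
    ext ⟨x, y, z⟩
    constructor
    · rintro ⟨⟨p, hp⟩, ⟨h1, h2, h3⟩, rfl⟩
      have hx := two_lt_of_mem_triples hp
      have hy := two_lt_of_mem_triples (x := y) (y := x) (z := z)
        ⟨hp.2.1, hp.1, hp.2.2.1, by have := hp.2.2.2; simp only at this ⊢; linarith⟩
      have hz := two_lt_of_mem_triples (x := z) (y := x) (z := y)
        ⟨hp.2.2.1, hp.1, hp.2.1, by have := hp.2.2.2; simp only at this ⊢; linarith⟩
      exact ⟨⟨⟨hx.le, hy.le, hz.le⟩, ⟨h1, h2, h3⟩⟩, hp.2.2.2⟩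
    · rintro ⟨⟨⟨h1, h2, h3⟩, ⟨h4, h5, h6⟩⟩, h7⟩
      simp only at h1 h2 h3
      exact ⟨⟨(x, y, z), by simp only; linarith, by simp only; linarith,
          by simp only; linarith, h7⟩,
        ⟨h4, h5, h6⟩, rfl⟩
  rw [this]
  exact isCompact_Icc.inter_right (isClosed_eq (by fun_prop) (by fun_prop))

/-- The points of Teichmüller space where the traces of `a`, `b`, `a b` are at most `M`. -/
def teichBox (M : ℝ) : Set Teich := ⋃ m, (fun p => Teich.mk (nfRep m p)) '' box M

theorem continuous_mk : Continuous Teich.mk := continuous_quotient_mk'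

theorem isCompact_teichBox (M : ℝ) : IsCompact (teichBox M) :=
  isCompact_iUnion fun m =>
    (isCompact_box M).image (continuous_mk.comp (continuous_nfRep m))

theorem Teich.mem_teichBox {X : Teich} {M : ℝ} (hA : X.trc genA ≤ M) (hB : X.trc genB ≤ M)
    (hAB : X.trc (genA * genB) ≤ M) : X ∈ teichBox M := by
  obtain ⟨ρ, rfl⟩ := X.exists_rep
  obtain ⟨m, hm⟩ := exists_mk_eq_nfRep ρ
  exact Set.mem_iUnion.2 ⟨m, _, ⟨hA, hB, hAB⟩, hm⟩

/-! ### Existence of earthquakes -/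

theorem twist_trc_le {X Y : Teich} {γ : SimpleCurve} {w t : ℝ} (hw : 0 ≤ w)
    (h : IsTwist X γ (w * t) Y) (δ : SimpleCurve) :
    Y.trc δ.1 ≤ Real.exp (weightedCurve w γ δ / 2 * |t|) * X.trc δ.1 := by
  obtain ⟨f, h1, h2, -, -⟩ := exists_twist_profile X γ.prim δ.prim
  rw [← Y.m_cls, ← X.m_cls, h2 γ _ Y rfl h, h2 γ _ X rfl (IsTwist.refl X γ)]
  have := h1.le_exp_mul 0 (w * t)
  rw [zero_add, abs_mul, abs_of_nonneg hw] at this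
  rw [weightedCurve, inter_eq]
  convert this using 3
  ring

/-- At a fixed time the traces of `a`, `b`, `ab` after the twists are eventually bounded, by
`twist_trc_le`, so the twisted surfaces stay in a compact set. -/
theorem exists_isEarthquake (X : Teich) {l : SimpleCurve → ℝ} (hl : l ∈ ML) :
    ∃ E : ℝ → Teich, IsEarthquake X l E := by
  let W : ℝ × SimpleCurve → SimpleCurve → ℝ := fun p => weightedCurve p.1 p.2
  let G : Filter (ℝ × SimpleCurve) := comap W (𝓝 l) ⊓ 𝓟 {p | 0 ≤ p.1}
  have hG : G.NeBot := by
    refine inf_principal_neBot_iff.2 ?_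
    rintro U ⟨V, hV, hVU⟩
    obtain ⟨_, hx, w, hw, γ, rfl⟩ := mem_closure_iff_nhds.1 hl V hV
    exact ⟨(w, γ), hVU hx, hw⟩
  -- An ultrafilter gives convergence at all times along one and the same filter, without extracting
  -- subsequences.
  let F : Ultrafilter (ℝ × SimpleCurve) := Ultrafilter.of G
  have hFG : (F : Filter (ℝ × SimpleCurve)) ≤ G := Ultrafilter.of_le G
  have hpos : ∀ᶠ p in (F : Filter (ℝ × SimpleCurve)), 0 ≤ p.1 :=
    (hFG.trans inf_le_right) (mem_principal_self _)
  have hW : Tendsto W F (𝓝 l) := (tendsto_comap.mono_left inf_le_left).mono_left hFG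
  choose Y hY using fun (p : ℝ × SimpleCurve) (t : ℝ) => exists_isTwist X p.2 (p.1 * t)
  have hbound : ∀ (δ : SimpleCurve) t, ∃ M, ∀ᶠ p in (F : Filter (ℝ × SimpleCurve)),
      (Y p t).trc δ.1 ≤ M := by
    intro δ t
    refine ⟨Real.exp ((l δ + 1) / 2 * |t|) * X.trc δ.1, ?_⟩
    have h1 : ∀ᶠ p in (F : Filter (ℝ × SimpleCurve)), W p δ < l δ + 1 :=
      (tendsto_pi_nhds.1 hW δ).eventually_lt_const (lt_add_one _)
    filter_upwards [hpos, h1] with p hp h1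
    refine (twist_trc_le hp (hY p t) δ).trans ?_
    have h0 : 0 ≤ X.trc δ.1 := by
      rw [← X.m_cls]
      have := X.two_lt_m δ.prim
      linarith
    have : weightedCurve p.1 p.2 δ ≤ l δ + 1 := h1.le
    gcongr
  have hlim : ∀ t, ∃ Z, Tendsto (fun p => Y p t) F (𝓝 Z) := by
    intro t
    obtain ⟨M₁, h₁⟩ := hbound ⟨genA, 1, MCG.one_mem, rfl⟩ t
    obtain ⟨M₂, h₂⟩ := hbound ⟨genB, autS, autS_mem, autS_genA⟩ t
    obtain ⟨M₃, h₃⟩ := hbound ⟨genA * genB, autV, autV_mem, autV_genA⟩ t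
    have hmem : ∀ᶠ p in (F : Filter (ℝ × SimpleCurve)),
        Y p t ∈ teichBox (max M₁ (max M₂ M₃)) := by
      filter_upwards [h₁, h₂, h₃] with p h₁ h₂ h₃
      exact Teich.mem_teichBox (h₁.trans (le_max_left _ _))
        (h₂.trans ((le_max_left _ _).trans (le_max_right _ _)))
        (h₃.trans ((le_max_right _ _).trans (le_max_right _ _)))
    obtain ⟨Z, -, hZ⟩ := (isCompact_teichBox _).ultrafilter_le_nhds (F.map fun p => Y p t)
      (le_principal_iff.2 hmem)
    exact ⟨Z, hZ⟩
  choose E hE using hlim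
  exact ⟨E, F, Y, inferInstance, hpos, hW, hY, hE⟩

/-! ### Reduced bases -/

/-- The trace of `v + k u` grows with `|k|`, because this class crosses `v` exactly `|k|` times. So
only finitely many `k` compete for the minimum. -/
theorem Teich.exists_minimal (X : Teich) {u : ℤ × ℤ} (hu : Prim u) :
    ∃ v, cross u v = 1 ∧ X.m v ≤ X.m (u + v) ∧ X.m v ≤ X.m (u - v) := by
  obtain ⟨v, hv⟩ := hu
  have hk : ∀ k : ℤ, cross u (v + k • u) = 1 := by
    intro k
    simp only [cross] at hv ⊢
    simp
    linear_combination hv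
  set c := 4 / (X.m v ^ 2 - 4) with hc
  have hc0 : 0 < c := by
    have := X.two_lt_m (prim_right hv)
    have : 0 < X.m v ^ 2 - 4 := by nlinarith
    positivity
  have hgrow : ∀ k : ℤ, 4 * (1 + k.natAbs * c) ≤ X.m (v + k • u) ^ 2 := by
    intro k
    obtain ⟨-, -, -, -, h⟩ := exists_twist_profile X (prim_right hv) (prim_right (hk k))
    have e : (cross v (v + k • u)).natAbs = k.natAbs := by
      have : cross v (v + k • u) = -k := by
        simp only [cross] at hv ⊢
        simp
        linear_combination -k * hv
      rw [this, Int.natAbs_neg]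
    rw [e] at h
    have := one_add_mul_le_pow (a := c) (by linarith) k.natAbs
    linarith
  set s : Set ℤ := {k | X.m (v + k • u) ≤ X.m v} with hs
  have hfin : s.Finite := by
    obtain ⟨N, hN⟩ := exists_nat_ge (X.m v ^ 2 / c)
    refine (Set.finite_Icc (-(N : ℤ)) N).subset fun k hkm => ?_
    have h1 := hgrow k
    have h2 : X.m (v + k • u) ^ 2 ≤ X.m v ^ 2 := by
      have := X.two_lt_m (prim_right (hk k))
      exact pow_le_pow_left₀ (by linarith) hkm 2
    have h3 : (k.natAbs : ℝ) ≤ N := by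
      refine le_trans ?_ hN
      rw [le_div_iff₀ hc0]
      have : 0 ≤ (k.natAbs : ℝ) * c := by positivity
      linarith
    have h4 : k.natAbs ≤ N := by exact_mod_cast h3
    rw [Set.mem_Icc]
    omega
  obtain ⟨k, hks, hmin⟩ := s.exists_min_image (fun k => X.m (v + k • u)) hfin ⟨0, by simp [hs]⟩
  have hall : ∀ j : ℤ, X.m (v + k • u) ≤ X.m (v + j • u) := by
    intro j
    by_cases hj : j ∈ s
    · exact hmin j hj
    · have h1 : X.m (v + k • u) ≤ X.m v := hks
      have h2 : X.m v < X.m (v + j • u) := not_le.1 hj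
      exact h1.trans h2.le
  refine ⟨v + k • u, hk k, ?_, ?_⟩
  · convert hall (k + 1) using 2
    rw [add_smul, one_smul]; abel
  · rw [← X.m_neg (u - _)]
    convert hall (k - 1) using 2
    rw [sub_smul, one_smul]; abel

/-- A bound for the traces of a reduced basis that contains a curve of trace `x`. -/
noncomputable def reducedBound (x : ℝ) : ℝ := x + (1 + x) * (x ^ 2 / (x - 2))

/-- For minimal `v` both `m (u + v)` and `m (u - v)` are at least `y = m v`. Their sum is `xy` and
their product `x² + y²`, so `(x - 2) y² ≤ x²`. -/
theorem Teich.exists_reduced (X : Teich) {u : ℤ × ℤ} (hu : Prim u) :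
    ∃ v, cross u v = 1 ∧ X.m u ≤ reducedBound (X.m u) ∧ X.m v ≤ reducedBound (X.m u) ∧
      X.m (u + v) ≤ reducedBound (X.m u) := by
  obtain ⟨v, hv, h1, h2⟩ := X.exists_minimal hu
  have hx := X.two_lt_m hu
  have hy := X.two_lt_m (prim_right hv)
  have hz := X.two_lt_m (prim_add hv)
  have hz' := X.two_lt_m (prim_sub hv)
  have hr := X.m_markov hv
  have hs := X.m_add_m_sub hv
  refine ⟨v, hv, ?_⟩
  rw [reducedBound]
  generalize X.m u = x at *
  generalize X.m v = y at *
  generalize X.m (u + v) = z at *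
  generalize X.m (u - v) = z' at *
  have hq : y ≤ x ^ 2 / (x - 2) := by
    rw [le_div_iff₀ (by linarith)]
    have h3 := mul_nonneg (sub_nonneg.2 h1) (sub_nonneg.2 h2)
    have h4 : z * z' = x ^ 2 + y ^ 2 := by linear_combination z * hs - hr
    have h5 : y ^ 2 * (x - 2) ≤ x ^ 2 := by
      have : (z - y) * (z' - y) = x ^ 2 - y ^ 2 * (x - 2) := by linear_combination h4 - y * hs
      linarith
    -- Using `y ≤ y²` avoids a square root in the bound.
    have h6 : y * (x - 2) ≤ y ^ 2 * (x - 2) :=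
      mul_le_mul_of_nonneg_right (by nlinarith) (by linarith)
    linarith
  have hxq := mul_le_mul_of_nonneg_left hq (show 0 ≤ x by linarith)
  have hq0 : 0 < x ^ 2 / (x - 2) := by linarith
  have hxq0 : 0 < x * (x ^ 2 / (x - 2)) := mul_pos (by linarith) hq0
  exact ⟨by linarith, by linarith, by linarith⟩

/-! ### Moduli space -/

theorem continuous_toModuli : Continuous Teich.toModuli :=
  continuous_quot_lift _ continuous_quotient_mk'

theorem toModuli_precomp (ρ : FuchsianRep) {φ : MulAut Pi1} (hφ : φ ∈ MCG) :
    (Teich.mk ρ).toModuli = (Teich.mk (ρ.precomp hφ)).toModuli :=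
  Quotient.sound (s := moduliSetoid) ⟨φ, hφ, ProjConj.refl _⟩

theorem exists_of_toModuli_eq {ρ σ : FuchsianRep}
    (h : (Teich.mk ρ).toModuli = (Teich.mk σ).toModuli) :
    ∃ φ ∈ MCG, ∀ g, (Teich.mk σ).trc g = (Teich.mk ρ).trc (φ g) := by
  obtain ⟨φ, hφ, h⟩ := Quotient.exact (s := moduliSetoid) h
  exact ⟨φ, hφ, fun g => (h.abs_tr g).symm⟩

section Basis

variable {X : Teich} {u v : ℤ × ℤ} {M : ℝ}

theorem Teich.toModuli_mem (h : cross u v = 1) (hu : X.m u ≤ M) (hv : X.m v ≤ M)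
    (huv : X.m (u + v) ≤ M) : X.toModuli ∈ Teich.toModuli '' teichBox M := by
  obtain ⟨φ, hφ, rfl, rfl⟩ := exists_basis_of_cross h
  obtain ⟨ρ, rfl⟩ := X.exists_rep
  rw [m_homCls _ hφ] at hu
  rw [m_genB _ hφ] at hv
  rw [m_add _ hφ] at huv
  exact ⟨Teich.mk (ρ.precomp hφ), Teich.mem_teichBox hu hv huv, (toModuli_precomp ρ hφ).symm⟩

theorem Teich.trc_gap (h : cross u v = 1) (hu : X.m u ≤ M) (hv : X.m v ≤ M)
    (huv : X.m (u + v) ≤ M) (g : Pi1) :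
    X.trc g ^ 2 = 4 ∨ 4 + 4 / (M ^ 2) ^ 2 ≤ X.trc g ^ 2 := by
  obtain ⟨φ, hφ, rfl, rfl⟩ := exists_basis_of_cross h
  obtain ⟨ρ, rfl⟩ := X.exists_rep
  rw [m_homCls _ hφ] at hu
  rw [m_genB _ hφ] at hv
  rw [m_add _ hφ] at huv
  have e := abs_tr_eq_nfHom (tr_comp_cusp ρ hφ) (tr_comp_genA_ne_zero ρ φ) (φ⁻¹ g)
  have e' : (ρ.toHom.comp φ.toMonoidHom) (φ⁻¹ g) = ρ.toHom g := by
    show ρ.toHom (φ (φ⁻¹ g)) = _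
    rw [MulAut.apply_inv_self]
  rw [e'] at e
  rw [trc_mk, e, sq_abs]
  exact tr_sq_gap _ (parBound_of_le _ hu hv huv) _

end Basis

/-! ### An exhaustion of moduli space by open sets with traces bounded away from `2` -/

theorem cross_one_zero_eq_zero {v : ℤ × ℤ} (hv : Prim v) (h : cross (1, 0) v = 0) :
    v = (1, 0) ∨ v = -(1, 0) := by
  obtain ⟨r, hr⟩ := hv
  obtain ⟨a, b⟩ := v
  simp only [cross] at h hr
  have hb : b = 0 := by linarith
  subst hb
  rw [zero_mul, sub_zero] at hr
  rcases Int.eq_one_or_neg_one_of_mul_eq_one hr with rfl | rfl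
  · exact Or.inl rfl
  · exact Or.inr rfl

/-- The part of moduli space where some simple closed curve has trace between `2 + 1 / (n + 1)`
and `n`. -/
def thick (n : ℕ) : Set Moduli :=
  {q | ∃ X : Teich, X.toModuli = q ∧ 2 + 1 / ((n : ℝ) + 1) < X.trc genA ∧ X.trc genA < n}

/-- The preimage in the space of representations is a union over the mapping classes of open
conditions on one trace. -/
theorem isOpen_thick (n : ℕ) : IsOpen (thick n) := by
  have h : (Quotient.mk moduliSetoid) ⁻¹' thick n = ⋃ φ ∈ MCG, {ρ : FuchsianRep |
      2 + 1 / ((n : ℝ) + 1) < |tr (ρ.toHom (φ genA))| ∧ |tr (ρ.toHom (φ genA))| < n} := by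
    ext ρ
    simp only [Set.mem_iUnion]
    constructor
    · rintro ⟨X, hX, h1, h2⟩
      obtain ⟨σ, rfl⟩ := X.exists_rep
      obtain ⟨φ, hφ, h⟩ := exists_of_toModuli_eq (ρ := ρ) (σ := σ) hX.symm
      rw [h] at h1 h2
      exact ⟨φ, hφ, h1, h2⟩
    · rintro ⟨φ, hφ, h1, h2⟩
      exact ⟨Teich.mk (ρ.precomp hφ), (toModuli_precomp ρ hφ).symm, h1, h2⟩
  refine isQuotientMap_quot_mk.isOpen_preimage.1
    (?_ : IsOpen ((Quotient.mk moduliSetoid) ⁻¹' thick n))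
  rw [h]
  refine isOpen_biUnion fun φ _ => ?_
  have hc : Continuous fun ρ : FuchsianRep => |tr (ρ.toHom (φ genA))| :=
    (continuous_tr.comp (continuous_toHom _)).abs
  exact (isOpen_lt continuous_const hc).inter (isOpen_lt hc continuous_const)

theorem thick_mono : Monotone thick := by
  rintro m n hmn q ⟨X, hX, h1, h2⟩
  have h : (m : ℝ) ≤ n := by exact_mod_cast hmn
  refine ⟨X, hX, lt_of_le_of_lt ?_ h1, h2.trans_le h⟩
  gcongr

theorem iUnion_thick : ⋃ n, thick n = Set.univ := by
  refine Set.eq_univ_of_forall fun q => ?_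
  obtain ⟨ρ, rfl⟩ := Quotient.exists_rep q
  have h2 : 2 < (Teich.mk ρ).trc genA := two_lt_abs_tr ρ MCG.one_mem
  obtain ⟨a, ha⟩ := exists_nat_gt ((Teich.mk ρ).trc genA)
  obtain ⟨b, hb⟩ := exists_nat_one_div_lt (sub_pos.2 h2)
  refine Set.mem_iUnion.2 ⟨max a b, Teich.mk ρ, rfl, ?_, ?_⟩
  · have : 1 / (((max a b : ℕ) : ℝ) + 1) ≤ 1 / ((b : ℝ) + 1) := by
      have : (b : ℝ) ≤ (max a b : ℕ) := by exact_mod_cast le_max_right a b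
      gcongr
    linarith
  · exact ha.trans_le (by exact_mod_cast le_max_left a b)

/-- A collar argument: a curve crossing one of trace `x` has squared trace at least `4 (1 + 4 / (x²
- 4))`, and a curve that does not cross it is that curve itself. -/
theorem trace_ge_of_mem_thick {n : ℕ} {X : Teich} (hX : X.toModuli ∈ thick n) {u : ℤ × ℤ}
    (hu : Prim u) : 2 + 1 / ((n : ℝ) + 1) ^ 2 ≤ X.m u := by
  obtain ⟨Z, hZ, h1, h2⟩ := hX
  have key : ∀ v, Prim v → 2 + 1 / ((n : ℝ) + 1) ^ 2 ≤ Z.m v := by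
    intro v hv
    have hmA : Z.m (1, 0) = Z.trc genA := Z.m_cls ⟨genA, 1, MCG.one_mem, rfl⟩
    have hprim : Prim (1, 0) := ⟨(0, 1), by simp [cross]⟩
    rw [← hmA] at h1 h2
    have hx := Z.two_lt_m hprim
    have hn : (2 : ℝ) < n := hx.trans h2
    by_cases h0 : cross (1, 0) v = 0
    · have hm : Z.m v = Z.m (1, 0) := by
        rcases cross_one_zero_eq_zero hv h0 with rfl | rfl
        · rfl
        · exact Z.m_neg _
      rw [hm]
      refine le_trans ?_ h1.le
      gcongr
      nlinarith
    · obtain ⟨-, -, -, -, h⟩ := exists_twist_profile Z hprim hv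
      have hv2 := Z.two_lt_m hv
      set x := Z.m (1, 0)
      have hx4 : 0 < x ^ 2 - 4 := by nlinarith
      have h3 : 1 + 4 / (x ^ 2 - 4) ≤ (1 + 4 / (x ^ 2 - 4)) ^ (cross (1, 0) v).natAbs := by
        refine le_self_pow₀ ?_ (Int.natAbs_ne_zero.2 h0)
        have : 0 < 4 / (x ^ 2 - 4) := by positivity
        linarith
      have h4 : 4 / ((n : ℝ) + 1) ^ 2 ≤ 4 / (x ^ 2 - 4) := by
        gcongr
        nlinarith
      set d := 1 / ((n : ℝ) + 1) ^ 2 with hd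
      have hd0 : 0 < d := by positivity
      have hd1 : d ≤ 1 := by
        rw [hd, div_le_one (by positivity)]
        nlinarith
      have h5 : 4 / ((n : ℝ) + 1) ^ 2 = 4 * d := by rw [hd]; ring
      refine abs_le_of_sq_le_sq' ?_ (by linarith) |>.2
      nlinarith
  obtain ⟨ρ, rfl⟩ := X.exists_rep
  obtain ⟨σ, rfl⟩ := Z.exists_rep
  obtain ⟨φ, hφ, h⟩ := exists_of_toModuli_eq hZ
  obtain ⟨ψ, hψ, rfl⟩ := hu.exists_mcg
  let δ : SimpleCurve := ⟨(φ * ψ) genA, φ * ψ, MCG.mul_mem hφ hψ, rfl⟩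
  have h3 := key _ δ.prim
  rw [Teich.m_cls] at h3
  rw [Teich.m_homCls _ hψ, h]
  exact h3

/-- A compact set lies in a single member of the increasing open cover by the sets `thick n`. -/
theorem exists_trace_ge_of_isCompact {K : Set Moduli} (hK : IsCompact K) :
    ∃ κ > 2, ∀ X : Teich, X.toModuli ∈ K → ∀ u, Prim u → κ ≤ X.m u := by
  obtain ⟨n, hn⟩ := hK.elim_directed_cover thick isOpen_thick (by rw [iUnion_thick]; simp)
    (thick_mono.directed_le)
  refine ⟨2 + 1 / ((n : ℝ) + 1) ^ 2, ?_, fun X hX u hu => trace_ge_of_mem_thick (hn hX) hu⟩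
  have : 0 < 1 / ((n : ℝ) + 1) ^ 2 := by positivity
  linarith

/-! ### The systole -/

theorem isHyperbolic_iff (A : SL(2, ℝ)) : A.val.IsHyperbolic ↔ 4 < tr A ^ 2 := by
  rw [Matrix.IsHyperbolic, Matrix.discr_fin_two, A.2, tr]
  constructor <;> intro h <;> linarith

theorem systole_nonneg (X : Teich) : 0 ≤ systole X := by
  refine Real.sInf_nonneg ?_
  rintro _ ⟨ρ, -, g, -, rfl⟩
  exact translationLength_nonneg _

theorem systole_le {X : Teich} {u : ℤ × ℤ} (hu : Prim u) {c : ℝ} (hc : 0 ≤ c)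
    (h : X.m u ^ 2 - 4 ≤ 4 * Real.sinh (c / 2) ^ 2) : systole X ≤ c := by
  obtain ⟨φ, hφ, rfl⟩ := hu.exists_mcg
  obtain ⟨ρ, rfl⟩ := X.exists_rep
  rw [Teich.m_homCls _ hφ, Teich.trc_mk, sq_abs] at h
  have h2 := two_lt_abs_tr ρ hφ
  have hpos := sq_sub_four_pos h2
  unfold systole
  refine le_trans (csInf_le ⟨0, ?_⟩ ⟨ρ, rfl, φ genA, (isHyperbolic_iff _).2 (by linarith), rfl⟩)
    (translationLength_le hc h2 h)
  rintro _ ⟨ρ, -, g, -, rfl⟩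
  exact translationLength_nonneg _

theorem le_systole {X : Teich} {c : ℝ}
    (h : ∀ g, X.trc g ^ 2 = 4 ∨ 4 + 4 * Real.sinh (c / 2) ^ 2 ≤ X.trc g ^ 2) : c ≤ systole X := by
  obtain ⟨σ, rfl⟩ := X.exists_rep
  -- `genA` shows that the set of lengths is non-empty; the infimum of the empty set would be the
  -- default value `0`.
  refine le_csInf ⟨_, σ, rfl, genA, (isHyperbolic_iff _).2 ?_, rfl⟩ ?_
  · have := sq_sub_four_pos (two_lt_abs_tr σ MCG.one_mem)
    simp only [MulAut.one_apply] at this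
    linarith
  · rintro _ ⟨ρ, hρ, g, hg, rfl⟩
    rw [isHyperbolic_iff] at hg
    have := h g
    rw [← hρ, Teich.trc_mk, sq_abs] at this
    refine le_translationLength ?_
    rcases this with h | h <;> linarith

/-! ### Trajectories in moduli space -/

section Trajectory

variable {X : Teich} {lam : ℝ × ℝ} {E : ℝ → Teich}

/-- With exponent `0` the growth estimate forbids any increase of the trace, forwards and backwards
in time. -/
theorem IsEarthquake.m_eq_of_pair_eq_zero (hE : IsEarthquake X (lamOf lam) E) {u : ℤ × ℤ}
    (hu : Prim u) (h : pair lam u = 0) (t : ℝ) : (E t).m u = (E 0).m u := by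
  obtain ⟨-, -, h3, -⟩ := hE.estimates hu
  rw [h] at h3
  simp only [abs_zero, zero_div, zero_mul, Real.exp_zero, one_mul] at h3
  have h1 := h3 0 t
  have h2 := h3 t (-t)
  rw [zero_add] at h1
  rw [add_neg_cancel] at h2
  exact le_antisymm h1 h2

theorem IsEarthquake.exists_bounded_basis (hE : IsEarthquake X (lamOf lam) E) (h : ¬ Irr lam) :
    ∃ M > 0, ∀ t, ∃ u v, cross u v = 1 ∧ (E t).m u ≤ M ∧ (E t).m v ≤ M ∧ (E t).m (u + v) ≤ M := by
  unfold Irr at h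
  push Not at h
  obtain ⟨u, hu, h0⟩ := h
  refine ⟨reducedBound ((E 0).m u), ?_, fun t => ?_⟩
  · obtain ⟨v, -, h1, -⟩ := (E 0).exists_reduced hu
    have := (E 0).two_lt_m hu
    linarith
  · rw [← hE.m_eq_of_pair_eq_zero hu h0 t]
    obtain ⟨v, hv⟩ := (E t).exists_reduced hu
    exact ⟨u, v, hv⟩

theorem IsEarthquake.exists_isCompact (hE : IsEarthquake X (lamOf lam) E) (h : ¬ Irr lam) :
    ∃ K : Set Moduli, IsCompact K ∧ ∀ t, (E t).toModuli ∈ K := by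
  obtain ⟨M, -, hM⟩ := hE.exists_bounded_basis h
  refine ⟨Teich.toModuli '' teichBox M, (isCompact_teichBox M).image continuous_toModuli,
    fun t => ?_⟩
  obtain ⟨u, v, huv, h1, h2, h3⟩ := hM t
  exact Teich.toModuli_mem huv h1 h2 h3

theorem IsEarthquake.exists_le_systole (hE : IsEarthquake X (lamOf lam) E) (h : ¬ Irr lam) :
    ∃ c > 0, ∀ t, c ≤ systole (E t) := by
  obtain ⟨M, hM0, hM⟩ := hE.exists_bounded_basis h
  have hpos : 0 < 1 / M ^ 2 := by positivity
  -- For this length `c` the quantity `4 sinh² (c / 2)` is exactly the gap `4 / (M²)²` of the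
  -- squared traces above `4`.
  refine ⟨2 * Real.arsinh (1 / M ^ 2), by
    have := Real.arsinh_pos_iff.2 hpos
    linarith, fun t => le_systole fun g => ?_⟩
  obtain ⟨u, v, huv, h1, h2, h3⟩ := hM t
  rw [mul_div_cancel_left₀ _ two_ne_zero, Real.sinh_arsinh]
  have := Teich.trc_gap huv h1 h2 h3 g
  rwa [div_pow, one_pow, mul_one_div]

theorem IsEarthquake.exists_systole_le (hE : IsEarthquake X (lamOf lam) E) (h : Irr lam) {c : ℝ}
    (hc : 0 < c) (T : ℝ) : ∃ t ≥ T, systole (E t) ≤ c := by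
  have hs : 0 < Real.sinh (c / 2) := Real.sinh_pos_iff.2 (by linarith)
  -- This is the trace of a curve of length `c`.
  have hκ : 2 < Real.sqrt (4 + 4 * Real.sinh (c / 2) ^ 2) := by
    refine Real.lt_sqrt_of_sq_lt ?_
    nlinarith [pow_pos hs 2]
  obtain ⟨t, ht, u, hu, hlt⟩ := (hE.flow h).exists_short h hκ T
  refine ⟨t, ht, systole_le hu hc.le ?_⟩
  have := (E t).two_lt_m hu
  have := (Real.lt_sqrt (by linarith)).1 hlt
  linarith

theorem IsEarthquake.irr_iff_liminf (hE : IsEarthquake X (lamOf lam) E) :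
    ¬ Irr lam ↔ liminf (fun t : ℝ => (systole (E t) : EReal)) atTop ≠ 0 := by
  constructor
  · intro h
    obtain ⟨c, hc, h⟩ := hE.exists_le_systole h
    have h1 : (c : EReal) ≤ liminf (fun t : ℝ => (systole (E t) : EReal)) atTop :=
      le_liminf_of_le (by isBoundedDefault)
        (Eventually.of_forall fun t => EReal.coe_le_coe_iff.2 (h t))
    exact ((EReal.coe_pos.2 hc).trans_le h1).ne'
  · intro hne h
    have h0 : 0 ≤ liminf (fun t : ℝ => (systole (E t) : EReal)) atTop :=
      le_liminf_of_le (by isBoundedDefault)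
        (Eventually.of_forall fun t => EReal.coe_nonneg.2 (systole_nonneg _))
    obtain ⟨c, hc0, hc⟩ := EReal.lt_iff_exists_real_btwn.1 (lt_of_le_of_ne h0 hne.symm)
    obtain ⟨T, hT⟩ := eventually_atTop.1 (eventually_lt_of_lt_liminf hc (by isBoundedDefault))
    obtain ⟨t, ht, hle⟩ := hE.exists_systole_le h (EReal.coe_pos.1 hc0) T
    exact absurd (EReal.coe_lt_coe_iff.1 (hT t ht)) (not_lt.2 hle)

theorem IsEarthquake.irr_iff_isCompact (hE : IsEarthquake X (lamOf lam) E) :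
    ¬ Irr lam ↔ ∃ K : Set Moduli, IsCompact K ∧ ∀ᶠ t : ℝ in atTop, (E t).toModuli ∈ K := by
  constructor
  · intro h
    obtain ⟨K, hK, h⟩ := hE.exists_isCompact h
    exact ⟨K, hK, Eventually.of_forall h⟩
  · rintro ⟨K, hK, hev⟩ h
    obtain ⟨κ, hκ, hge⟩ := exists_trace_ge_of_isCompact hK
    obtain ⟨T, hT⟩ := eventually_atTop.1 hev
    obtain ⟨t, ht, u, hu, hlt⟩ := (hE.flow h).exists_short h hκ T
    exact absurd hlt (not_lt.2 (hge _ (hT t ht) u hu))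

end Trajectory

end PuncturedTorus

theorem proposition1p2 (X : Teich) (l : SimpleCurve → ℝ) (hl : l ∈ ML) :
    (∃ E : ℝ → Teich, IsEarthquake X l E) ∧
    ∀ E : ℝ → Teich, IsEarthquake X l E →
      (IsWeightedCurve l ↔ liminf (fun t : ℝ => (systole (E t) : EReal)) atTop ≠ 0) ∧
      (IsWeightedCurve l ↔
        ∃ K : Set Moduli, IsCompact K ∧ ∀ᶠ t : ℝ in atTop, (E t).toModuli ∈ K) := by
  refine ⟨exists_isEarthquake X hl, fun E hE => ?_⟩
  obtain ⟨lam, rfl⟩ := exists_lamOf hl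
  rw [isWeightedCurve_lamOf_iff]
  exact ⟨hE.irr_iff_liminf, hE.irr_iff_isCompact⟩
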